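/- **Setting.** Let $m,k_B,n>0$, let $\delta\ge 2$ be real, $\bm u\in\mathbb R^3$, and write $\mathbb R_+=(0,\infty)$, $(f,g)=\int_{\mathbb R^3\times\mathbb R_+} fg\,\mathrm d\bm\xi\,\mathrm dI$. For $\bm\xi,\bm\xi_*,\bm\xi',\bm\xi_*'\in\mathbb R^3$ and $I,I_*,I',I_*'>0$ put $\bm g=\bm\xi-\bm\xi_*$, $\bm g'=\bm\xi'-\bm\xi'_*$, $\bm G=(\bm\xi+\bm\xi_*)/2$, $\bm G'=(\bm\xi'+\bm\xi_*')/2$, $\Delta I=I'+I_*'-I-I_*$, $\cos\phi=\bm g\cdot\bm g'/(|\bm g||\bm g'|)$. Let $\sigma_s,\sigma_r$ be measurable functions of $(|\bm g|,|\cos\phi|,I,I_*,I',I_*')$ that are positive for almost every collision and satisfy, for values compatible with $\frac m4|\bm g|^2+I+I_*=\frac m4|\bm g'|^2+I'+I_*'$ (for $\sigma_r$: with $|\bm g|=|\bm g'|$ and $\Delta I=0$), the relations $$(II_*)^{\delta/2-1}|\bm g|^2\sigma(|\bm g|,|\cos\phi|,I,I_*,I',I_*')=(I'I_*')^{\delta/2-1}|\bm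 g'|^2\sigma(|\bm g'|,|\cos\phi|,I',I_*',I,I_*),$$ $$\sigma(|\bm g|,|\cos\phi|,I,I_*,I',I_*')=\sigma(|\bm g|,|\cos\phi|,I,I_*,I_*',I')=\sigma(|\bm g|,|\cos\phi|,I_*,I,I_*',I').$$ For $0\le\theta\le1$ let $W_\theta=\theta W_s+(1-\theta)W_r$, where (the Dirac deltas being evaluated as measures in the post-collisional variables) $$W_s=(II_*)^{\delta/2-1}\sigma_s\frac{|\bm g|}{|\bm g'|^2}\,\bm\delta_3(\bm G-\bm G')\,\bm\delta_1\Big(\sqrt{|\bm g|^2-\tfrac4m\Delta I}-|\bm g'|\Big),\qquad W_r=(II_*)^{\delta/2-1}\sigma_r|\bm g|^{-1}\bm\delta_3(\bm G-\bm G')\,\bm\delta_1(|\bm g|-|\bm g'|)\,\bm\delta_1(\Delta I).$$ With $f=f(\bm\xi,I)$, $f_*=f(\bm\xi_*,I_*)$, $f'=f(\bm\xi',I')$, $f_*'=f(\bm\xi_*',I_*')$, let $$Q_\theta(f,F)=\frac12\int_{(\mathbb R^3\times\mathbb R_+)^3}\Big(\frac{f'F_*'+f_*'F'}{(I'I_*')^{\delta/2-1}}-\frac{fF_*+f_*F}{(II_*)^{\delta/2-1}}\Big)W_\theta\,\mathrm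 d\bm\xi_*\mathrm d\bm\xi'\mathrm d\bm\xi_*'\mathrm dI_*\mathrm dI'\mathrm dI_*',\qquad \mathcal L_\theta h=-2M^{-1}Q_\theta(M,Mh).$$ Here $M=M_s$ if $0<\theta\le1$ and $M=M_r$ if $\theta=0$, where for arbitrary temperatures $T,T_{tr},T_{int}>0$ $$M_r=\frac{n\,I^{\delta/2-1}}{(2\pi k_BT_{tr}/m)^{3/2}(k_BT_{int})^{\delta/2}\Gamma(\delta/2)}\exp\Big(-\frac{m|\bm\xi-\bm u|^2}{2k_BT_{tr}}-\frac{I}{k_BT_{int}}\Big),$$ and $M_s$ is the same expression with $T_{tr}=T_{int}=T$. We say that $\mathcal L_\theta h$ is defined if $h$ is measurable and the integral $Q_\theta(M,Mh)$ converges absolutely for almost every $(\bm\xi,I)$, and that the weak form $(\mathcal L_\theta h,Mg)$ is defined if the corresponding integral over $(\mathbb R^3\times\mathbb R_+)^4$ converges absolutely. **Proposition.** The linearized collision operator $\mathcal L_\theta$ is symmetric and nonnegative with respect to the weighted inner product $(\,\cdot\,,M\,\cdot\,)$: 1. if $\mathcal L_\theta h$, $\mathcal L_\theta g$ and the weak forms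 $(\mathcal L_\theta h,Mg)$, $(\mathcal L_\theta g,Mh)$ are defined, then the functions $\mathcal L_\theta h\cdot Mg$ and $Mh\cdot\mathcal L_\theta g$ are integrable and $(\mathcal L_\theta h,Mg)=(Mh,\mathcal L_\theta g)$; 2. if $\mathcal L_\theta h$ and the weak form $(\mathcal L_\theta h,Mh)$ are defined, then $\mathcal L_\theta h\cdot Mh$ is integrable and $(\mathcal L_\theta h,Mh)\ge0$. Moreover, let $\ker\mathcal L_\theta$ be the set of $h\in L^2(M\,\mathrm d\bm\xi\,\mathrm dI)$ for which $\mathcal L_\theta h$ and the weak form $(\mathcal L_\theta h,Mh)$ are defined and $\mathcal L_\theta h=0$ almost everywhere. Then, up to equality almost everywhere, $\ker\mathcal L_\theta$ is the linear span of $$\{1,\xi_x,\xi_y,\xi_z,m|\bm\xi|^2+2I\}$$ in the non-resonant case $0<\theta\le1$ (with $M=M_s$), and the linear span of $$\{1,\xi_x,\xi_y,\xi_z,|\bm\xi|^2,I\}$$ in the resonant case $\theta=0$ (with $M=M_r$). -/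

import Mathlib

open MeasureTheory Set

noncomputable section

namespace Polyatomic

/-- The velocity space `ℝ³` with its Euclidean norm. -/
abbrev Vel : Type := EuclideanSpace ℝ (Fin 3)

/-- A molecular state `(ξ, I)`: velocity and internal energy. The internal energy is positive; this
is encoded in the measure `stateMeasure`. -/
abbrev State : Type := Vel × ℝ

/-- The unit sphere `𝕊²` of directions. -/
abbrev Dir : Type := Metric.sphere (0 : Vel) 1

/-- Lebesgue measure on `ℝ₊ = (0, ∞)`. -/
def energyMeasure : Measure ℝ := volume.restrict (Ioi 0)

/-- The measure `dξ dI` on `ℝ³ × ℝ₊`. -/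
def stateMeasure : Measure State := (volume : Measure Vel).prod energyMeasure

/-- The surface measure on `𝕊²` (total mass `4π`). -/
def dirMeasure : Measure Dir := (volume : Measure Vel).toSphere

/-- The pairing `(f, g) = ∫ f g dξ dI`. -/
def pairing (f g : State → ℝ) : ℝ := ∫ x, f x * g x ∂stateMeasure

/-- Scattering cross sections `σ(|g|, |cos φ|, I, I_*, I', I_*')`. -/
abbrev CrossSection : Type := ℝ → ℝ → ℝ → ℝ → ℝ → ℝ → ℝ

/-- The cross section at a collision of `x = (ξ, I)` with `y = (ξ_*, I_*)` whose outgoing relative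
velocity `g'` has direction `ω` and whose outgoing internal energies are `I'`, `J' = I_*'`. Here
`g = ξ - ξ_*` and `|cos φ| = |g · ω| / |g|`. -/
def CrossSection.at (σ : CrossSection) (x y : State) (ω : Dir) (I' J' : ℝ) : ℝ :=
  σ ‖x.1 - y.1‖ (|inner ℝ (x.1 - y.1) (ω : Vel)| / ‖x.1 - y.1‖) x.2 y.2 I' J'

/-- `ΔI = I' + I_*' - I - I_*`. -/
def gap (x y : State) (I' J' : ℝ) : ℝ := I' + J' - x.2 - y.2

/-- The final state `((ξ_*, I_*), (ξ', I'), (ξ_*', I_*'))` of the collision of `x = (ξ, I)` with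
`y = (ξ_*, I_*)` with outgoing relative velocity `g' = q ω` (so `|g'| = q`) and the same
centre of mass velocity, `G' = G = (ξ + ξ_*) / 2`. -/
def outcome (x y : State) (q : ℝ) (ω : Dir) (I' J' : ℝ) : State × State × State :=
  (y, ((1 / 2 : ℝ) • (x.1 + y.1) + (q / 2) • (ω : Vel), I'),
    ((1 / 2 : ℝ) • (x.1 + y.1) - (q / 2) • (ω : Vel), J'))

/-- A standard collision is energetically possible iff `|g|² - (4 / m) ΔI > 0`
(up to the null set where this vanishes). -/
def Possible (m : ℝ) (x y : State) (I' J' : ℝ) : Prop :=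
  4 / m * gap x y I' J' < ‖x.1 - y.1‖ ^ 2

/-- The standing assumptions on the cross section `σ_s` of standard collisions: measurability,
positivity for almost every collision, microreversibility, and the two symmetry relations. The
relations are required for values `g = |g|`, `g' = |g'|`, `I, J = I_*`, `I', J' = I_*'` that
are compatible with conservation of the total energy. -/
structure IsStandardCrossSection (m δ : ℝ) (σ : CrossSection) : Prop where
  measurable : Measurable fun z : ℝ × ℝ × ℝ × ℝ × ℝ × ℝ =>
    σ z.1 z.2.1 z.2.2.1 z.2.2.2.1 z.2.2.2.2.1 z.2.2.2.2.2
  pos : ∀ᵐ z : State × State × Dir × ℝ × ℝ ∂(stateMeasure.prod (stateMeasure.prod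
      (dirMeasure.prod (energyMeasure.prod energyMeasure)))),
    Possible m z.1 z.2.1 z.2.2.2.1 z.2.2.2.2 →
      0 < σ.at z.1 z.2.1 z.2.2.1 z.2.2.2.1 z.2.2.2.2
  microreversible : ∀ g g' c I J I' J' : ℝ, 0 < g → 0 < g' → 0 ≤ c → c ≤ 1 →
    0 < I → 0 < J → 0 < I' → 0 < J' →
    m / 4 * g ^ 2 + I + J = m / 4 * g' ^ 2 + I' + J' →
    (I * J) ^ (δ / 2 - 1) * g ^ 2 * σ g c I J I' J'
      = (I' * J') ^ (δ / 2 - 1) * g' ^ 2 * σ g' c I' J' I J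
  symm_out : ∀ g g' c I J I' J' : ℝ, 0 < g → 0 < g' → 0 ≤ c → c ≤ 1 →
    0 < I → 0 < J → 0 < I' → 0 < J' →
    m / 4 * g ^ 2 + I + J = m / 4 * g' ^ 2 + I' + J' →
    σ g c I J I' J' = σ g c I J J' I'
  symm_both : ∀ g g' c I J I' J' : ℝ, 0 < g → 0 < g' → 0 ≤ c → c ≤ 1 →
    0 < I → 0 < J → 0 < I' → 0 < J' →
    m / 4 * g ^ 2 + I + J = m / 4 * g' ^ 2 + I' + J' →
    σ g c I J I' J' = σ g c J I J' I'

/-- The standing assumptions on the cross section `σ_r` of resonant collisions. It enters only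
through `σ_r δ₁(ΔI)`, so everything is required only where `I + I_* = I' + I_*'`; there
`|g'| = |g|`, and the factors `|g|²`, `|g'|²` in the microreversibility condition cancel. -/
structure IsResonantCrossSection (δ : ℝ) (σ : CrossSection) : Prop where
  measurable : Measurable fun z : ℝ × ℝ × ℝ × ℝ × ℝ × ℝ =>
    σ z.1 z.2.1 z.2.2.1 z.2.2.2.1 z.2.2.2.2.1 z.2.2.2.2.2
  pos : ∀ᵐ z : State × State × Dir × ℝ ∂(stateMeasure.prod (stateMeasure.prod
      (dirMeasure.prod energyMeasure))),
    z.2.2.2 < z.1.2 + z.2.1.2 →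
      0 < σ.at z.1 z.2.1 z.2.2.1 z.2.2.2 (z.1.2 + z.2.1.2 - z.2.2.2)
  microreversible : ∀ g c I J I' J' : ℝ, 0 < g → 0 ≤ c → c ≤ 1 →
    0 < I → 0 < J → 0 < I' → 0 < J' → I + J = I' + J' →
    (I * J) ^ (δ / 2 - 1) * g ^ 2 * σ g c I J I' J'
      = (I' * J') ^ (δ / 2 - 1) * g ^ 2 * σ g c I' J' I J
  symm_out : ∀ g c I J I' J' : ℝ, 0 < g → 0 ≤ c → c ≤ 1 →
    0 < I → 0 < J → 0 < I' → 0 < J' → I + J = I' + J' →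
    σ g c I J I' J' = σ g c I J J' I'
  symm_both : ∀ g c I J I' J' : ℝ, 0 < g → 0 ≤ c → c ≤ 1 →
    0 < I → 0 < J → 0 < I' → 0 < J' → I + J = I' + J' →
    σ g c I J I' J' = σ g c J I J' I'

open Classical in
/-- The measure `W_s(ξ, ξ_*, I, I_* | ξ', ξ_*', I', I_*') dξ_* dξ' dξ_*' dI_* dI' dI_*'` on triples
`((ξ_*, I_*), (ξ', I'), (ξ_*', I_*'))`, for given `x = (ξ, I)`, where
`W_s = (I I_*)^(δ/2-1) σ_s |g| |g'|⁻² δ₃(G - G') δ₁(√(|g|² - (4/m) ΔI) - |g'|)`.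
The Dirac deltas are evaluated with `dξ' dξ_*' = dG' dg' = |g'|² dG' d|g'| dω`, `ω = g' / |g'|`:
they fix `G' = G` and `|g'| = √(|g|² - (4/m) ΔI)`, and there remains the density
`(I I_*)^(δ/2-1) |g| σ_s` with respect to `dξ_* dI_* dω dI' dI_*'`. -/
def standardTransition (m δ : ℝ) (σs : CrossSection) (x : State) :
    Measure (State × State × State) :=
  ((stateMeasure.prod (dirMeasure.prod (energyMeasure.prod energyMeasure))).withDensity
    fun z : State × Dir × ℝ × ℝ =>
      if Possible m x z.1 z.2.2.1 z.2.2.2 then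
        ENNReal.ofReal ((x.2 * z.1.2) ^ (δ / 2 - 1) * ‖x.1 - z.1.1‖
          * σs.at x z.1 z.2.1 z.2.2.1 z.2.2.2)
      else 0).map
    fun z : State × Dir × ℝ × ℝ =>
      outcome x z.1 (Real.sqrt (‖x.1 - z.1.1‖ ^ 2 - 4 / m * gap x z.1 z.2.2.1 z.2.2.2))
        z.2.1 z.2.2.1 z.2.2.2

open Classical in
/-- The measure `W_r(ξ, ξ_*, I, I_* | ξ', ξ_*', I', I_*') dξ_* dξ' dξ_*' dI_* dI' dI_*'`, for given
`x = (ξ, I)`, where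
`W_r = (I I_*)^(δ/2-1) σ_r |g|⁻¹ δ₃(G - G') δ₁(|g| - |g'|) δ₁(ΔI)`. Evaluating the deltas fixes
`G' = G`, `|g'| = |g|`, `I_*' = I + I_* - I'` with `0 < I' < I + I_*`, and there remains the
density `(I I_*)^(δ/2-1) |g| σ_r` with respect to `dξ_* dI_* dω dI'`. -/
def resonantTransition (δ : ℝ) (σr : CrossSection) (x : State) :
    Measure (State × State × State) :=
  ((stateMeasure.prod (dirMeasure.prod energyMeasure)).withDensity
    fun z : State × Dir × ℝ =>
      if z.2.2 < x.2 + z.1.2 then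
        ENNReal.ofReal ((x.2 * z.1.2) ^ (δ / 2 - 1) * ‖x.1 - z.1.1‖
          * σr.at x z.1 z.2.1 z.2.2 (x.2 + z.1.2 - z.2.2))
      else 0).map
    fun z : State × Dir × ℝ =>
      outcome x z.1 ‖x.1 - z.1.1‖ z.2.1 z.2.2 (x.2 + z.1.2 - z.2.2)

/-- `W_θ = θ W_s + (1 - θ) W_r`, as a measure for given `x = (ξ, I)`. -/
def transition (m δ : ℝ) (σs σr : CrossSection) (θ : ℝ) (x : State) :
    Measure (State × State × State) :=
  ENNReal.ofReal θ • standardTransition m δ σs x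
    + ENNReal.ofReal (1 - θ) • resonantTransition δ σr x

/-- `(f' F_*' + f_*' F') / (I' I_*')^(δ/2-1) - (f F_* + f_* F) / (I I_*)^(δ/2-1)`, where `p` is the
triple `((ξ_*, I_*), (ξ', I'), (ξ_*', I_*'))`. -/
def collisionIntegrand (δ : ℝ) (f F : State → ℝ) (x : State) (p : State × State × State) : ℝ :=
  (f p.2.1 * F p.2.2 + f p.2.2 * F p.2.1) / (p.2.1.2 * p.2.2.2) ^ (δ / 2 - 1)
    - (f x * F p.1 + f p.1 * F x) / (x.2 * p.1.2) ^ (δ / 2 - 1)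

/-- The bilinear collision operator `Q_θ(f, F)`. -/
def collisionOp (m δ : ℝ) (σs σr : CrossSection) (θ : ℝ) (f F : State → ℝ) (x : State) : ℝ :=
  1 / 2 * ∫ p, collisionIntegrand δ f F x p ∂(transition m δ σs σr θ x)

/-- The equilibrium distribution `M_s` with number density `n`, flow velocity `u` and
temperature `T`. -/
def maxwellianS (m δ kB n : ℝ) (u : Vel) (T : ℝ) (x : State) : ℝ :=
  n * x.2 ^ (δ / 2 - 1)
    / ((2 * Real.pi * kB * T / m) ^ (3 / 2 : ℝ) * (kB * T) ^ (δ / 2) * Real.Gamma (δ / 2))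
    * Real.exp (-((m * ‖x.1 - u‖ ^ 2 + 2 * x.2) / (2 * kB * T)))

/-- The equilibrium distribution `M_r` with number density `n`, flow velocity `u`, translational
temperature `Ttr` and internal temperature `Tint`. -/
def maxwellianR (m δ kB n : ℝ) (u : Vel) (Ttr Tint : ℝ) (x : State) : ℝ :=
  n * x.2 ^ (δ / 2 - 1)
    / ((2 * Real.pi * kB * Ttr / m) ^ (3 / 2 : ℝ) * (kB * Tint) ^ (δ / 2) * Real.Gamma (δ / 2))
    * Real.exp (-(m * ‖x.1 - u‖ ^ 2 / (2 * kB * Ttr)) - x.2 / (kB * Tint))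

/-- The linearized collision operator `𝓛_θ h = -2 M⁻¹ Q_θ(M, M h)`. -/
def linOp (m δ : ℝ) (σs σr : CrossSection) (θ : ℝ) (M h : State → ℝ) (x : State) : ℝ :=
  -2 * (M x)⁻¹ * collisionOp m δ σs σr θ M (fun y => M y * h y) x

/-- `𝓛_θ h` is defined: `h` is measurable and the integral defining `(𝓛_θ h)(x)` converges
absolutely for almost every `x`. -/
def LinOpDefined (m δ : ℝ) (σs σr : CrossSection) (θ : ℝ) (M h : State → ℝ) : Prop :=
  AEMeasurable h stateMeasure ∧
    ∀ᵐ x ∂stateMeasure, Integrable (collisionIntegrand δ M (fun y => M y * h y) x)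
      (transition m δ σs σr θ x)

/-- The integral over all collisions that is the weak form `(𝓛_θ h, M g)` is defined, that is, it
converges absolutely. -/
def WeakFormDefined (m δ : ℝ) (σs σr : CrossSection) (θ : ℝ) (M h g : State → ℝ) : Prop :=
  ∫⁻ x, ∫⁻ p, ‖collisionIntegrand δ M (fun y => M y * h y) x p * g x‖ₑ
    ∂(transition m δ σs σr θ x) ∂stateMeasure < ⊤

/-- `𝓛_θ` is symmetric with respect to `(·, M ·)`: both pairings exist and agree, whenever the
operator and the weak forms are defined. -/
def LinOpSymmetric (m δ : ℝ) (σs σr : CrossSection) (θ : ℝ) (M : State → ℝ) : Prop :=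
  ∀ h g : State → ℝ,
    LinOpDefined m δ σs σr θ M h → LinOpDefined m δ σs σr θ M g →
    WeakFormDefined m δ σs σr θ M h g → WeakFormDefined m δ σs σr θ M g h →
    Integrable (fun x => linOp m δ σs σr θ M h x * (M x * g x)) stateMeasure ∧
    Integrable (fun x => M x * h x * linOp m δ σs σr θ M g x) stateMeasure ∧
    pairing (linOp m δ σs σr θ M h) (fun x => M x * g x)
      = pairing (fun x => M x * h x) (linOp m δ σs σr θ M g)

/-- `𝓛_θ` is nonnegative with respect to `(·, M ·)`. -/
def LinOpNonneg (m δ : ℝ) (σs σr : CrossSection) (θ : ℝ) (M : State → ℝ) : Prop :=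
  ∀ h : State → ℝ,
    LinOpDefined m δ σs σr θ M h → WeakFormDefined m δ σs σr θ M h h →
    Integrable (fun x => linOp m δ σs σr θ M h x * (M x * h x)) stateMeasure ∧
    0 ≤ pairing (linOp m δ σs σr θ M h) (fun x => M x * h x)

/-- The kernel of `𝓛_θ`: the functions `h ∈ L²(M dξ dI)` for which `𝓛_θ h` and the quadratic form
`(𝓛_θ h, M h)` are defined and `𝓛_θ h = 0` almost everywhere. -/
def linOpKernel (m δ : ℝ) (σs σr : CrossSection) (θ : ℝ) (M : State → ℝ) : Set (State → ℝ) :=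
  {h | MemLp h 2 (stateMeasure.withDensity fun x => ENNReal.ofReal (M x)) ∧
    LinOpDefined m δ σs σr θ M h ∧ WeakFormDefined m δ σs σr θ M h h ∧
    ∀ᵐ x ∂stateMeasure, linOp m δ σs σr θ M h x = 0}

/-- The functions that agree almost everywhere with a linear combination of members of `S`. -/
def generatedBy (S : Set (State → ℝ)) : Set (State → ℝ) :=
  {h | ∃ φ ∈ Submodule.span ℝ S, h =ᵐ[stateMeasure] φ}

end Polyatomic

end

/-! Put `w = M M_* / (I I_*)^(δ/2-1)` and let `increment h` be the total of `h` over the outgoing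
molecules minus its total over the incoming ones. For a Maxwellian the powers of the internal
energies cancel in `w`, and the remaining exponential depends only on conserved quantities. Hence
the gain and loss terms carry the same weight, and the linearized collision integrand is `w *
increment h` (detailed balance).

The measure on collisions `(x, y, x', y')` is invariant under exchange of the incoming molecules and
under time reversal. The first follows from the two symmetry relations of the cross sections. The
second follows from microreversibility together with a change of variables in centre of mass
coordinates, where `r dr = q dq` relates the relative speeds. Averaging the weak form over these
symmetries gives `(𝓛h, Mg) = 1/4 ∫ w * increment h * increment g`, which is symmetric in `h` and `g`
and nonnegative for `g = h` (`DetailedBalance.weakForm_eq`, `DetailedBalance.pairing_eq`).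

If `𝓛h = 0`, the quadratic form vanishes, and positivity of the weight and of the cross sections
makes `h` a collision invariant almost everywhere. Since `h` is square integrable with weight `M`,
it is locally integrable away from zero internal energy. Translating all velocities by one vector
and all internal energies by one number commutes with collisions, so mollifications of `h` are
smooth invariants, everywhere above a cutoff (`mollify_invariant`). Smooth invariants are found by
differentiation: the energy derivative is constant, and the velocity gradient is affine with linear
part a multiple of the identity (`exists_eq_of_resonant`). These functions form a finite-dimensional
space, which is closed under pointwise limits, so removing the mollification and the cutoff stays
inside it. If standard collisions occur, a single inelastic collision ties the coefficient of `|ξ|²`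
to that of `I`.

Conversely the listed functions are conserved in every relevant collision and square integrable
against `M`, so the integrand vanishes on them. -/

noncomputable section
-- Differentiable collision invariants
namespace Polyatomic

/-- Derivatives of a function with the elastic collision symmetry agree orthogonally to `ξ - η`. -/
theorem fderiv_apply_eq_of_elastic {a : Vel → ℝ} (ha : Differentiable ℝ a)
    (h : ∀ ξ η ω : Vel, ξ ≠ η → ‖ω‖ = 1 →
      a ξ + a η = a ((1 / 2 : ℝ) • (ξ + η) + (‖ξ - η‖ / 2) • ω)
        + a ((1 / 2 : ℝ) • (ξ + η) - (‖ξ - η‖ / 2) • ω))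
    {ξ η e : Vel} (hne : ξ ≠ η) (he : inner ℝ (ξ - η) e = (0 : ℝ)) :
    fderiv ℝ a ξ e = fderiv ℝ a η e := by
  have hg : 0 < ‖ξ - η‖ := norm_pos_iff.2 (sub_ne_zero.2 hne)
  rcases eq_or_ne e 0 with rfl | he0
  · simp
  have hepos : 0 < ‖e‖ := norm_pos_iff.2 he0
  -- Rescaling `e` to the length of `ξ - η` makes the curve `c` below a great circle on the sphere
  -- of admissible relative velocities.
  set f : Vel := (‖ξ - η‖ / ‖e‖) • e with hf
  have hfn : ‖f‖ = ‖ξ - η‖ := by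
    rw [hf, norm_smul, Real.norm_of_nonneg (by positivity), div_mul_cancel₀ _ hepos.ne']
  have hgf : inner ℝ (ξ - η) f = (0 : ℝ) := by rw [hf, inner_smul_right, he, mul_zero]
  suffices hs : fderiv ℝ a ξ f = fderiv ℝ a η f by
    simp only [hf, map_smul, smul_eq_mul] at hs
    exact mul_left_cancel₀ (div_pos hg hepos).ne' hs
  let c : ℝ → Vel := fun t => Real.cos t • (ξ - η) + Real.sin t • f
  have hc : ∀ t, ‖c t‖ = ‖ξ - η‖ := fun t => by
    have h2 : ‖c t‖ ^ 2 = ‖ξ - η‖ ^ 2 := by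
      simp only [c]
      rw [norm_add_sq_real, norm_smul, norm_smul, inner_smul_left, inner_smul_right, hgf, hfn,
        mul_pow, mul_pow, Real.norm_eq_abs, Real.norm_eq_abs, sq_abs, sq_abs]
      have := Real.sin_sq_add_cos_sq t
      simp only [mul_zero, add_zero]
      linear_combination ‖ξ - η‖ ^ 2 * this
    exact (sq_eq_sq₀ (norm_nonneg _) (norm_nonneg _)).1 h2
  have hcd : HasDerivAt c f 0 := by
    have h1 : HasDerivAt c _ 0 := ((Real.hasDerivAt_cos 0).smul_const (ξ - η)).add
      ((Real.hasDerivAt_sin 0).smul_const f)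
    simpa using h1
  have hc0 : c 0 = ξ - η := by simp [c]
  have hp0 : (1 / 2 : ℝ) • (ξ + η) + (1 / 2 : ℝ) • c 0 = ξ := by rw [hc0]; module
  have hq0 : (1 / 2 : ℝ) • (ξ + η) - (1 / 2 : ℝ) • c 0 = η := by rw [hc0]; module
  have hp : HasDerivAt (fun t => (1 / 2 : ℝ) • (ξ + η) + (1 / 2 : ℝ) • c t) ((1 / 2 : ℝ) • f) 0 :=
    (hcd.const_smul (1 / 2 : ℝ)).const_add _
  have hq : HasDerivAt (fun t => (1 / 2 : ℝ) • (ξ + η) - (1 / 2 : ℝ) • c t)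
      (-((1 / 2 : ℝ) • f)) 0 :=
    (hcd.const_smul (1 / 2 : ℝ)).const_sub _
  -- The outgoing velocities `G ± c t / 2` pass through `ξ` and `η` at `t = 0`, with velocities `±f
  -- / 2`. Along them the sum of the values of `a` is constant, so its derivative vanishes.
  have hap := (ha ((1 / 2 : ℝ) • (ξ + η) + (1 / 2 : ℝ) • c 0)).hasFDerivAt.comp_hasDerivAt 0 hp
  have haq := (ha ((1 / 2 : ℝ) • (ξ + η) - (1 / 2 : ℝ) • c 0)).hasFDerivAt.comp_hasDerivAt 0 hq
  rw [hp0] at hap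
  rw [hq0] at haq
  have hsum := hap.add haq
  have hconst : (a ∘ (fun t => (1 / 2 : ℝ) • (ξ + η) + (1 / 2 : ℝ) • c t))
      + (a ∘ fun t => (1 / 2 : ℝ) • (ξ + η) - (1 / 2 : ℝ) • c t) = fun _ => a ξ + a η := by
    funext t
    have h1 := h ξ η (‖ξ - η‖⁻¹ • c t) hne (by
      rw [norm_smul, hc, norm_inv, norm_norm, inv_mul_cancel₀ hg.ne'])
    have h2 : (‖ξ - η‖ / 2) • (‖ξ - η‖⁻¹ • c t) = (1 / 2 : ℝ) • c t := by
      rw [smul_smul]; congr 1; field_simp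
    rw [h2] at h1
    simp [h1]
  rw [hconst] at hsum
  have h0 := hsum.unique (hasDerivAt_const (0 : ℝ) (a ξ + a η))
  simp only [map_smul, map_neg, smul_eq_mul] at h0
  linarith

/-- Differentiable collision invariants of elastic monatomic collisions. -/
theorem exists_eq_quadratic_of_elastic {a : Vel → ℝ} (ha : Differentiable ℝ a)
    (h : ∀ ξ η ω : Vel, ξ ≠ η → ‖ω‖ = 1 →
      a ξ + a η = a ((1 / 2 : ℝ) • (ξ + η) + (‖ξ - η‖ / 2) • ω)
        + a ((1 / 2 : ℝ) • (ξ + η) - (‖ξ - η‖ / 2) • ω)) :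
    ∃ (α γ : ℝ) (β : Vel →L[ℝ] ℝ), ∀ ξ, a ξ = α * ‖ξ‖ ^ 2 + β ξ + γ := by
  have key := fun {ξ η e : Vel} => fderiv_apply_eq_of_elastic ha h (ξ := ξ) (η := η) (e := e)
  set b : Vel → Vel →L[ℝ] ℝ := fun ξ => fderiv ℝ a ξ - fderiv ℝ a 0 with hb
  set l : Vel → ℝ := fun ξ => b ξ ξ / ‖ξ‖ ^ 2 with hl
  -- Comparison with the point `0` shows that `b ξ` vanishes on the orthogonal complement of `ξ`, so
  -- it is a multiple of the inner product with `ξ`.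
  have hbl : ∀ ξ, ξ ≠ 0 → ∀ w, b ξ w = l ξ * inner ℝ ξ w := by
    intro ξ hξ w
    have hn : ‖ξ‖ ^ 2 ≠ 0 := pow_ne_zero _ (norm_ne_zero_iff.2 hξ)
    have h1 : b ξ (w - (inner ℝ ξ w / ‖ξ‖ ^ 2) • ξ) = 0 := by
      have := @key ξ 0 (w - (inner ℝ ξ w / ‖ξ‖ ^ 2) • ξ) hξ (by
        rw [sub_zero, inner_sub_right, inner_smul_right, real_inner_self_eq_norm_sq]
        field_simp; simp)
      simp only [hb, sub_apply]
      rw [this, sub_self]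
    rw [map_sub, map_smul, smul_eq_mul, sub_eq_zero] at h1
    rw [h1, hl]; field_simp
  have horth : ∀ ξ η : Vel, ξ ≠ 0 → η ≠ 0 → inner ℝ ξ η = (0 : ℝ) → l ξ = l η := by
    intro ξ η hξ hη ho
    have ho' : inner ℝ η ξ = (0 : ℝ) := by rw [real_inner_comm]; exact ho
    have hne : ξ ≠ η := by
      rintro rfl
      exact hξ (inner_self_eq_zero.1 ho)
    -- For orthogonal `ξ` and `η` this vector is orthogonal to `ξ - η`, and its inner products with
    -- `ξ` and with `η` are both `‖ξ‖² ‖η‖²`.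
    have h1 := @key ξ η (‖η‖ ^ 2 • ξ + ‖ξ‖ ^ 2 • η) hne (by
      simp only [inner_sub_left, inner_add_right, inner_smul_right, ho, ho',
        real_inner_self_eq_norm_sq]
      ring)
    have h2 : b ξ (‖η‖ ^ 2 • ξ + ‖ξ‖ ^ 2 • η) = b η (‖η‖ ^ 2 • ξ + ‖ξ‖ ^ 2 • η) := by
      simp only [hb, sub_apply, h1]
    rw [hbl ξ hξ, hbl η hη] at h2
    simp only [inner_add_right, inner_smul_right, ho, ho', real_inner_self_eq_norm_sq, mul_zero,
      add_zero, zero_add] at h2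
    have h3 : ‖ξ‖ ^ 2 * ‖η‖ ^ 2 ≠ 0 := mul_ne_zero (pow_ne_zero _ (norm_ne_zero_iff.2 hξ))
      (pow_ne_zero _ (norm_ne_zero_iff.2 hη))
    apply mul_right_cancel₀ h3
    linear_combination h2
  have hconst : ∀ ξ η : Vel, ξ ≠ 0 → η ≠ 0 → l ξ = l η := by
    intro ξ η hξ hη
    -- In dimension three two vectors leave room for a nonzero `w` orthogonal to both, which links
    -- `l ξ` to `l η` through `l w`.
    have hs : (Submodule.span ℝ (({ξ, η} : Finset Vel) : Set Vel))ᗮ ≠ ⊥ := by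
      intro hbot
      rw [Submodule.orthogonal_eq_bot_iff] at hbot
      have h1 := finrank_span_finset_le_card (R := ℝ) ({ξ, η} : Finset Vel)
      have h2 := Finset.card_le_two (a := ξ) (b := η)
      have h3 : Module.finrank ℝ (⊤ : Submodule ℝ Vel) = 3 := by simp
      rw [Set.finrank, hbot, h3] at h1
      omega
    obtain ⟨w, hw, hw0⟩ := Submodule.exists_mem_ne_zero_of_ne_bot hs
    rw [Submodule.mem_orthogonal] at hw
    exact (horth ξ w hξ hw0 (hw ξ (Submodule.subset_span (by simp)))).trans
      (horth η w hη hw0 (hw η (Submodule.subset_span (by simp)))).symm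
  obtain ⟨e, he⟩ := exists_ne (0 : Vel)
  have hfd : ∀ ξ w, fderiv ℝ a ξ w = fderiv ℝ a 0 w + l e * inner ℝ ξ w := by
    intro ξ w
    rcases eq_or_ne ξ 0 with rfl | hξ
    · simp
    · rw [← hconst ξ e hξ he, ← hbl ξ hξ]; simp [hb]
  refine ⟨l e / 2, a 0, fderiv ℝ a 0, fun ξ => ?_⟩
  -- The gradient of `a` is now affine in `ξ`. Subtracting its primitive leaves a function with zero
  -- derivative.
  let r : Vel → ℝ := fun ξ => a ξ - (l e / 2) * ‖ξ‖ ^ 2 - fderiv ℝ a 0 ξ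
  have hr : ∀ ξ, HasFDerivAt r (0 : Vel →L[ℝ] ℝ) ξ := by
    intro ξ
    have h1 := ((ha ξ).hasFDerivAt.sub
      (((hasStrictFDerivAt_norm_sq ξ).hasFDerivAt).const_mul (l e / 2))).sub
      (fderiv ℝ a 0).hasFDerivAt
    convert! h1 using 1
    ext1 w
    simp [hfd ξ w]
    ring
  have hz := is_const_of_fderiv_eq_zero (fun ξ => (hr ξ).differentiableAt)
    (fun ξ => (hr ξ).fderiv) ξ 0
  simp only [r, norm_zero, map_zero] at hz
  linarith

/-- Differentiable functions of `(ξ, I)` that are invariants of resonant collisions of molecules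
with internal energies above `κ`. -/
theorem exists_eq_of_resonant {F : State → ℝ} (hF : Differentiable ℝ F) (κ : ℝ)
    (h : ∀ (x y : State) (ω : Vel) (I' J' : ℝ), x.1 ≠ y.1 → ‖ω‖ = 1 → κ < x.2 → κ < y.2 →
      κ < I' → κ < J' → I' + J' = x.2 + y.2 →
      F x + F y = F ((1 / 2 : ℝ) • (x.1 + y.1) + (‖x.1 - y.1‖ / 2) • ω, I')
        + F ((1 / 2 : ℝ) • (x.1 + y.1) - (‖x.1 - y.1‖ / 2) • ω, J')) :
    ∃ (c α γ : ℝ) (β : Vel →L[ℝ] ℝ), ∀ x : State, κ < x.2 →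
      F x = c * x.2 + α * ‖x.1‖ ^ 2 + β x.1 + γ := by
  -- Choosing `ω` along the incoming relative velocity leaves both velocities unchanged, so the
  -- collision only transfers internal energy.
  have hexch : ∀ (ξ η : Vel) (I J t : ℝ), ξ ≠ η → κ < I → κ < J → κ < I + t → κ < J - t →
      F (ξ, I) + F (η, J) = F (ξ, I + t) + F (η, J - t) := by
    intro ξ η I J t hne hI hJ hI' hJ'
    have hg : 0 < ‖ξ - η‖ := norm_pos_iff.2 (sub_ne_zero.2 hne)
    have h1 := h (ξ, I) (η, J) (‖ξ - η‖⁻¹ • (ξ - η)) (I + t) (J - t) hne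
      (by rw [norm_smul, norm_inv, norm_norm, inv_mul_cancel₀ hg.ne']) hI hJ hI' hJ' (by simp)
    have h2 : (‖ξ - η‖ / 2) • (‖ξ - η‖⁻¹ • (ξ - η)) = (1 / 2 : ℝ) • (ξ - η) := by
      rw [smul_smul]; congr 1; field_simp
    have e1 : (1 / 2 : ℝ) • (ξ + η) + (1 / 2 : ℝ) • (ξ - η) = ξ := by module
    have e2 : (1 / 2 : ℝ) • (ξ + η) - (1 / 2 : ℝ) • (ξ - η) = η := by module
    simpa only [h2, e1, e2] using h1
  -- `F (ξ, I + t) - F (ξ, I)` does not depend on the base point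
  have hincr : ∀ (ξ η : Vel) (I J t : ℝ), κ < I → κ < J → 0 ≤ t →
      F (ξ, I + t) - F (ξ, I) = F (η, J + t) - F (η, J) := by
    have hne : ∀ (ξ η : Vel) (I J t : ℝ), ξ ≠ η → κ < I → κ < J → 0 ≤ t →
        F (ξ, I + t) - F (ξ, I) = F (η, J + t) - F (η, J) := by
      intro ξ η I J t hne hI hJ ht
      have h1 := hexch ξ η I (J + t) t hne hI (by linarith) (by linarith) (by linarith)
      rw [add_sub_cancel_right] at h1
      linarith
    intro ξ η I J t hI hJ ht
    -- A third velocity removes the restriction `ξ ≠ η`, in particular when both base points have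
    -- the same velocity.
    obtain ⟨e, he⟩ : ∃ e : Vel, e ≠ ξ ∧ e ≠ η := by
      have hinf : Set.Infinite (univ : Set Vel) := Set.infinite_univ
      obtain ⟨e, -, he⟩ := hinf.exists_notMem_finset {ξ, η}
      exact ⟨e, by simpa using he⟩
    rw [hne ξ e I J t he.1.symm hI hJ ht, hne e η J J t he.2 hJ hJ ht]
  set I₀ := κ + 1 with hI₀
  set L : ℝ → ℝ := fun t => F (0, I₀ + t) - F (0, I₀) with hL
  have hder : ∀ I, κ < I → HasDerivAt (fun s => F (0, s)) (deriv (fun s => F (0, s)) I₀) I := by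
    have hd : Differentiable ℝ (fun s : ℝ => F (0, s)) := by fun_prop
    intro I hI
    have h1 : HasDerivAt (fun t => F (0, I₀ + t)) (deriv (fun s => F (0, s)) I₀) 0 := by
      have := (hd I₀).hasDerivAt
      rw [← add_zero I₀] at this
      simpa using this.comp_const_add I₀ 0
    have h2 : HasDerivAt (fun t => F (0, I + t)) (deriv (fun s => F (0, s)) I) 0 := by
      have := (hd I).hasDerivAt
      rw [← add_zero I] at this
      simpa using this.comp_const_add I 0
    have h3 : deriv (fun s => F (0, s)) I = deriv (fun s => F (0, s)) I₀ := by
      -- Increments are compared only for `t ≥ 0`. One-sided derivatives suffice, because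
      -- derivatives within `Ici 0` are unique at `0`.
      have h2' := (h2.sub_const (F (0, I))).hasDerivWithinAt (s := Ici 0)
      have h1' := (h1.sub_const (F (0, I₀))).hasDerivWithinAt (s := Ici 0)
      refine (uniqueDiffOn_Ici (0 : ℝ) 0 self_mem_Ici).eq_deriv _ h2' ?_
      refine h1'.congr (fun t ht => ?_) (by simp)
      exact hincr 0 0 I I₀ t hI (by linarith) ht
    rw [← h3]
    exact (hd I).hasDerivAt
  set c := deriv (fun s => F (0, s)) I₀ with hc
  have hlin0 : ∀ I, κ < I → F (0, I) = F (0, I₀) + c * (I - I₀) := by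
    intro I hI
    have h1 : ∀ s ∈ Ioi κ, HasDerivWithinAt (fun s => F (0, s) - c * s) 0 (Ioi κ) s := by
      intro s hs
      have : HasDerivAt (fun s => F (0, s) - c * s) _ s :=
        (hder s hs).sub ((hasDerivAt_id s).const_mul c)
      simpa using this.hasDerivWithinAt (s := Ioi κ)
    have h2 := (convex_Ioi κ).is_const_of_fderivWithin_eq_zero (𝕜 := ℝ)
      (fun s hs => (h1 s hs).differentiableWithinAt)
      (fun s hs => by
        have := (h1 s hs).hasFDerivWithinAt.fderivWithin
          ((isOpen_Ioi.uniqueDiffOn) s hs)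
        rw [this]; ext; simp) hI (show κ < I₀ by linarith)
    linarith
  have hlin : ∀ (ξ : Vel) (I : ℝ), κ < I → F (ξ, I) = F (ξ, I₀) + c * (I - I₀) := by
    intro ξ I hI
    rcases le_total I₀ I with hle | hle
    · have h1 := hincr ξ 0 I₀ I₀ (I - I₀) (by linarith) (by linarith) (by linarith)
      rw [add_sub_cancel, hlin0 I hI] at h1
      linarith
    · have h1 := hincr ξ 0 I I (I₀ - I) hI hI (by linarith)
      rw [add_sub_cancel, hlin0 I hI] at h1
      linarith
  -- With all four internal energies equal to `I₀` the resonant collision is an elastic monatomic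
  -- one.
  obtain ⟨α, γ, β, hβ⟩ := exists_eq_quadratic_of_elastic (a := fun ξ => F (ξ, I₀))
    (by fun_prop) (fun ξ η ω hne hω => h (ξ, I₀) (η, I₀) ω I₀ I₀ hne hω
      (by simp [hI₀]) (by simp [hI₀]) (by simp [hI₀]) (by simp [hI₀]) rfl)
  refine ⟨c, α, γ - c * I₀, β, fun x hx => ?_⟩
  have h1 := hlin x.1 x.2 hx
  have h2 := hβ x.1
  rw [h2] at h1
  rw [h1]; ring

end Polyatomic
-- Mollification: from almost every collision to every collision
namespace Polyatomic

open Filter Topology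

instance : (volume : Measure State).IsAddHaarMeasure :=
  Measure.prod.instIsAddHaarMeasure (volume : Measure Vel) (volume : Measure ℝ)

/-- Pointwise limits of members of a finite-dimensional function space. -/
theorem exists_mem_eqOn_of_tendsto {α : Type*} (V : Submodule ℝ (α → ℝ)) [FiniteDimensional ℝ V]
    (S : Set α) (p : ℕ → α → ℝ) (hp : ∀ n, p n ∈ V) (f : α → ℝ)
    (hf : ∀ x ∈ S, Tendsto (fun n => p n x) atTop (𝓝 (f x))) : ∃ q ∈ V, EqOn f q S := by
  let r : (α → ℝ) →ₗ[ℝ] (S → ℝ) := LinearMap.funLeft ℝ ℝ ((↑) : S → α)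
  -- Pointwise convergence on `S` is convergence in the product topology of `S → ℝ`, where a
  -- finite-dimensional subspace is closed.
  have hcl : IsClosed (V.map r : Set (S → ℝ)) := Submodule.closed_of_finiteDimensional _
  have hmem : r f ∈ V.map r := by
    refine hcl.mem_of_tendsto (b := atTop) (f := fun n => r (p n)) ?_
      (Eventually.of_forall fun n => Submodule.mem_map_of_mem (hp n))
    rw [tendsto_pi_nhds]
    exact fun x => hf x x.2
  obtain ⟨q, hq, hqf⟩ := hmem
  exact ⟨q, hq, fun x hx => (congrFun hqf ⟨x, hx⟩).symm⟩

theorem stateMeasure_eq_restrict :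
    stateMeasure = (volume : Measure State).restrict (Prod.snd ⁻¹' Ioi 0) := by
  have h1 := Measure.prod_restrict (μ := (volume : Measure Vel)) (ν := (volume : Measure ℝ))
    univ (Ioi 0)
  rw [Measure.restrict_univ, Set.univ_prod] at h1
  exact h1

theorem ae_stateMeasure_iff {P : State → Prop} :
    (∀ᵐ x ∂stateMeasure, P x) ↔ ∀ᵐ x : State, 0 < x.2 → P x := by
  rw [stateMeasure_eq_restrict, ae_restrict_iff' (measurable_snd measurableSet_Ioi)]
  rfl

/-- The part of a function on internal energies above `κ`. -/
def above (κ : ℝ) (h : State → ℝ) : State → ℝ := {x : State | κ < x.2}.indicator h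

/-- Mollification of `above κ h`. -/
def mollify (φ : ContDiffBump (0 : State)) (κ : ℝ) (h : State → ℝ) : State → ℝ :=
  convolution (φ.normed volume) (above κ h) (ContinuousLinearMap.lsmul ℝ ℝ) volume

theorem contDiff_mollify (φ : ContDiffBump (0 : State)) {κ : ℝ} {h : State → ℝ}
    (hloc : LocallyIntegrable (above κ h)) : ContDiff ℝ 1 (mollify φ κ h) :=
  φ.hasCompactSupport_normed.contDiff_convolution_left (n := 1) _ φ.contDiff_normed hloc

theorem integrable_mollify (φ : ContDiffBump (0 : State)) {κ : ℝ} {h : State → ℝ}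
    (hloc : LocallyIntegrable (above κ h)) (x : State) :
    Integrable fun t => φ.normed volume t * above κ h (x - t) :=
  φ.hasCompactSupport_normed.convolutionExists_left (L := ContinuousLinearMap.lsmul ℝ ℝ)
    φ.continuous_normed hloc x

theorem mollify_apply (φ : ContDiffBump (0 : State)) (κ : ℝ) (h : State → ℝ) (x : State) :
    mollify φ κ h x = ∫ t, φ.normed volume t * above κ h (x - t) := rfl

/-- If all mollifications of `h` lie in a finite-dimensional space on high energies, so does `h`. -/
theorem exists_mem_ae_eq_of_mollify (V : Submodule ℝ (State → ℝ)) [FiniteDimensional ℝ V]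
    {h : State → ℝ} (hloc : ∀ κ, 0 < κ → LocallyIntegrable (above κ h))
    (hV : ∀ κ, 0 < κ → ∀ φ : ContDiffBump (0 : State), φ.rOut ≤ κ →
      ∃ p ∈ V, ∀ x : State, κ + κ < x.2 → mollify φ κ h x = p x) :
    ∃ p ∈ V, h =ᵐ[stateMeasure] p := by
  have hstep : ∀ κ, 0 < κ → ∃ q ∈ V, ∀ᵐ x : State, κ + κ < x.2 → h x = q x := by
    intro κ hκ
    -- The outer radii tend to zero while never exceeding the cutoff margin `κ`. The constant ratio
    -- 2 of the radii is what almost everywhere convergence of the mollifications requires.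
    let φ : ℕ → ContDiffBump (0 : State) := fun n =>
      ⟨κ / (n + 2), 2 * (κ / (n + 2)), by positivity, by
        have : 0 < κ / (n + 2) := by positivity
        linarith⟩
    have hφ : ∀ n, (φ n).rOut ≤ κ := fun n => by
      change 2 * (κ / (n + 2)) ≤ κ
      rw [← mul_div_assoc, div_le_iff₀ (by positivity)]
      nlinarith [hκ, (Nat.cast_nonneg n : (0 : ℝ) ≤ n), mul_nonneg hκ.le (Nat.cast_nonneg n : (0 : ℝ) ≤ n)]
    choose p hp hpe using fun n => hV κ hκ (φ n) (hφ n)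
    have hlim : Tendsto (fun n => (φ n).rOut) atTop (𝓝 0) := by
      change Tendsto (fun n : ℕ => 2 * (κ / ((n : ℝ) + 2))) atTop (𝓝 0)
      have h1 : Tendsto (fun n : ℕ => (n : ℝ) + 2) atTop atTop :=
        tendsto_atTop_add_const_right _ _ tendsto_natCast_atTop_atTop
      simpa using (h1.const_div_atTop κ).const_mul 2
    have hae := ContDiffBump.ae_convolution_tendsto_right_of_locallyIntegrable (K := 2) hlim
      (Eventually.of_forall fun n => le_rfl) (hloc κ hκ)
    obtain ⟨q, hq, hqe⟩ := exists_mem_eqOn_of_tendsto V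
      {x | (κ + κ < x.2) ∧ Tendsto (fun n => mollify (φ n) κ h x) atTop (𝓝 (above κ h x))}
      p hp (above κ h) (fun x hx => hx.2.congr fun n => hpe n x hx.1)
    refine ⟨q, hq, ?_⟩
    filter_upwards [hae] with x hx hxκ
    have h1 := hqe (show x ∈ _ from ⟨hxκ, hx⟩)
    rwa [above, indicator_of_mem (show x ∈ {x : State | κ < x.2} from by
      change κ < x.2; linarith)] at h1
  -- Cutoffs shrinking to zero exhaust the positive energies. At almost every state `h` eventually
  -- equals `q n`, so the closedness argument applies again to a sequence that is eventually
  -- constant at each such point.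
  choose q hq hqe using fun n : ℕ => hstep (1 / (n + 1)) (by positivity)
  have hall := ae_all_iff.2 hqe
  obtain ⟨p, hp, hpe⟩ := exists_mem_eqOn_of_tendsto V
    {x | 0 < x.2 ∧ ∀ n : ℕ, (1 / ((n : ℝ) + 1) + 1 / (n + 1) < x.2 → h x = q n x)} q hq h (by
      rintro x ⟨hx0, hx⟩
      refine tendsto_const_nhds.congr' ?_
      have h1 : Tendsto (fun n : ℕ => 1 / ((n : ℝ) + 1) + 1 / (n + 1)) atTop (𝓝 (0 + 0)) :=
        tendsto_one_div_add_atTop_nhds_zero_nat.add tendsto_one_div_add_atTop_nhds_zero_nat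
      rw [add_zero] at h1
      filter_upwards [h1.eventually (gt_mem_nhds hx0)] with n hn using hx n hn)
  refine ⟨p, hp, ae_stateMeasure_iff.2 ?_⟩
  filter_upwards [hall] with x hx hx0 using hpe ⟨hx0, hx⟩

/-- A collision invariance that holds almost everywhere on a space of collisions which is
invariant under translations of all states passes to mollifications, everywhere. -/
theorem mollify_invariant {Z : Type*} [TopologicalSpace Z] [MeasurableSpace Z]
    {ν : Measure Z} [SFinite ν] [ν.IsOpenPosMeasure]
    {τ : State → Z → Z} (hτ : Measurable (Function.uncurry τ))
    (hτν : ∀ t, MeasurePreserving (τ t) ν ν) {X : Fin 4 → Z → State}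
    (hX : ∀ i, Continuous (X i)) (hXτ : ∀ i t z, X i (τ t z) = X i z + t)
    {U : Set Z} (hU : IsOpen U) (hUτ : ∀ t z, z ∈ U → τ t z ∈ U)
    {κ ε : ℝ} {h : State → ℝ} (hloc : LocallyIntegrable (above κ h))
    (hrel : ∀ᵐ z ∂ν, z ∈ U → (∀ i, κ < (X i z).2) →
      h (X 0 z) + h (X 1 z) = h (X 2 z) + h (X 3 z))
    {φ : ContDiffBump (0 : State)} (hφ : φ.rOut ≤ ε) {z : Z} (hz : z ∈ U)
    (hzκ : ∀ i, κ + ε < (X i z).2) :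
    mollify φ κ h (X 0 z) + mollify φ κ h (X 1 z)
      = mollify φ κ h (X 2 z) + mollify φ κ h (X 3 z) := by
  set F := mollify φ κ h with hF
  have hFc : Continuous F := (contDiff_mollify φ hloc).continuous
  -- The set of violations is open by continuity. If it is also null, it is empty because `ν`
  -- charges nonempty open sets.
  let bad : Set Z := {z | z ∈ U ∧ (∀ i, κ + ε < (X i z).2) ∧
    F (X 0 z) + F (X 1 z) ≠ F (X 2 z) + F (X 3 z)}
  have hopen : IsOpen bad := by
    have h1 : IsOpen (⋂ i, {z | κ + ε < (X i z).2}) := isOpen_iInter_of_finite fun i =>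
      isOpen_lt continuous_const (continuous_snd.comp (hX i))
    have h2 : IsOpen {z | F (X 0 z) + F (X 1 z) ≠ F (X 2 z) + F (X 3 z)} :=
      isOpen_ne_fun ((hFc.comp (hX 0)).add (hFc.comp (hX 1)))
        ((hFc.comp (hX 2)).add (hFc.comp (hX 3)))
    have h3 : bad = U ∩ ((⋂ i, {z | κ + ε < (X i z).2}) ∩
        {z | F (X 0 z) + F (X 1 z) ≠ F (X 2 z) + F (X 3 z)}) := by
      ext z
      simp only [bad, mem_ofPred_eq, mem_inter_iff, mem_iInter]
    rw [h3]
    exact hU.inter (h1.inter h2)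
  have hnull : ∀ᵐ z ∂ν, z ∉ bad := by
    -- For each fixed `t` the translated collision avoids a null set for almost every `z`.
    -- Exchanging the quantifiers by Fubini needs a measurable set, hence the measurable superset
    -- `N`.
    obtain ⟨N, hsub, hNm, hN0⟩ := exists_measurable_superset_of_null (ae_iff.1 hrel)
    have h1 : ∀ t : State, ∀ᵐ z ∂ν, τ (-t) z ∉ N := fun t =>
      (hτν (-t)).quasiMeasurePreserving.ae (measure_eq_zero_iff_ae_notMem.1 hN0)
    have hmeas : MeasurableSet {p : State × Z | τ (-p.1) p.2 ∉ N} := by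
      have : Measurable fun p : State × Z => τ (-p.1) p.2 :=
        hτ.comp (measurable_fst.neg.prodMk measurable_snd)
      exact this hNm.compl
    have h2 : ∀ᵐ z ∂ν, ∀ᵐ t : State, τ (-t) z ∉ N :=
      (Measure.ae_ae_comm hmeas).1 (Eventually.of_forall h1)
    filter_upwards [h2] with z hz hbad
    obtain ⟨hzU, hzκ, hne⟩ := hbad
    apply hne
    have hi := fun i => integrable_mollify φ hloc (X i z)
    simp only [hF, mollify_apply]
    rw [← integral_add (hi 0) (hi 1), ← integral_add (hi 2) (hi 3)]
    refine integral_congr_ae ?_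
    filter_upwards [hz] with t ht
    by_cases htφ : φ.normed volume t = 0
    · simp [htφ]
    · have htn : ‖t‖ < φ.rOut := by
        have := φ.support_normed_eq (μ := volume) ▸ Function.mem_support.2 htφ
        simpa using this
      -- On the support of the bump function energies move by less than `ε`, so all four translated
      -- states remain above `κ`, where `above κ h` coincides with `h`.
      have ht2 : |t.2| < ε := (norm_snd_le t).trans_lt (htn.trans_le hφ)
      have hen : ∀ i, κ < (X i z - t).2 := fun i => by
        have h3 := hzκ i
        have h4 := (abs_lt.1 ht2).2
        simp only [Prod.snd_sub]
        linarith
      have hr : τ (-t) z ∈ U → (∀ i, κ < (X i (τ (-t) z)).2) →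
          h (X 0 (τ (-t) z)) + h (X 1 (τ (-t) z)) = h (X 2 (τ (-t) z)) + h (X 3 (τ (-t) z)) := by
        by_contra hcon
        exact ht (hsub hcon)
      simp only [hXτ, ← sub_eq_add_neg] at hr
      have h5 := hr (hUτ _ _ hzU) hen
      have h6 : ∀ i, above κ h (X i z - t) = h (X i z - t) := fun i =>
        indicator_of_mem (show X i z - t ∈ {x : State | κ < x.2} from hen i) h
      simp only [h6]
      rw [← mul_add, ← mul_add, h5]
  have hempty : bad = ∅ := hopen.eq_empty_of_measure_zero (measure_eq_zero_iff_ae_notMem.2 hnull)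
  by_contra hne
  exact (hempty ▸ (show z ∈ bad from ⟨hz, hzκ, hne⟩) : z ∈ (∅ : Set Z))

end Polyatomic
-- Measurable collision invariants
namespace Polyatomic

instance : IsFiniteMeasure dirMeasure := by unfold dirMeasure; infer_instance
instance : dirMeasure.IsOpenPosMeasure := by unfold dirMeasure; infer_instance
instance : SigmaFinite energyMeasure := by unfold energyMeasure; infer_instance
instance : SigmaFinite stateMeasure := by unfold stateMeasure; infer_instance

instance : SigmaFinite (volume : Measure State) :=
  Measure.prod.instSigmaFinite (μ := (volume : Measure Vel)) (ν := (volume : Measure ℝ))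

theorem isOpenPosMeasure_state_prod {Y : Type*} [TopologicalSpace Y] [MeasurableSpace Y]
    (ν : Measure Y) [SFinite ν] [ν.IsOpenPosMeasure] :
    ((volume : Measure State).prod ν).IsOpenPosMeasure :=
  Measure.prod.instIsOpenPosMeasure

/-- The parameter space of standard collisions: `x`, `y`, `ω`, `I'`, `J'`. -/
abbrev StdParam : Type := State × State × Dir × ℝ × ℝ

/-- The parameter space of resonant collisions: `x`, `y`, `ω`, `I'`. -/
abbrev ResParam : Type := State × State × Dir × ℝ

/-- The initial state `x` and the final state of a standard collision. -/
def stdCollision (m : ℝ) (z : StdParam) : State × State × State × State :=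
  (z.1, outcome z.1 z.2.1
    (Real.sqrt (‖z.1.1 - z.2.1.1‖ ^ 2 - 4 / m * gap z.1 z.2.1 z.2.2.2.1 z.2.2.2.2))
    z.2.2.1 z.2.2.2.1 z.2.2.2.2)

/-- The initial state `x` and the final state of a resonant collision. -/
def resCollision (z : ResParam) : State × State × State × State :=
  (z.1, outcome z.1 z.2.1 ‖z.1.1 - z.2.1.1‖ z.2.2.1 z.2.2.2 (z.1.2 + z.2.1.2 - z.2.2.2))

/-- The change of a function in a collision. -/
def increment (h : State → ℝ) (p : State × State × State × State) : ℝ :=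
  h p.2.2.1 + h p.2.2.2 - h p.1 - h p.2.1

theorem continuous_stdCollision (m : ℝ) : Continuous (stdCollision m) := by
  unfold stdCollision outcome gap
  fun_prop

theorem continuous_resCollision : Continuous resCollision := by
  unfold resCollision outcome
  fun_prop

theorem stateMeasure_std_eq_restrict :
    stateMeasure.prod (stateMeasure.prod (dirMeasure.prod (energyMeasure.prod energyMeasure)))
      = ((volume : Measure State).prod ((volume : Measure State).prod (dirMeasure.prod
          ((volume : Measure ℝ).prod (volume : Measure ℝ))))).restrict
        ((Prod.snd ⁻¹' Ioi 0) ×ˢ (Prod.snd ⁻¹' Ioi 0) ×ˢ univ ×ˢ Ioi 0 ×ˢ Ioi 0) := by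
  rw [← Measure.prod_restrict, ← Measure.prod_restrict, ← Measure.prod_restrict,
    ← Measure.prod_restrict, ← stateMeasure_eq_restrict, Measure.restrict_univ]
  rfl

theorem stateMeasure_res_eq_restrict :
    stateMeasure.prod (stateMeasure.prod (dirMeasure.prod energyMeasure))
      = ((volume : Measure State).prod ((volume : Measure State).prod (dirMeasure.prod
          (volume : Measure ℝ)))).restrict
        ((Prod.snd ⁻¹' Ioi 0) ×ˢ (Prod.snd ⁻¹' Ioi 0) ×ˢ univ ×ˢ Ioi 0) := by
  rw [← Measure.prod_restrict, ← Measure.prod_restrict, ← Measure.prod_restrict,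
    ← stateMeasure_eq_restrict, Measure.restrict_univ]
  rfl

/-- Adding the same `t` to all four states preserves the relative velocity. It also preserves the
energy gap, since two molecules enter and two leave. The translations therefore act on the
parameters, preserve their measure and preserve energetic possibility, as `mollify_invariant`
demands. -/
theorem mollify_increment_std {m κ ε : ℝ} (hκ : 0 ≤ κ) {h : State → ℝ}
    (hloc : LocallyIntegrable (above κ h))
    (hrel : ∀ᵐ z : StdParam ∂(stateMeasure.prod (stateMeasure.prod
      (dirMeasure.prod (energyMeasure.prod energyMeasure)))),
      Possible m z.1 z.2.1 z.2.2.2.1 z.2.2.2.2 → increment h (stdCollision m z) = 0)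
    {φ : ContDiffBump (0 : State)} (hφ : φ.rOut ≤ ε) {z : StdParam}
    (hz : Possible m z.1 z.2.1 z.2.2.2.1 z.2.2.2.2) (h1 : κ + ε < z.1.2) (h2 : κ + ε < z.2.1.2)
    (h3 : κ + ε < z.2.2.2.1) (h4 : κ + ε < z.2.2.2.2) :
    increment (mollify φ κ h) (stdCollision m z) = 0 := by
  have i1 := isOpenPosMeasure_state_prod (dirMeasure.prod ((volume : Measure ℝ).prod (volume : Measure ℝ)))
  have i2 := isOpenPosMeasure_state_prod
    ((volume : Measure State).prod (dirMeasure.prod ((volume : Measure ℝ).prod (volume : Measure ℝ))))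
  let τ : State → StdParam → StdParam := fun t z =>
    (z.1 + t, z.2.1 + t, z.2.2.1, z.2.2.2.1 + t.2, z.2.2.2.2 + t.2)
  let X : Fin 4 → StdParam → State := ![fun z => z.1, fun z => z.2.1,
    fun z => (stdCollision m z).2.2.1, fun z => (stdCollision m z).2.2.2]
  have hc := continuous_stdCollision m
  have hgap : ∀ (t : State) (z : StdParam), gap (z.1 + t) (z.2.1 + t) (z.2.2.2.1 + t.2) (z.2.2.2.2 + t.2)
      = gap z.1 z.2.1 z.2.2.2.1 z.2.2.2.2 := fun t z => by
    simp only [gap, Prod.snd_add]; ring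
  have key := mollify_invariant (ν := (volume : Measure State).prod ((volume : Measure State).prod
      (dirMeasure.prod ((volume : Measure ℝ).prod (volume : Measure ℝ))))) (τ := τ) (X := X)
    (by fun_prop)
    (fun t => (measurePreserving_add_right _ t).prod ((measurePreserving_add_right _ t).prod
      ((MeasurePreserving.id _).prod ((measurePreserving_add_right _ t.2).prod
        (measurePreserving_add_right _ t.2)))))
    (by
      intro i
      fin_cases i
      · exact continuous_fst
      · exact continuous_fst.comp continuous_snd
      · exact (continuous_fst.comp (continuous_snd.comp continuous_snd)).comp hc
      · exact (continuous_snd.comp (continuous_snd.comp continuous_snd)).comp hc)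
    (by
      intro i t z
      fin_cases i
      · rfl
      · rfl
      · refine Prod.ext ?_ rfl
        simp [X, τ, stdCollision, outcome, hgap]
        module
      · refine Prod.ext ?_ rfl
        simp [X, τ, stdCollision, outcome, hgap]
        module)
    (U := {z | Possible m z.1 z.2.1 z.2.2.2.1 z.2.2.2.2})
    (by
      unfold Possible gap
      exact isOpen_lt (by fun_prop) (by fun_prop))
    (by
      intro t z hz
      change Possible _ _ _ _ _
      unfold Possible
      rw [hgap]
      simpa [τ] using (hz : _ < _))
    (κ := κ) (ε := ε) (h := h) hloc
    (by
      rw [stateMeasure_std_eq_restrict, ae_restrict_iff' (by measurability)] at hrel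
      filter_upwards [hrel] with z hz hU hX
      have h0 : κ < z.1.2 := hX 0
      have h1 : κ < z.2.1.2 := hX 1
      have h2 : κ < z.2.2.2.1 := hX 2
      have h3 : κ < z.2.2.2.2 := hX 3
      have := hz ⟨hκ.trans_lt h0, hκ.trans_lt h1, trivial, hκ.trans_lt h2, hκ.trans_lt h3⟩ hU
      simp only [increment] at this
      simp only [X]
      change h z.1 + h z.2.1 = h (stdCollision m z).2.2.1 + h (stdCollision m z).2.2.2
      change _ - h z.1 - h z.2.1 = 0 at this
      linarith)
    hφ (z := z) hz (by
      intro i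
      fin_cases i
      exacts [h1, h2, h3, h4])
  change _ - mollify φ κ h z.1 - mollify φ κ h z.2.1 = 0
  have key' : mollify φ κ h z.1 + mollify φ κ h z.2.1 = mollify φ κ h (stdCollision m z).2.2.1
    + mollify φ κ h (stdCollision m z).2.2.2 := key
  linarith

theorem mollify_increment_res {κ ε : ℝ} (hκ : 0 ≤ κ) {h : State → ℝ}
    (hloc : LocallyIntegrable (above κ h))
    (hrel : ∀ᵐ z : ResParam ∂(stateMeasure.prod (stateMeasure.prod
      (dirMeasure.prod energyMeasure))),
      z.2.2.2 < z.1.2 + z.2.1.2 → increment h (resCollision z) = 0)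
    {φ : ContDiffBump (0 : State)} (hφ : φ.rOut ≤ ε) {z : ResParam}
    (h1 : κ + ε < z.1.2) (h2 : κ + ε < z.2.1.2)
    (h3 : κ + ε < z.2.2.2) (h4 : κ + ε < z.1.2 + z.2.1.2 - z.2.2.2) :
    increment (mollify φ κ h) (resCollision z) = 0 := by
  have i1 := isOpenPosMeasure_state_prod (dirMeasure.prod (volume : Measure ℝ))
  have i2 := isOpenPosMeasure_state_prod
    ((volume : Measure State).prod (dirMeasure.prod (volume : Measure ℝ)))
  -- Only `I'` has to be moved: the other outgoing energy `I + J - I'` then shifts by `t.2` as well.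
  let τ : State → ResParam → ResParam := fun t z =>
    (z.1 + t, z.2.1 + t, z.2.2.1, z.2.2.2 + t.2)
  let X : Fin 4 → ResParam → State := ![fun z => z.1, fun z => z.2.1,
    fun z => (resCollision z).2.2.1, fun z => (resCollision z).2.2.2]
  have hc := continuous_resCollision
  have key := mollify_invariant (ν := (volume : Measure State).prod ((volume : Measure State).prod
      (dirMeasure.prod (volume : Measure ℝ)))) (τ := τ) (X := X)
    (by fun_prop)
    (fun t => (measurePreserving_add_right _ t).prod ((measurePreserving_add_right _ t).prod
      ((MeasurePreserving.id _).prod (measurePreserving_add_right _ t.2))))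
    (by
      intro i
      fin_cases i
      · exact continuous_fst
      · exact continuous_fst.comp continuous_snd
      · exact (continuous_fst.comp (continuous_snd.comp continuous_snd)).comp hc
      · exact (continuous_snd.comp (continuous_snd.comp continuous_snd)).comp hc)
    (by
      intro i t z
      fin_cases i
      · rfl
      · rfl
      · simp only [X, τ, resCollision, outcome]
        refine Prod.ext ?_ rfl
        simp
        module
      · simp only [X, τ, resCollision, outcome]
        refine Prod.ext ?_ ?_
        · simp
          module
        · simp
          ring)
    (U := univ) isOpen_univ (fun _ _ _ => trivial)
    (κ := κ) (ε := ε) (h := h) hloc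
    (by
      rw [stateMeasure_res_eq_restrict, ae_restrict_iff' (by measurability)] at hrel
      filter_upwards [hrel] with z hz hU hX
      have h0 : κ < z.1.2 := hX 0
      have h1 : κ < z.2.1.2 := hX 1
      have h2 : κ < z.2.2.2 := hX 2
      have h3 : κ < z.1.2 + z.2.1.2 - z.2.2.2 := hX 3
      have := hz ⟨hκ.trans_lt h0, hκ.trans_lt h1, trivial, hκ.trans_lt h2⟩ (by linarith)
      change _ - h z.1 - h z.2.1 = 0 at this
      change h z.1 + h z.2.1 = h (resCollision z).2.2.1 + h (resCollision z).2.2.2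
      linarith)
    hφ (z := z) trivial (by
      intro i
      fin_cases i
      exacts [h1, h2, h3, h4])
  change _ - mollify φ κ h z.1 - mollify φ κ h z.2.1 = 0
  have key' : mollify φ κ h z.1 + mollify φ κ h z.2.1 = mollify φ κ h (resCollision z).2.2.1
    + mollify φ κ h (resCollision z).2.2.2 := key
  linarith

/-- The generators of the kernel in the non-resonant case. -/
abbrev stdInvariants (m : ℝ) : Set (State → ℝ) :=
  {fun _ => 1, fun x => x.1 0, fun x => x.1 1, fun x => x.1 2,
    fun x => m * ‖x.1‖ ^ 2 + 2 * x.2}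

/-- The generators of the kernel in the resonant case. -/
abbrev resInvariants : Set (State → ℝ) :=
  {fun _ => 1, fun x => x.1 0, fun x => x.1 1, fun x => x.1 2,
    fun x => ‖x.1‖ ^ 2, fun x => x.2}

theorem clm_apply_eq_sum (β : Vel →L[ℝ] ℝ) : ∃ b : Fin 3 → ℝ, ∀ ξ : Vel,
    β ξ = b 0 * ξ 0 + b 1 * ξ 1 + b 2 * ξ 2 := by
  refine ⟨fun i => β (EuclideanSpace.basisFun (Fin 3) ℝ i), fun ξ => ?_⟩
  conv_lhs => rw [← (EuclideanSpace.basisFun (Fin 3) ℝ).sum_repr ξ]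
  simp only [map_add, map_smul, smul_eq_mul, Fin.sum_univ_three, EuclideanSpace.basisFun_repr]
  ring

/-- Measurable collision invariants of standard collisions. -/
theorem mem_generatedBy_of_std {m : ℝ} (hm : 0 < m) {h : State → ℝ}
    (hloc : ∀ κ, 0 < κ → LocallyIntegrable (above κ h))
    (hrel : ∀ᵐ z : StdParam ∂(stateMeasure.prod (stateMeasure.prod
      (dirMeasure.prod (energyMeasure.prod energyMeasure)))),
      Possible m z.1 z.2.1 z.2.2.2.1 z.2.2.2.2 → increment h (stdCollision m z) = 0) :
    h ∈ generatedBy (stdInvariants m) := by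
  have hfin : (stdInvariants m).Finite := Set.toFinite _
  have := FiniteDimensional.span_of_finite ℝ hfin
  refine exists_mem_ae_eq_of_mollify (Submodule.span ℝ (stdInvariants m)) hloc ?_
  intro κ hκ φ hφ
  have hinc := fun {z : StdParam} => mollify_increment_std hκ.le (hloc κ hκ) hrel hφ (z := z)
  -- Standard collisions with zero gap have the kinematics of resonant ones. This is a null set of
  -- collisions, which is why invariance everywhere was needed.
  obtain ⟨c, α, γ, β, hFe⟩ := exists_eq_of_resonant
    ((contDiff_mollify φ (hloc κ hκ)).differentiable one_ne_zero) (κ + κ) (by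
      intro x y ω I' J' hne hω hx hy hI hJ hsum
      have hgap : gap x y I' J' = 0 := by simp only [gap]; linarith
      have hpos : 0 < ‖x.1 - y.1‖ := norm_pos_iff.2 (sub_ne_zero.2 hne)
      have h1 := @hinc (x, y, ⟨ω, by simpa using hω⟩, I', J')
        (by
          change _ < _
          simp only [hgap, mul_zero]
          positivity) hx hy hI hJ
      simp only [increment, stdCollision, outcome, hgap, mul_zero, sub_zero,
        Real.sqrt_sq (norm_nonneg _)] at h1
      linarith)
  -- Test collision: velocities `±s e` meet head-on and each internal energy rises by 1. Then `|g|²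
  -- = 4s² = 32/m` and `|g'|² = 32/m - 8/m = 24/m`, so the collision is possible, and invariance
  -- reads `4α/m = 2c`. The energy `K` lies above the cutoff.
  have hcα : 2 * α = c * m := by
    obtain ⟨e, he⟩ : ∃ e : Vel, ‖e‖ = 1 := exists_norm_eq Vel zero_le_one
    set s : ℝ := Real.sqrt (8 / m) with hs
    have hss : s ^ 2 = 8 / m := Real.sq_sqrt (by positivity)
    have hspos : 0 < s := Real.sqrt_pos.2 (by positivity)
    set K : ℝ := κ + κ + 1 with hK
    have hgap : gap (s • e, K) (-(s • e), K) (K + 1) (K + 1) = 2 := by simp only [gap]; ring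
    have hn : ‖s • e - -(s • e)‖ = 2 * s := by
      rw [sub_neg_eq_add, ← two_smul ℝ, norm_smul, norm_smul, he, Real.norm_of_nonneg hspos.le]
      simp
    have hq : Real.sqrt ((2 * s) ^ 2 - 4 / m * 2) ^ 2 = 24 / m := by
      have h8 : (2 * s) ^ 2 - 4 / m * 2 = 24 / m := by rw [mul_pow, hss]; ring
      rw [h8, Real.sq_sqrt (by positivity)]
    have h1 := @hinc ((s • e, K), (-(s • e), K), ⟨e, by simpa using he⟩, K + 1, K + 1)
      (by
        change _ < _
        simp only [hgap, hn]
        rw [mul_pow, hss]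
        have : 0 < 1 / m := by positivity
        have e1 : 4 / m * 2 = 8 * (1 / m) := by ring
        have e2 : 2 ^ 2 * (8 / m) = 32 * (1 / m) := by ring
        rw [e1, e2]; linarith) (by simp [hK]) (by simp [hK]) (by simp [hK]; linarith)
        (by simp [hK]; linarith)
    simp only [increment, stdCollision, outcome, hgap, hn] at h1
    rw [hFe _ (by simp [hK]; linarith), hFe _ (by simp [hK]; linarith), hFe _ (by simp [hK]),
      hFe _ (by simp [hK])] at h1
    simp only [add_neg_cancel, smul_zero, zero_add, zero_sub, map_neg, norm_neg, norm_smul, he,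
      mul_one, Real.norm_eq_abs, sq_abs, div_pow, hq, hss] at h1
    field_simp at h1
    linarith
  obtain ⟨b, hb⟩ := clm_apply_eq_sum β
  refine ⟨(γ • fun _ => 1) + (b 0 • fun x => x.1 0) + (b 1 • fun x => x.1 1)
    + (b 2 • fun x => x.1 2) + ((c / 2) • fun x => m * ‖x.1‖ ^ 2 + 2 * x.2), ?_, fun x hx => ?_⟩
  · refine add_mem (add_mem (add_mem (add_mem ?_ ?_) ?_) ?_) ?_ <;>
      exact Submodule.smul_mem _ _ (Submodule.subset_span (by simp))
  · rw [hFe x hx, hb]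
    simp only [Pi.add_apply, Pi.smul_apply, smul_eq_mul]
    linear_combination (‖x.1‖ ^ 2 / 2) * hcα

/-- Measurable collision invariants of resonant collisions. -/
theorem mem_generatedBy_of_res {h : State → ℝ}
    (hloc : ∀ κ, 0 < κ → LocallyIntegrable (above κ h))
    (hrel : ∀ᵐ z : ResParam ∂(stateMeasure.prod (stateMeasure.prod
      (dirMeasure.prod energyMeasure))),
      z.2.2.2 < z.1.2 + z.2.1.2 → increment h (resCollision z) = 0) :
    h ∈ generatedBy resInvariants := by
  have hfin : resInvariants.Finite := Set.toFinite _
  have := FiniteDimensional.span_of_finite ℝ hfin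
  refine exists_mem_ae_eq_of_mollify (Submodule.span ℝ resInvariants) hloc ?_
  intro κ hκ φ hφ
  have hinc := fun {z : ResParam} => mollify_increment_res hκ.le (hloc κ hκ) hrel hφ (z := z)
  obtain ⟨c, α, γ, β, hFe⟩ := exists_eq_of_resonant
    ((contDiff_mollify φ (hloc κ hκ)).differentiable one_ne_zero) (κ + κ) (by
      intro x y ω I' J' hne hω hx hy hI hJ hsum
      have hJ' : x.2 + y.2 - I' = J' := by linarith
      have h1 := @hinc (x, y, ⟨ω, by simpa using hω⟩, I') hx hy hI (by simp only [hJ']; exact hJ)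
      simp only [increment, resCollision, outcome, hJ'] at h1
      linarith)
  obtain ⟨b, hb⟩ := clm_apply_eq_sum β
  refine ⟨(γ • fun _ => 1) + (b 0 • fun x => x.1 0) + (b 1 • fun x => x.1 1)
    + (b 2 • fun x => x.1 2) + (α • fun x => ‖x.1‖ ^ 2) + (c • fun x => x.2), ?_, fun x hx => ?_⟩
  · refine add_mem (add_mem (add_mem (add_mem (add_mem ?_ ?_) ?_) ?_) ?_) ?_ <;>
      exact Submodule.smul_mem _ _ (Submodule.subset_span (by simp))
  · rw [hFe x hx, hb]
    simp only [Pi.add_apply, Pi.smul_apply, smul_eq_mul]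
    ring

end Polyatomic
-- Changes of variables for pairs of molecules
namespace Polyatomic

open scoped ENNReal

/-- Polar coordinates in velocity space. -/
theorem lintegral_vel_polar (f : Vel → ℝ≥0∞) (hf : Measurable f) :
    ∫⁻ v, f v = ∫⁻ ω : Dir, ∫⁻ r, ENNReal.ofReal (r ^ 2) * f (r • (ω : Vel))
      ∂energyMeasure ∂dirMeasure := by
  have h1 : ∫⁻ v, f v = ∫⁻ v : ({0}ᶜ : Set Vel), f v ∂(volume.comap ((↑) : ({0}ᶜ : Set Vel) → Vel)) := by
    rw [lintegral_subtype_comap (measurableSet_singleton _).compl f,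
      restrict_compl_singleton]
  have h2 := ((volume : Measure Vel).measurePreserving_homeomorphUnitSphereProd).lintegral_comp_emb
    (Homeomorph.measurableEmbedding _)
    (fun z => f ((homeomorphUnitSphereProd Vel).symm z : Vel))
  simp only [Homeomorph.symm_apply_apply] at h2
  have hdim : Module.finrank ℝ Vel - 1 = 2 := by simp
  rw [h1, h2, hdim, lintegral_prod]
  · refine lintegral_congr fun ω => ?_
    rw [Measure.volumeIoiPow, lintegral_withDensity_eq_lintegral_mul _ (by fun_prop)]
    · simp only [homeomorphUnitSphereProd_symm_apply_coe, Pi.mul_apply]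
      exact lintegral_subtype_comap measurableSet_Ioi
        (fun r => ENNReal.ofReal (r ^ 2) * f (r • (ω : Vel)))
    · simp only [homeomorphUnitSphereProd_symm_apply_coe]
      fun_prop
  · simp only [homeomorphUnitSphereProd_symm_apply_coe]
    exact (hf.comp (by fun_prop)).aemeasurable

/-- Passage to the centre of mass and the relative velocity. -/
theorem lintegral_center_relative (f : Vel × Vel → ℝ≥0∞) (hf : Measurable f) :
    ∫⁻ ξ, ∫⁻ η, f (ξ, η) = ∫⁻ G : Vel, ∫⁻ g : Vel,
      f (G + (1 / 2 : ℝ) • g, G - (1 / 2 : ℝ) • g) := by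
  calc ∫⁻ ξ, ∫⁻ η, f (ξ, η) = ∫⁻ η, ∫⁻ ξ, f (ξ, η) :=
        lintegral_lintegral_swap hf.aemeasurable
    _ = ∫⁻ η : Vel, ∫⁻ g : Vel, f (g + η, η) := by
        refine lintegral_congr fun η => ?_
        exact (lintegral_add_right_eq_self (fun ξ => f (ξ, η)) η).symm
    _ = ∫⁻ g : Vel, ∫⁻ η : Vel, f (g + η, η) :=
        lintegral_lintegral_swap (hf.comp (by fun_prop)).aemeasurable
    _ = ∫⁻ g : Vel, ∫⁻ G : Vel, f (G + (1 / 2 : ℝ) • g, G - (1 / 2 : ℝ) • g) := by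
        refine lintegral_congr fun g => ?_
        -- At fixed relative velocity the centre of mass velocity differs from `η` by the
        -- translation `g / 2`, so the Jacobian is 1.
        rw [← lintegral_add_right_eq_self (fun η => f (g + η, η)) (-((1 / 2 : ℝ) • g))]
        refine lintegral_congr fun G => ?_
        congr 2
        · module
    _ = _ := lintegral_lintegral_swap (hf.comp (by fun_prop)).aemeasurable

/-- Integration over pairs of states in terms of the centre of mass velocity, the relative
velocity in polar coordinates, and the internal energies. -/
theorem lintegral_pair (H : Vel × Vel × (ℝ × ℝ) → ℝ≥0∞) (hH : Measurable H) :
    ∫⁻ x, ∫⁻ y, H (x.1, y.1, (x.2, y.2)) ∂stateMeasure ∂stateMeasure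
      = ∫⁻ G : Vel, ∫⁻ ω : Dir, ∫⁻ r, ENNReal.ofReal (r ^ 2) *
          ∫⁻ e, H (G + (r / 2) • (ω : Vel), G - (r / 2) • (ω : Vel), e)
            ∂(energyMeasure.prod energyMeasure) ∂energyMeasure ∂dirMeasure := by
  set Φ : Vel × Vel → ℝ≥0∞ := fun q => ∫⁻ e, H (q.1, q.2, e) ∂(energyMeasure.prod energyMeasure)
    with hΦ
  have hΦm : Measurable Φ := by
    have : Measurable fun p : (Vel × Vel) × (ℝ × ℝ) => H (p.1.1, p.1.2, p.2) :=
      hH.comp (by fun_prop)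
    exact this.lintegral_prod_right'
  have h1 : ∫⁻ x, ∫⁻ y, H (x.1, y.1, (x.2, y.2)) ∂stateMeasure ∂stateMeasure
      = ∫⁻ ξ, ∫⁻ η, Φ (ξ, η) := by
    have e1 : ∀ x : State, ∫⁻ y, H (x.1, y.1, (x.2, y.2)) ∂stateMeasure
        = ∫⁻ η : Vel, ∫⁻ J, H (x.1, η, (x.2, J)) ∂energyMeasure := fun x => by
      rw [stateMeasure, lintegral_prod]
      exact (hH.comp (by fun_prop)).aemeasurable
    simp only [e1]
    rw [stateMeasure, lintegral_prod]
    · refine lintegral_congr fun ξ => ?_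
      simp only
      rw [lintegral_lintegral_swap]
      · refine lintegral_congr fun η => ?_
        rw [hΦ]
        simp only
        rw [lintegral_prod]
        exact (hH.comp (by fun_prop)).aemeasurable
      · have : Measurable fun p : (ℝ × Vel) × ℝ => H (ξ, p.1.2, (p.1.1, p.2)) :=
          hH.comp (by fun_prop)
        exact this.lintegral_prod_right'.aemeasurable
    · have : Measurable fun p : (State × Vel) × ℝ => H (p.1.1.1, p.1.2, (p.1.1.2, p.2)) :=
        hH.comp (by fun_prop)
      exact this.lintegral_prod_right'.lintegral_prod_right'.aemeasurable
  rw [h1, lintegral_center_relative Φ hΦm]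
  refine lintegral_congr fun G => ?_
  rw [lintegral_vel_polar (fun g => Φ (G + (1 / 2 : ℝ) • g, G - (1 / 2 : ℝ) • g))
    (hΦm.comp (by fun_prop))]
  refine lintegral_congr fun ω => lintegral_congr fun r => ?_
  have : (1 / 2 : ℝ) • r • (ω : Vel) = (r / 2) • (ω : Vel) := by
    rw [smul_smul]; congr 1; ring
  rw [this]

/-- The substitution `q = √(r² - A)`, `r dr = q dq`. -/
theorem lintegral_relative_speed (A : ℝ) (φ : ℝ → ℝ → ℝ≥0∞) :
    ∫⁻ r in {r : ℝ | 0 < r ∧ A < r ^ 2}, ENNReal.ofReal r * φ r (Real.sqrt (r ^ 2 - A))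
      = ∫⁻ q in {q : ℝ | 0 < q ∧ -A < q ^ 2},
          ENNReal.ofReal q * φ (Real.sqrt (q ^ 2 + A)) q := by
  set T : Set ℝ := {q : ℝ | 0 < q ∧ -A < q ^ 2} with hT
  set F : ℝ → ℝ := fun q => Real.sqrt (q ^ 2 + A) with hF
  have hpos : ∀ q ∈ T, 0 < q ^ 2 + A := fun q hq => by have := hq.2; linarith
  have hFsq : ∀ q ∈ T, F q ^ 2 = q ^ 2 + A := fun q hq => Real.sq_sqrt (hpos q hq).le
  have himg : F '' T = {r : ℝ | 0 < r ∧ A < r ^ 2} := by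
    ext r
    constructor
    · rintro ⟨q, hq, rfl⟩
      refine ⟨Real.sqrt_pos.2 (hpos q hq), ?_⟩
      rw [hFsq q hq]
      have := pow_pos hq.1 2
      linarith
    · rintro ⟨hr, hA⟩
      have h1 : Real.sqrt (r ^ 2 - A) ^ 2 = r ^ 2 - A := Real.sq_sqrt (by linarith)
      refine ⟨Real.sqrt (r ^ 2 - A), ⟨Real.sqrt_pos.2 (by linarith), ?_⟩, ?_⟩
      · rw [h1]
        have := pow_pos hr 2
        linarith
      · simp only [hF]
        rw [h1, sub_add_cancel, Real.sqrt_sq hr.le]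
  have hTm : MeasurableSet T := by
    have : T = Ioi 0 ∩ {q : ℝ | -A < q ^ 2} := rfl
    rw [this]
    exact measurableSet_Ioi.inter (measurableSet_lt measurable_const (by fun_prop))
  have hinj : InjOn F T := by
    intro a ha b hb hab
    have h1 : F a ^ 2 = F b ^ 2 := by rw [hab]
    rw [hFsq a ha, hFsq b hb] at h1
    exact (sq_eq_sq₀ ha.1.le hb.1.le).1 (by linarith)
  have hder : ∀ q ∈ T, HasDerivWithinAt F (q / F q) T q := by
    intro q hq
    have h1 : HasDerivAt (fun q : ℝ => q ^ 2 + A) (2 * q) q := by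
      simpa using (hasDerivAt_pow 2 q).add_const A
    convert! (h1.sqrt (hpos q hq).ne').hasDerivWithinAt using 1
    rw [mul_div_mul_left _ _ two_ne_zero]
  -- The derivative of `q ↦ √(q² + A)` is `q / r`, whose denominator cancels the factor `r`. Either
  -- sign of `A` is allowed: the two conditions on `r` and on `q` make both speeds positive.
  rw [← himg, lintegral_image_eq_lintegral_abs_deriv_mul hTm hder hinj]
  refine setLIntegral_congr_fun hTm fun q hq => ?_
  have hFp : 0 < F q := Real.sqrt_pos.2 (hpos q hq)
  rw [hFsq q hq, add_sub_cancel_right, Real.sqrt_sq hq.1.le, ← mul_assoc,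
    abs_of_pos (div_pos hq.1 hFp), ← ENNReal.ofReal_mul (div_pos hq.1 hFp).le,
    div_mul_cancel₀ _ hFp.ne']

/-- Exchange of the internal energies before and after a resonant collision. -/
theorem lintegral_resonant_energies (Θ : ℝ × ℝ × ℝ × ℝ → ℝ≥0∞) (hΘ : Measurable Θ) :
    ∫⁻ I, ∫⁻ J, ∫⁻ I', (if I' < I + J then Θ (I, J, I', I + J - I') else 0)
        ∂energyMeasure ∂energyMeasure ∂energyMeasure
      = ∫⁻ I, ∫⁻ J, ∫⁻ I', (if I' < I + J then Θ (I', I + J - I', I, J) else 0)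
        ∂energyMeasure ∂energyMeasure ∂energyMeasure := by
  -- With the total energy `s = I + J` as a variable the domain becomes the square `0 < I, I' < s`,
  -- on which the time reversal is the exchange of `I` and `I'`.
  have key : ∀ Θ : ℝ × ℝ × ℝ × ℝ → ℝ≥0∞, Measurable Θ →
      ∫⁻ I, ∫⁻ J, ∫⁻ I', (if I' < I + J then Θ (I, J, I', I + J - I') else 0)
        ∂energyMeasure ∂energyMeasure ∂energyMeasure
      = ∫⁻ s : ℝ, ∫⁻ I : ℝ, ∫⁻ I' : ℝ, (if (0 < I ∧ I < s) ∧ (0 < I' ∧ I' < s) then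
          Θ (I, s - I, I', s - I') else 0) := by
    intro Θ hΘ
    have hm : Measurable fun p : ℝ × ℝ × ℝ => (if (0 < p.2.1 ∧ p.2.1 < p.1) ∧
        (0 < p.2.2 ∧ p.2.2 < p.1) then Θ (p.2.1, p.1 - p.2.1, p.2.2, p.1 - p.2.2) else 0) :=
      Measurable.ite (by measurability) (hΘ.comp (by fun_prop)) measurable_const
    have e1 : ∀ I, ∫⁻ J, ∫⁻ I', (if I' < I + J then Θ (I, J, I', I + J - I') else 0)
        ∂energyMeasure ∂energyMeasure = ∫⁻ s : ℝ, ∫⁻ I' : ℝ,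
          (if I < s ∧ (0 < I' ∧ I' < s) then Θ (I, s - I, I', s - I') else 0) := by
      intro I
      rw [← lintegral_add_left_eq_self (fun s : ℝ => ∫⁻ I' : ℝ,
          (if I < s ∧ (0 < I' ∧ I' < s) then Θ (I, s - I, I', s - I') else 0)) I,
        energyMeasure, ← lintegral_indicator measurableSet_Ioi]
      refine lintegral_congr fun J => ?_
      by_cases hJ : 0 < J
      · rw [indicator_of_mem (show J ∈ Ioi 0 from hJ), ← lintegral_indicator measurableSet_Ioi]
        refine lintegral_congr fun I' => ?_
        by_cases hI' : 0 < I'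
        · rw [indicator_of_mem (show I' ∈ Ioi 0 from hI')]
          simp [hJ, hI']
        · rw [indicator_of_notMem (show I' ∉ Ioi 0 from hI')]
          simp [hI']
      · rw [indicator_of_notMem (show J ∉ Ioi 0 from hJ)]
        simp [hJ]
    simp only [e1]
    rw [energyMeasure, ← lintegral_indicator measurableSet_Ioi]
    have e2 : ∀ I : ℝ, (Ioi (0 : ℝ)).indicator (fun I => ∫⁻ s : ℝ, ∫⁻ I' : ℝ,
          (if I < s ∧ (0 < I' ∧ I' < s) then Θ (I, s - I, I', s - I') else 0)) I
        = ∫⁻ s : ℝ, ∫⁻ I' : ℝ, (if (0 < I ∧ I < s) ∧ (0 < I' ∧ I' < s) then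
          Θ (I, s - I, I', s - I') else 0) := by
      intro I
      by_cases hI : 0 < I
      · rw [indicator_of_mem (show I ∈ Ioi 0 from hI)]
        simp [hI]
      · rw [indicator_of_notMem (show I ∉ Ioi 0 from hI)]
        simp [hI]
    simp only [e2]
    refine lintegral_lintegral_swap ?_
    have : Measurable fun p : (ℝ × ℝ) × ℝ => (if (0 < p.1.1 ∧ p.1.1 < p.1.2) ∧
        (0 < p.2 ∧ p.2 < p.1.2) then Θ (p.1.1, p.1.2 - p.1.1, p.2, p.1.2 - p.2) else 0) :=
      hm.comp (f := fun p : (ℝ × ℝ) × ℝ => ((p.1.2, p.1.1, p.2) : ℝ × ℝ × ℝ)) (by fun_prop)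
    exact this.lintegral_prod_right'.aemeasurable
  rw [key Θ hΘ]
  have hΘ' : Measurable fun q : ℝ × ℝ × ℝ × ℝ => Θ (q.2.2.1, q.2.2.2, q.1, q.2.1) :=
    hΘ.comp (by fun_prop)
  have h2 := key _ hΘ'
  simp only at h2
  rw [h2]
  refine lintegral_congr fun s => ?_
  rw [lintegral_lintegral_swap]
  · refine lintegral_congr fun I => lintegral_congr fun I' => ?_
    by_cases h1 : (0 < I ∧ I < s) <;> by_cases h2 : (0 < I' ∧ I' < s) <;> simp [h1, h2]
  · exact (Measurable.ite (by measurability) (hΘ.comp (by fun_prop)) measurable_const).aemeasurable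

end Polyatomic
-- Collision densities and exchange of the incoming molecules
namespace Polyatomic

open scoped ENNReal

open Classical in
/-- The density of the standard transition measure. -/
def stdDensity (m δ : ℝ) (σ : CrossSection) (x : State) (z : State × Dir × ℝ × ℝ) : ℝ≥0∞ :=
  if Possible m x z.1 z.2.2.1 z.2.2.2 then
    ENNReal.ofReal ((x.2 * z.1.2) ^ (δ / 2 - 1) * ‖x.1 - z.1.1‖
      * σ.at x z.1 z.2.1 z.2.2.1 z.2.2.2)
  else 0

open Classical in
/-- The density of the resonant transition measure. -/
def resDensity (δ : ℝ) (σ : CrossSection) (x : State) (z : State × Dir × ℝ) : ℝ≥0∞ :=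
  if z.2.2 < x.2 + z.1.2 then
    ENNReal.ofReal ((x.2 * z.1.2) ^ (δ / 2 - 1) * ‖x.1 - z.1.1‖
      * σ.at x z.1 z.2.1 z.2.2 (x.2 + z.1.2 - z.2.2))
  else 0

theorem measurable_at {σ : CrossSection} (hσ : Measurable fun z : ℝ × ℝ × ℝ × ℝ × ℝ × ℝ =>
    σ z.1 z.2.1 z.2.2.1 z.2.2.2.1 z.2.2.2.2.1 z.2.2.2.2.2) :
    Measurable fun z : StdParam => σ.at z.1 z.2.1 z.2.2.1 z.2.2.2.1 z.2.2.2.2 :=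
  hσ.comp (f := fun z : StdParam => (‖z.1.1 - z.2.1.1‖,
    |inner ℝ (z.1.1 - z.2.1.1) (z.2.2.1 : Vel)| / ‖z.1.1 - z.2.1.1‖, z.1.2, z.2.1.2,
    z.2.2.2.1, z.2.2.2.2)) (by fun_prop)

theorem measurable_stdDensity {m δ : ℝ} {σ : CrossSection}
    (hσ : Measurable fun z : ℝ × ℝ × ℝ × ℝ × ℝ × ℝ =>
      σ z.1 z.2.1 z.2.2.1 z.2.2.2.1 z.2.2.2.2.1 z.2.2.2.2.2) :
    Measurable fun z : StdParam => stdDensity m δ σ z.1 z.2 := by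
  have h1 := measurable_at hσ
  refine Measurable.ite ?_ ?_ measurable_const
  · unfold Possible gap
    exact measurableSet_lt (by fun_prop) (by fun_prop)
  · fun_prop

theorem measurable_resDensity {δ : ℝ} {σ : CrossSection}
    (hσ : Measurable fun z : ℝ × ℝ × ℝ × ℝ × ℝ × ℝ =>
      σ z.1 z.2.1 z.2.2.1 z.2.2.2.1 z.2.2.2.2.1 z.2.2.2.2.2) :
    Measurable fun z : ResParam => resDensity δ σ z.1 z.2 := by
  have h1 : Measurable fun z : ResParam =>
      σ.at z.1 z.2.1 z.2.2.1 z.2.2.2 (z.1.2 + z.2.1.2 - z.2.2.2) :=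
    (measurable_at hσ).comp (f := fun z : ResParam =>
      ((z.1, z.2.1, z.2.2.1, z.2.2.2, z.1.2 + z.2.1.2 - z.2.2.2) : StdParam)) (by fun_prop)
  refine Measurable.ite ?_ ?_ measurable_const
  · exact measurableSet_lt (by fun_prop) (by fun_prop)
  · fun_prop

/-- Integration over standard collisions. -/
def stdIntegral (m δ : ℝ) (σ : CrossSection) (f : State × State × State × State → ℝ≥0∞) : ℝ≥0∞ :=
  ∫⁻ x, ∫⁻ z, stdDensity m δ σ x z * f (stdCollision m (x, z))
    ∂(stateMeasure.prod (dirMeasure.prod (energyMeasure.prod energyMeasure))) ∂stateMeasure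

/-- Integration over resonant collisions. -/
def resIntegral (δ : ℝ) (σ : CrossSection) (f : State × State × State × State → ℝ≥0∞) : ℝ≥0∞ :=
  ∫⁻ x, ∫⁻ z, resDensity δ σ x z * f (resCollision (x, z))
    ∂(stateMeasure.prod (dirMeasure.prod energyMeasure)) ∂stateMeasure

/-- Exchange of the two incoming molecules. -/
def swapInitial (p : State × State × State × State) : State × State × State × State :=
  (p.2.1, p.1, p.2.2)

/-- Exchange of the states before and after a collision. -/
def swapTime (p : State × State × State × State) : State × State × State × State :=
  (p.2.2.1, p.2.2.2, p.1, p.2.1)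

theorem measurable_swapInitial : Measurable swapInitial := by unfold swapInitial; fun_prop
theorem measurable_swapTime : Measurable swapTime := by unfold swapTime; fun_prop

theorem ae_energy_pos : ∀ᵐ I ∂energyMeasure, 0 < I := ae_restrict_mem measurableSet_Ioi

theorem ae_state_energy_pos : ∀ᵐ x ∂stateMeasure, 0 < x.2 :=
  ae_stateMeasure_iff.2 (Filter.Eventually.of_forall fun _ h => h)

theorem ae_dir_energies_pos : ∀ᵐ b : Dir × ℝ × ℝ
    ∂(dirMeasure.prod (energyMeasure.prod energyMeasure)), 0 < b.2.1 ∧ 0 < b.2.2 := by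
  refine Measure.quasiMeasurePreserving_snd.ae
    (p := fun e : ℝ × ℝ => 0 < e.1 ∧ 0 < e.2) ?_
  filter_upwards [Measure.quasiMeasurePreserving_fst.ae ae_energy_pos,
    Measure.quasiMeasurePreserving_snd.ae ae_energy_pos] with e h1 h2 using ⟨h1, h2⟩

theorem ae_dir_energy_pos : ∀ᵐ b : Dir × ℝ ∂(dirMeasure.prod energyMeasure), 0 < b.2 :=
  Measure.quasiMeasurePreserving_snd.ae ae_energy_pos

theorem gap_comm (x y : State) (I' J' : ℝ) : gap y x I' J' = gap x y I' J' := by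
  simp only [gap]; ring

theorem cos_mem_Icc (v : Vel) (ω : Dir) :
    0 ≤ |inner ℝ v (ω : Vel)| / ‖v‖ ∧ |inner ℝ v (ω : Vel)| / ‖v‖ ≤ 1 := by
  refine ⟨by positivity, div_le_one_of_le₀ ?_ (norm_nonneg _)⟩
  have h := abs_real_inner_le_norm v (ω : Vel)
  rwa [norm_eq_of_mem_sphere, mul_one] at h

/-- The relation `symm_both` exchanges the incoming and the outgoing energies together, and
`symm_out` then restores the outgoing order. The absolute value in the cosine absorbs the sign
change of the relative velocity. -/
theorem stdDensity_comm {m δ : ℝ} (hm : 0 < m) {σ : CrossSection}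
    (hσ : IsStandardCrossSection m δ σ) {x y : State} {b : Dir × ℝ × ℝ} (hx : 0 < x.2)
    (hy : 0 < y.2) (hb : 0 < b.2.1 ∧ 0 < b.2.2) :
    stdDensity m δ σ y (x, b) = stdDensity m δ σ x (y, b) := by
  have hP : Possible m y x b.2.1 b.2.2 ↔ Possible m x y b.2.1 b.2.2 := by
    unfold Possible
    rw [gap_comm, norm_sub_rev]
  simp only [stdDensity]
  by_cases h : Possible m x y b.2.1 b.2.2
  · rw [if_pos (hP.2 h), if_pos h]
    congr 1
    rw [mul_comm y.2, norm_sub_rev]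
    -- The symmetry relations are assumed only for positive relative speed. At zero relative speed
    -- the factor `|g|` makes both sides vanish.
    rcases (norm_nonneg (x.1 - y.1)).eq_or_lt with h0 | h0
    · simp [← h0]
    congr 1
    unfold CrossSection.at
    have hsq := Real.sq_sqrt (sub_nonneg.2 (le_of_lt h))
    have hen : m / 4 * ‖x.1 - y.1‖ ^ 2 + x.2 + y.2
        = m / 4 * Real.sqrt (‖x.1 - y.1‖ ^ 2 - 4 / m * gap x y b.2.1 b.2.2) ^ 2
          + b.2.1 + b.2.2 := by
      rw [hsq]; simp only [gap]; field_simp; ring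
    have hq := Real.sqrt_pos.2 (sub_pos.2 h)
    have hc := cos_mem_Icc (x.1 - y.1) b.1
    rw [← neg_sub x.1 y.1, norm_neg, inner_neg_left, abs_neg,
      hσ.symm_both _ _ _ _ _ _ _ h0 hq hc.1 hc.2 hx hy hb.1 hb.2 hen]
    exact hσ.symm_out _ _ _ _ _ _ _ h0 hq hc.1 hc.2 hy hx hb.1 hb.2 (by linarith)
  · rw [if_neg (hP.not.2 h), if_neg h]

theorem resDensity_comm {δ : ℝ} {σ : CrossSection}
    (hσ : IsResonantCrossSection δ σ) {x y : State} {b : Dir × ℝ} (hx : 0 < x.2)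
    (hy : 0 < y.2) (hb : 0 < b.2) :
    resDensity δ σ y (x, b) = resDensity δ σ x (y, b) := by
  simp only [resDensity, add_comm y.2 x.2]
  by_cases h : b.2 < x.2 + y.2
  · rw [if_pos h, if_pos h]
    congr 1
    rw [mul_comm y.2, norm_sub_rev]
    rcases (norm_nonneg (x.1 - y.1)).eq_or_lt with h0 | h0
    · simp [← h0]
    congr 1
    unfold CrossSection.at
    have hc := cos_mem_Icc (x.1 - y.1) b.1
    rw [← neg_sub x.1 y.1, norm_neg, inner_neg_left, abs_neg,
      hσ.symm_both _ _ _ _ _ _ h0 hc.1 hc.2 hx hy hb (by linarith) (by linarith)]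
    exact hσ.symm_out _ _ _ _ _ _ h0 hc.1 hc.2 hy hx hb (by linarith) (by linarith)
  · rw [if_neg h, if_neg h]

theorem stdCollision_comm (m : ℝ) (x y : State) (b : Dir × ℝ × ℝ) :
    stdCollision m (y, x, b) = swapInitial (stdCollision m (x, y, b)) := by
  simp only [stdCollision, swapInitial, outcome, gap_comm x y, norm_sub_rev y.1 x.1,
    add_comm y.1 x.1]

theorem resCollision_comm (x y : State) (b : Dir × ℝ) :
    resCollision (y, x, b) = swapInitial (resCollision (x, y, b)) := by
  simp only [resCollision, swapInitial, outcome, norm_sub_rev y.1 x.1, add_comm y.1 x.1,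
    add_comm y.2 x.2]

/-- Exchanging the first two variables of a density that is symmetric almost everywhere. -/
theorem lintegral_swap_states {B : Type*} [MeasurableSpace B] {β : Measure B} [SFinite β]
    {D F F' : State × State × B → ℝ≥0∞} (hD : Measurable D) (hF : Measurable F)
    (hsymm : ∀ᵐ x ∂stateMeasure, ∀ᵐ y ∂stateMeasure, ∀ᵐ b ∂β,
      D (y, x, b) * F (y, x, b) = D (x, y, b) * F' (x, y, b)) (hF' : Measurable F') :
    ∫⁻ x, ∫⁻ z, D (x, z) * F' (x, z) ∂(stateMeasure.prod β) ∂stateMeasure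
      = ∫⁻ x, ∫⁻ z, D (x, z) * F (x, z) ∂(stateMeasure.prod β) ∂stateMeasure := by
  have e : ∀ F : State × State × B → ℝ≥0∞, Measurable F → ∀ x,
      ∫⁻ z, D (x, z) * F (x, z) ∂(stateMeasure.prod β)
      = ∫⁻ y, ∫⁻ b, D (x, y, b) * F (x, y, b) ∂β ∂stateMeasure := fun F hF x =>
    lintegral_prod _ ((hD.comp (by fun_prop)).mul (hF.comp (by fun_prop))).aemeasurable
  simp only [e F hF, e F' hF']
  rw [lintegral_lintegral_swap (f := fun x y => ∫⁻ b, D (x, y, b) * F (x, y, b) ∂β)]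
  · refine lintegral_congr_ae ?_
    filter_upwards [hsymm] with x hx
    refine lintegral_congr_ae ?_
    filter_upwards [hx] with y hy
    exact lintegral_congr_ae (hy.mono fun b hb => hb.symm)
  · have : Measurable fun p : (State × State) × B =>
        D (p.1.1, p.1.2, p.2) * F (p.1.1, p.1.2, p.2) :=
      (hD.comp (by fun_prop)).mul (hF.comp (by fun_prop))
    exact this.lintegral_prod_right'.aemeasurable

theorem stdIntegral_swapInitial {m δ : ℝ} (hm : 0 < m) {σ : CrossSection}
    (hσ : IsStandardCrossSection m δ σ) {f : State × State × State × State → ℝ≥0∞}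
    (hf : Measurable f) : stdIntegral m δ σ (f ∘ swapInitial) = stdIntegral m δ σ f := by
  have hc := (continuous_stdCollision m).measurable
  refine lintegral_swap_states (D := fun p => stdDensity m δ σ p.1 p.2)
    (F := fun p => f (stdCollision m p)) (F' := fun p => f (swapInitial (stdCollision m p)))
    (measurable_stdDensity hσ.measurable) (hf.comp hc) ?_
    (hf.comp (measurable_swapInitial.comp hc))
  filter_upwards [ae_state_energy_pos] with x hx
  filter_upwards [ae_state_energy_pos] with y hy
  filter_upwards [ae_dir_energies_pos] with b hb
  rw [stdCollision_comm, stdDensity_comm hm hσ hx hy hb]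

theorem resIntegral_swapInitial {δ : ℝ} {σ : CrossSection}
    (hσ : IsResonantCrossSection δ σ) {f : State × State × State × State → ℝ≥0∞}
    (hf : Measurable f) : resIntegral δ σ (f ∘ swapInitial) = resIntegral δ σ f := by
  have hc := continuous_resCollision.measurable
  refine lintegral_swap_states (D := fun p => resDensity δ σ p.1 p.2)
    (F := fun p => f (resCollision p)) (F' := fun p => f (swapInitial (resCollision p)))
    (measurable_resDensity hσ.measurable) (hf.comp hc) ?_
    (hf.comp (measurable_swapInitial.comp hc))
  filter_upwards [ae_state_energy_pos] with x hx
  filter_upwards [ae_state_energy_pos] with y hy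
  filter_upwards [ae_dir_energy_pos] with b hb
  rw [resCollision_comm, resDensity_comm hσ hx hy hb]

end Polyatomic
-- Time reversal of standard collisions
namespace Polyatomic

open scoped ENNReal

/-- The pair of states with centre of mass velocity `G`, relative velocity `r a.1` and internal
energies `a.2`. -/
def statePair (G : Vel) (r : ℝ) (a : Dir × ℝ × ℝ) : State × State :=
  ((G + (r / 2) • (a.1 : Vel), a.2.1), (G - (r / 2) • (a.1 : Vel), a.2.2))

theorem measurable_statePair : Measurable fun p : Vel × ℝ × Dir × ℝ × ℝ =>
    statePair p.1 p.2.1 p.2.2 := by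
  unfold statePair
  fun_prop

theorem statePair_sub (G : Vel) (r : ℝ) (ω : Dir) :
    (G + (r / 2) • (ω : Vel)) - (G - (r / 2) • (ω : Vel)) = r • (ω : Vel) := by
  module

theorem statePair_mid (G : Vel) (r : ℝ) (ω : Dir) :
    (1 / 2 : ℝ) • ((G + (r / 2) • (ω : Vel)) + (G - (r / 2) • (ω : Vel))) = G := by
  module

theorem norm_smul_dir {r : ℝ} (hr : 0 < r) (ω : Dir) : ‖r • (ω : Vel)‖ = r := by
  rw [norm_smul, norm_eq_of_mem_sphere, mul_one, Real.norm_of_nonneg hr.le]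

theorem cos_smul_dir {r : ℝ} (hr : 0 < r) (ω ω' : Dir) :
    |inner ℝ (r • (ω : Vel)) (ω' : Vel)| / r = |inner ℝ (ω : Vel) (ω' : Vel)| := by
  rw [real_inner_smul_left, abs_mul, abs_of_pos hr, mul_div_cancel_left₀ _ hr.ne']

/-- The weight of a collision with relative speed `r` in centre of mass coordinates. -/
def polarWeight (δ : ℝ) (σ : CrossSection) (r : ℝ) (a b : Dir × ℝ × ℝ) : ℝ≥0∞ :=
  ENNReal.ofReal ((a.2.1 * a.2.2) ^ (δ / 2 - 1) * r ^ 2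
    * σ r |inner ℝ (a.1 : Vel) (b.1 : Vel)| a.2.1 a.2.2 b.2.1 b.2.2)

theorem measurable_polarWeight {δ : ℝ} {σ : CrossSection}
    (hσ : Measurable fun z : ℝ × ℝ × ℝ × ℝ × ℝ × ℝ =>
      σ z.1 z.2.1 z.2.2.1 z.2.2.2.1 z.2.2.2.2.1 z.2.2.2.2.2) :
    Measurable fun p : ℝ × (Dir × ℝ × ℝ) × (Dir × ℝ × ℝ) =>
      polarWeight δ σ p.1 p.2.1 p.2.2 := by
  have h := hσ.comp (f := fun p : ℝ × (Dir × ℝ × ℝ) × (Dir × ℝ × ℝ) =>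
    ((p.1, |inner ℝ (p.2.1.1 : Vel) (p.2.2.1 : Vel)|, p.2.1.2.1, p.2.1.2.2, p.2.2.2.1, p.2.2.2.2) :
      ℝ × ℝ × ℝ × ℝ × ℝ × ℝ)) (by fun_prop)
  simp only [Function.comp_def] at h
  unfold polarWeight
  fun_prop

theorem cos_dir_mem_Icc (ω ω' : Dir) :
    0 ≤ |inner ℝ (ω : Vel) (ω' : Vel)| ∧ |inner ℝ (ω : Vel) (ω' : Vel)| ≤ 1 := by
  refine ⟨abs_nonneg _, ?_⟩
  have h := abs_real_inner_le_norm (ω : Vel) (ω' : Vel)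
  rwa [norm_eq_of_mem_sphere, norm_eq_of_mem_sphere, mul_one] at h

/-- Microreversibility is exactly this symmetry, since the scattering angle enters through an inner
product of the two directions. -/
theorem polarWeight_symm_std {m δ : ℝ} {σ : CrossSection} (hσ : IsStandardCrossSection m δ σ)
    {r q : ℝ} (hr : 0 < r) (hq : 0 < q) {a b : Dir × ℝ × ℝ} (ha : 0 < a.2.1 ∧ 0 < a.2.2)
    (hb : 0 < b.2.1 ∧ 0 < b.2.2)
    (hen : m / 4 * r ^ 2 + a.2.1 + a.2.2 = m / 4 * q ^ 2 + b.2.1 + b.2.2) :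
    polarWeight δ σ r a b = polarWeight δ σ q b a := by
  have hc := cos_dir_mem_Icc a.1 b.1
  unfold polarWeight
  rw [hσ.microreversible _ _ _ _ _ _ _ hr hq hc.1 hc.2 ha.1 ha.2 hb.1 hb.2 hen, real_inner_comm]

theorem polarWeight_symm_res {δ : ℝ} {σ : CrossSection} (hσ : IsResonantCrossSection δ σ)
    {r : ℝ} (hr : 0 < r) {a b : Dir × ℝ × ℝ} (ha : 0 < a.2.1 ∧ 0 < a.2.2)
    (hb : 0 < b.2.1 ∧ 0 < b.2.2) (hen : a.2.1 + a.2.2 = b.2.1 + b.2.2) :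
    polarWeight δ σ r a b = polarWeight δ σ r b a := by
  have hc := cos_dir_mem_Icc a.1 b.1
  unfold polarWeight
  rw [hσ.microreversible _ _ _ _ _ _ hr hc.1 hc.2 ha.1 ha.2 hb.1 hb.2 hen, real_inner_comm]

/-- `r² - q²` for a standard collision with energies `a.2` before and `b.2` after. -/
def speedLoss (m : ℝ) (a b : Dir × ℝ × ℝ) : ℝ := 4 / m * (b.2.1 + b.2.2 - a.2.1 - a.2.2)

theorem measurable_speedLoss (m : ℝ) : Measurable fun p : (Dir × ℝ × ℝ) × (Dir × ℝ × ℝ) =>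
    speedLoss m p.1 p.2 := by
  unfold speedLoss
  fun_prop

/-- Reordering of the incoming and outgoing states. -/
def quad (p q : State × State) : State × State × State × State := (p.1, p.2, q.1, q.2)

theorem measurable_quad : Measurable fun p : (State × State) × State × State => quad p.1 p.2 := by
  unfold quad
  fun_prop

open Classical in
/-- The integrand of `stdIntegral` in centre of mass coordinates. -/
def stdPolar (m δ : ℝ) (σ : CrossSection) (f : State × State × State × State → ℝ≥0∞)
    (G : Vel) (a b : Dir × ℝ × ℝ) (r : ℝ) : ℝ≥0∞ :=
  if speedLoss m a b < r ^ 2 then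
    ENNReal.ofReal r * (polarWeight δ σ r a b
      * f (quad (statePair G r a) (statePair G (Real.sqrt (r ^ 2 - speedLoss m a b)) b)))
  else 0

/-- The Jacobian `r²` and the factor `|g| = r` give `r³`. Two powers complete the weight that is
symmetric by microreversibility, and the third is kept for the substitution `r dr = q dq`. -/
theorem stdDensity_statePair {m δ : ℝ} {σ : CrossSection}
    {f : State × State × State × State → ℝ≥0∞} {G : Vel} {a b : Dir × ℝ × ℝ} {r : ℝ}
    (hr : 0 < r) :
    ENNReal.ofReal (r ^ 2) * (stdDensity m δ σ (statePair G r a).1 ((statePair G r a).2, b)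
      * f (stdCollision m ((statePair G r a).1, (statePair G r a).2, b)))
      = stdPolar m δ σ f G a b r := by
  have hgap : 4 / m * gap (statePair G r a).1 (statePair G r a).2 b.2.1 b.2.2
      = speedLoss m a b := rfl
  have hsub : (statePair G r a).1.1 - (statePair G r a).2.1 = r • (a.1 : Vel) :=
    statePair_sub G r a.1
  have hmid : (1 / 2 : ℝ) • ((statePair G r a).1.1 + (statePair G r a).2.1) = G :=
    statePair_mid G r a.1
  have hcol : stdCollision m ((statePair G r a).1, (statePair G r a).2, b)
      = quad (statePair G r a) (statePair G (Real.sqrt (r ^ 2 - speedLoss m a b)) b) := by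
    simp only [stdCollision, outcome, quad, hgap, hsub, hmid, norm_smul_dir hr]
    rfl
  simp only [stdDensity, stdPolar, Possible, hgap, hsub, norm_smul_dir hr, hcol]
  by_cases h : speedLoss m a b < r ^ 2
  · rw [if_pos h, if_pos h, ← mul_assoc, ← mul_assoc]
    congr 1
    rw [polarWeight, ← ENNReal.ofReal_mul (by positivity), ← ENNReal.ofReal_mul hr.le]
    congr 1
    simp only [CrossSection.at, hsub, norm_smul_dir hr, cos_smul_dir hr]
    simp only [statePair]
    ring
  · rw [if_neg h, if_neg h, zero_mul, mul_zero]

theorem measurable_stdPolar {m δ : ℝ} {σ : CrossSection}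
    (hσ : Measurable fun z : ℝ × ℝ × ℝ × ℝ × ℝ × ℝ =>
      σ z.1 z.2.1 z.2.2.1 z.2.2.2.1 z.2.2.2.2.1 z.2.2.2.2.2)
    {f : State × State × State × State → ℝ≥0∞} (hf : Measurable f) :
    Measurable fun p : Vel × (Dir × ℝ × ℝ) × (Dir × ℝ × ℝ) × ℝ =>
      stdPolar m δ σ f p.1 p.2.1 p.2.2.1 p.2.2.2 := by
  have h1 : Measurable fun p : Vel × (Dir × ℝ × ℝ) × (Dir × ℝ × ℝ) × ℝ =>
      polarWeight δ σ p.2.2.2 p.2.1 p.2.2.1 :=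
    (measurable_polarWeight hσ).comp (f := fun p : Vel × (Dir × ℝ × ℝ) × (Dir × ℝ × ℝ) × ℝ =>
      (p.2.2.2, p.2.1, p.2.2.1)) (by fun_prop)
  have h2 : Measurable fun p : Vel × (Dir × ℝ × ℝ) × (Dir × ℝ × ℝ) × ℝ =>
      speedLoss m p.2.1 p.2.2.1 :=
    (measurable_speedLoss m).comp (f := fun p : Vel × (Dir × ℝ × ℝ) × (Dir × ℝ × ℝ) × ℝ =>
      (p.2.1, p.2.2.1)) (by fun_prop)
  have h3 : Measurable fun p : Vel × (Dir × ℝ × ℝ) × (Dir × ℝ × ℝ) × ℝ =>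
      statePair p.1 p.2.2.2 p.2.1 :=
    measurable_statePair.comp (f := fun p : Vel × (Dir × ℝ × ℝ) × (Dir × ℝ × ℝ) × ℝ =>
      (p.1, p.2.2.2, p.2.1)) (by fun_prop)
  have h4 : Measurable fun p : Vel × (Dir × ℝ × ℝ) × (Dir × ℝ × ℝ) × ℝ =>
      statePair p.1 (Real.sqrt (p.2.2.2 ^ 2 - speedLoss m p.2.1 p.2.2.1)) p.2.2.1 :=
    measurable_statePair.comp (f := fun p : Vel × (Dir × ℝ × ℝ) × (Dir × ℝ × ℝ) × ℝ =>
      (p.1, Real.sqrt (p.2.2.2 ^ 2 - speedLoss m p.2.1 p.2.2.1), p.2.2.1)) (by fun_prop)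
  have h5 := hf.comp (measurable_quad.comp (h3.prodMk h4))
  simp only [Function.comp_def] at h5
  exact Measurable.ite (measurableSet_lt h2 (by fun_prop))
    (Measurable.mul (by fun_prop) (h1.mul h5)) measurable_const

/-- `lintegral_pair` for functions of two states and further variables. -/
theorem lintegral_pair_param {B : Type*} [MeasurableSpace B] {β : Measure B} [SFinite β]
    (K : State × State × B → ℝ≥0∞) (hK : Measurable K) :
    ∫⁻ x, ∫⁻ z, K (x, z) ∂(stateMeasure.prod β) ∂stateMeasure
      = ∫⁻ G : Vel, ∫⁻ ω : Dir, ∫⁻ r, ∫⁻ e, ∫⁻ b, ENNReal.ofReal (r ^ 2) *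
          K ((statePair G r (ω, e)).1, (statePair G r (ω, e)).2, b) ∂β
            ∂(energyMeasure.prod energyMeasure) ∂energyMeasure ∂dirMeasure := by
  have e1 : ∀ x, ∫⁻ z, K (x, z) ∂(stateMeasure.prod β)
      = ∫⁻ y, ∫⁻ b, K (x, y, b) ∂β ∂stateMeasure :=
    fun x => lintegral_prod _ (hK.comp (by fun_prop)).aemeasurable
  have hH : Measurable fun q : Vel × Vel × (ℝ × ℝ) =>
      ∫⁻ b, K ((q.1, q.2.2.1), (q.2.1, q.2.2.2), b) ∂β := by
    have : Measurable fun p : (Vel × Vel × (ℝ × ℝ)) × B =>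
        K ((p.1.1, p.1.2.2.1), (p.1.2.1, p.1.2.2.2), p.2) := hK.comp (by fun_prop)
    exact this.lintegral_prod_right'
  have e2 := lintegral_pair _ hH
  simp only [Prod.mk.eta] at e2
  simp only [e1]
  rw [e2]
  refine lintegral_congr fun G => lintegral_congr fun ω => lintegral_congr fun r => ?_
  rw [← lintegral_const_mul' _ _ ENNReal.ofReal_ne_top]
  refine lintegral_congr fun e => ?_
  rw [← lintegral_const_mul' _ _ ENNReal.ofReal_ne_top]
  rfl

/-- Moving the integral over the relative speed to the inside. -/
theorem lintegral_speed_last {B : Type*} [MeasurableSpace B] {β : Measure B} [SFinite β]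
    (P : (Dir × ℝ × ℝ) × B × ℝ → ℝ≥0∞) (hP : Measurable P) :
    ∫⁻ ω, ∫⁻ r, ∫⁻ e, ∫⁻ b, P ((ω, e), b, r) ∂β ∂(energyMeasure.prod energyMeasure)
        ∂energyMeasure ∂dirMeasure
      = ∫⁻ a, ∫⁻ b, ∫⁻ r, P (a, b, r) ∂energyMeasure ∂β
        ∂(dirMeasure.prod (energyMeasure.prod energyMeasure)) := by
  rw [lintegral_prod (fun a : Dir × ℝ × ℝ => ∫⁻ b, ∫⁻ r, P (a, b, r) ∂energyMeasure ∂β)]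
  · refine lintegral_congr fun ω => ?_
    rw [lintegral_lintegral_swap]
    · refine lintegral_congr fun e => ?_
      rw [lintegral_lintegral_swap]
      exact (hP.comp (f := fun p : ℝ × B => ((ω, e), p.2, p.1)) (by fun_prop)).aemeasurable
    · have : Measurable fun p : (ℝ × (ℝ × ℝ)) × B => P ((ω, p.1.2), p.2, p.1.1) :=
        hP.comp (by fun_prop)
      exact this.lintegral_prod_right'.aemeasurable
  · have : Measurable fun p : ((Dir × ℝ × ℝ) × B) × ℝ => P (p.1.1, p.1.2, p.2) :=
      hP.comp (by fun_prop)
    exact this.lintegral_prod_right'.lintegral_prod_right'.aemeasurable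

theorem stdIntegral_eq_polar {m δ : ℝ} {σ : CrossSection}
    (hσ : Measurable fun z : ℝ × ℝ × ℝ × ℝ × ℝ × ℝ =>
      σ z.1 z.2.1 z.2.2.1 z.2.2.2.1 z.2.2.2.2.1 z.2.2.2.2.2)
    {f : State × State × State × State → ℝ≥0∞} (hf : Measurable f) :
    stdIntegral m δ σ f = ∫⁻ G : Vel, ∫⁻ a, ∫⁻ b, ∫⁻ r, stdPolar m δ σ f G a b r ∂energyMeasure
      ∂(dirMeasure.prod (energyMeasure.prod energyMeasure))
      ∂(dirMeasure.prod (energyMeasure.prod energyMeasure)) := by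
  have hP := measurable_stdPolar (m := m) (δ := δ) hσ hf
  have hK : Measurable fun z : StdParam => stdDensity m δ σ z.1 z.2 * f (stdCollision m z) :=
    (measurable_stdDensity hσ).mul (hf.comp (continuous_stdCollision m).measurable)
  refine (lintegral_pair_param _ hK).trans (lintegral_congr fun G => ?_)
  rw [← lintegral_speed_last (fun p => stdPolar m δ σ f G p.1 p.2.1 p.2.2)
    (hP.comp (f := fun p : (Dir × ℝ × ℝ) × (Dir × ℝ × ℝ) × ℝ => (G, p)) (by fun_prop))]
  refine lintegral_congr fun ω => lintegral_congr_ae ?_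
  filter_upwards [ae_energy_pos] with r hr
  exact lintegral_congr fun e => lintegral_congr fun b => stdDensity_statePair hr

theorem lintegral_stdPolar (m δ : ℝ) (σ : CrossSection)
    (f : State × State × State × State → ℝ≥0∞) (G : Vel) (a b : Dir × ℝ × ℝ) :
    ∫⁻ r, stdPolar m δ σ f G a b r ∂energyMeasure
      = ∫⁻ r in {r : ℝ | 0 < r ∧ speedLoss m a b < r ^ 2}, ENNReal.ofReal r *
        (polarWeight δ σ r a b * f (quad (statePair G r a)
          (statePair G (Real.sqrt (r ^ 2 - speedLoss m a b)) b))) := by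
  have hm1 : MeasurableSet {r : ℝ | speedLoss m a b < r ^ 2} :=
    measurableSet_lt measurable_const (by fun_prop)
  have hm2 : MeasurableSet {r : ℝ | 0 < r ∧ speedLoss m a b < r ^ 2} :=
    measurableSet_Ioi.inter hm1
  rw [energyMeasure, ← lintegral_indicator measurableSet_Ioi, ← lintegral_indicator hm2]
  refine lintegral_congr fun r => ?_
  simp only [indicator_apply, stdPolar, mem_Ioi, mem_ofPred_eq]
  by_cases h1 : 0 < r <;> by_cases h2 : speedLoss m a b < r ^ 2 <;> simp [h1, h2]

/-- At fixed centre of mass velocity, directions and energies, time reversal is a one-dimensional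
substitution between the two relative speeds. Exchanging `a` and `b` reverses the sign of
`speedLoss`. -/
theorem lintegral_stdPolar_swapTime {m δ : ℝ} (hm : 0 < m) {σ : CrossSection}
    (hσ : IsStandardCrossSection m δ σ) (f : State × State × State × State → ℝ≥0∞)
    (G : Vel) {a b : Dir × ℝ × ℝ} (ha : 0 < a.2.1 ∧ 0 < a.2.2) (hb : 0 < b.2.1 ∧ 0 < b.2.2) :
    ∫⁻ r, stdPolar m δ σ (f ∘ swapTime) G b a r ∂energyMeasure
      = ∫⁻ r, stdPolar m δ σ f G a b r ∂energyMeasure := by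
  have hA : speedLoss m b a = - speedLoss m a b := by simp only [speedLoss]; ring
  rw [lintegral_stdPolar, lintegral_stdPolar, hA,
    lintegral_relative_speed (speedLoss m a b) (fun r q => polarWeight δ σ r a b *
      f (quad (statePair G r a) (statePair G q b)))]
  have hm2 : MeasurableSet {r : ℝ | 0 < r ∧ -speedLoss m a b < r ^ 2} :=
    measurableSet_Ioi.inter (measurableSet_lt measurable_const (measurable_id.pow_const 2))
  refine setLIntegral_congr_fun hm2 fun q hq => ?_
  have hpos : 0 < q ^ 2 + speedLoss m a b := by have := hq.2; linarith
  have hs := Real.sq_sqrt hpos.le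
  rw [polarWeight_symm_std hσ (Real.sqrt_pos.2 hpos) hq.1 ha hb, sub_neg_eq_add]
  · rfl
  -- Energy compatibility of the speeds `√(q² + A)` and `q`, the condition under which
  -- microreversibility is assumed.
  · rw [hs]; simp only [speedLoss]; field_simp; ring

theorem stdIntegral_swapTime {m δ : ℝ} (hm : 0 < m) {σ : CrossSection}
    (hσ : IsStandardCrossSection m δ σ) {f : State × State × State × State → ℝ≥0∞}
    (hf : Measurable f) : stdIntegral m δ σ (f ∘ swapTime) = stdIntegral m δ σ f := by
  rw [stdIntegral_eq_polar hσ.measurable hf,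
    stdIntegral_eq_polar hσ.measurable (hf.comp measurable_swapTime)]
  refine lintegral_congr fun G => ?_
  rw [lintegral_lintegral_swap]
  · refine lintegral_congr_ae ?_
    filter_upwards [ae_dir_energies_pos] with a ha
    refine lintegral_congr_ae ?_
    filter_upwards [ae_dir_energies_pos] with b hb
    exact lintegral_stdPolar_swapTime hm hσ f G ha hb
  · have : Measurable fun p : ((Dir × ℝ × ℝ) × (Dir × ℝ × ℝ)) × ℝ =>
        stdPolar m δ σ (f ∘ swapTime) G p.1.1 p.1.2 p.2 :=
      (measurable_stdPolar hσ.measurable (hf.comp measurable_swapTime)).comp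
        (f := fun p : ((Dir × ℝ × ℝ) × (Dir × ℝ × ℝ)) × ℝ => (G, p.1.1, p.1.2, p.2))
        (by fun_prop)
    exact this.lintegral_prod_right'.aemeasurable

end Polyatomic
-- Time reversal of resonant collisions
namespace Polyatomic

open scoped ENNReal

/-- The integrand of `resIntegral` in centre of mass coordinates. -/
def resPolar (δ : ℝ) (σ : CrossSection) (f : State × State × State × State → ℝ≥0∞)
    (G : Vel) (r : ℝ) (ω ω' : Dir) (e : ℝ × ℝ × ℝ × ℝ) : ℝ≥0∞ :=
  ENNReal.ofReal r * (polarWeight δ σ r (ω, e.1, e.2.1) (ω', e.2.2)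
    * f (quad (statePair G r (ω, e.1, e.2.1)) (statePair G r (ω', e.2.2))))

theorem measurable_resPolar {δ : ℝ} {σ : CrossSection}
    (hσ : Measurable fun z : ℝ × ℝ × ℝ × ℝ × ℝ × ℝ =>
      σ z.1 z.2.1 z.2.2.1 z.2.2.2.1 z.2.2.2.2.1 z.2.2.2.2.2)
    {f : State × State × State × State → ℝ≥0∞} (hf : Measurable f) :
    Measurable fun p : Vel × ℝ × Dir × Dir × ℝ × ℝ × ℝ × ℝ =>
      resPolar δ σ f p.1 p.2.1 p.2.2.1 p.2.2.2.1 p.2.2.2.2 := by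
  have h1 := (measurable_polarWeight (δ := δ) hσ).comp
    (f := fun p : Vel × ℝ × Dir × Dir × ℝ × ℝ × ℝ × ℝ =>
      (p.2.1, (p.2.2.1, p.2.2.2.2.1, p.2.2.2.2.2.1), (p.2.2.2.1, p.2.2.2.2.2.2))) (by fun_prop)
  have h2 := measurable_statePair.comp (f := fun p : Vel × ℝ × Dir × Dir × ℝ × ℝ × ℝ × ℝ =>
      (p.1, p.2.1, (p.2.2.1, p.2.2.2.2.1, p.2.2.2.2.2.1))) (by fun_prop)
  have h3 := measurable_statePair.comp (f := fun p : Vel × ℝ × Dir × Dir × ℝ × ℝ × ℝ × ℝ =>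
      (p.1, p.2.1, (p.2.2.2.1, p.2.2.2.2.2.2))) (by fun_prop)
  have h4 := hf.comp (measurable_quad.comp (h2.prodMk h3))
  exact Measurable.mul (by fun_prop) (h1.mul h4)

open Classical in
theorem resDensity_statePair {δ : ℝ} {σ : CrossSection}
    {f : State × State × State × State → ℝ≥0∞} {G : Vel} {ω : Dir} {e : ℝ × ℝ} {b : Dir × ℝ}
    {r : ℝ} (hr : 0 < r) :
    ENNReal.ofReal (r ^ 2) * (resDensity δ σ (statePair G r (ω, e)).1
      ((statePair G r (ω, e)).2, b) * f (resCollision ((statePair G r (ω, e)).1,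
        (statePair G r (ω, e)).2, b)))
      = if b.2 < e.1 + e.2 then resPolar δ σ f G r ω b.1 (e.1, e.2, b.2, e.1 + e.2 - b.2)
        else 0 := by
  have hsub : (statePair G r (ω, e)).1.1 - (statePair G r (ω, e)).2.1 = r • (ω : Vel) :=
    statePair_sub G r ω
  have hmid : (1 / 2 : ℝ) • ((statePair G r (ω, e)).1.1 + (statePair G r (ω, e)).2.1) = G :=
    statePair_mid G r ω
  have h1 : (statePair G r (ω, e)).1.2 = e.1 := rfl
  have h2 : (statePair G r (ω, e)).2.2 = e.2 := rfl
  have hcol : resCollision ((statePair G r (ω, e)).1, (statePair G r (ω, e)).2, b)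
      = quad (statePair G r (ω, e.1, e.2)) (statePair G r (b.1, b.2, e.1 + e.2 - b.2)) := by
    simp only [resCollision, outcome, quad, hsub, hmid, h1, h2, norm_smul_dir hr]
    rfl
  simp only [resDensity, hsub, norm_smul_dir hr, hcol, h1, h2]
  by_cases h : b.2 < e.1 + e.2
  · rw [if_pos h, if_pos h, resPolar, ← mul_assoc, ← mul_assoc]
    congr 1
    rw [polarWeight, ← ENNReal.ofReal_mul (by positivity), ← ENNReal.ofReal_mul hr.le]
    congr 1
    simp only [CrossSection.at, hsub, norm_smul_dir hr, cos_smul_dir hr, h1, h2]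
    ring
  · rw [if_neg h, if_neg h, zero_mul, mul_zero]

-- The relative speed is the same before and after, so it is moved outside together with `G`. Inside
-- remain only the two directions and the energies, which time reversal exchanges.
open Classical in
theorem resIntegral_eq_polar {δ : ℝ} {σ : CrossSection}
    (hσ : Measurable fun z : ℝ × ℝ × ℝ × ℝ × ℝ × ℝ =>
      σ z.1 z.2.1 z.2.2.1 z.2.2.2.1 z.2.2.2.2.1 z.2.2.2.2.2)
    {f : State × State × State × State → ℝ≥0∞} (hf : Measurable f) :
    resIntegral δ σ f = ∫⁻ G : Vel, ∫⁻ r, ∫⁻ ω, ∫⁻ ω', ∫⁻ I, ∫⁻ J, ∫⁻ I',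
      (if I' < I + J then resPolar δ σ f G r ω ω' (I, J, I', I + J - I') else 0)
      ∂energyMeasure ∂energyMeasure ∂energyMeasure ∂dirMeasure ∂dirMeasure ∂energyMeasure := by
  have hP := measurable_resPolar (δ := δ) hσ hf
  have hR : Measurable fun p : Vel × ℝ × Dir × Dir × ℝ × ℝ × ℝ =>
      (if p.2.2.2.2.2.2 < p.2.2.2.2.1 + p.2.2.2.2.2.1 then
        resPolar δ σ f p.1 p.2.1 p.2.2.1 p.2.2.2.1 (p.2.2.2.2.1, p.2.2.2.2.2.1, p.2.2.2.2.2.2,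
          p.2.2.2.2.1 + p.2.2.2.2.2.1 - p.2.2.2.2.2.2) else 0) :=
    Measurable.ite (measurableSet_lt (by fun_prop) (by fun_prop))
      (hP.comp (f := fun p : Vel × ℝ × Dir × Dir × ℝ × ℝ × ℝ =>
        (p.1, p.2.1, p.2.2.1, p.2.2.2.1, (p.2.2.2.2.1, p.2.2.2.2.2.1, p.2.2.2.2.2.2,
          p.2.2.2.2.1 + p.2.2.2.2.2.1 - p.2.2.2.2.2.2))) (by fun_prop)) measurable_const
  have hK : Measurable fun z : ResParam => resDensity δ σ z.1 z.2 * f (resCollision z) :=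
    (measurable_resDensity hσ).mul (hf.comp continuous_resCollision.measurable)
  refine (lintegral_pair_param _ hK).trans (lintegral_congr fun G => ?_)
  have e1 : ∀ ω : Dir, ∀ᵐ r ∂energyMeasure, ∫⁻ e, ∫⁻ b : Dir × ℝ, ENNReal.ofReal (r ^ 2) *
      (resDensity δ σ (statePair G r (ω, e)).1 ((statePair G r (ω, e)).2, b)
        * f (resCollision ((statePair G r (ω, e)).1, (statePair G r (ω, e)).2, b)))
        ∂(dirMeasure.prod energyMeasure) ∂(energyMeasure.prod energyMeasure)
      = ∫⁻ ω', ∫⁻ I, ∫⁻ J, ∫⁻ I',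
      (if I' < I + J then resPolar δ σ f G r ω ω' (I, J, I', I + J - I') else 0)
      ∂energyMeasure ∂energyMeasure ∂energyMeasure ∂dirMeasure := by
    intro ω
    filter_upwards [ae_energy_pos] with r hr
    simp only [resDensity_statePair hr]
    have e2 : ∀ e : ℝ × ℝ, ∫⁻ b : Dir × ℝ, (if b.2 < e.1 + e.2 then
        resPolar δ σ f G r ω b.1 (e.1, e.2, b.2, e.1 + e.2 - b.2) else 0)
          ∂(dirMeasure.prod energyMeasure)
        = ∫⁻ ω', ∫⁻ I', (if I' < e.1 + e.2 then
        resPolar δ σ f G r ω ω' (e.1, e.2, I', e.1 + e.2 - I') else 0)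
          ∂energyMeasure ∂dirMeasure := fun e =>
      lintegral_prod _ (hR.comp (f := fun b : Dir × ℝ => (G, r, ω, b.1, e.1, e.2, b.2))
        (by fun_prop)).aemeasurable
    simp only [e2]
    have h3 : Measurable fun p : ((ℝ × ℝ) × Dir) × ℝ => (if p.2 < p.1.1.1 + p.1.1.2 then
        resPolar δ σ f G r ω p.1.2 (p.1.1.1, p.1.1.2, p.2, p.1.1.1 + p.1.1.2 - p.2) else 0) :=
      hR.comp (f := fun p : ((ℝ × ℝ) × Dir) × ℝ => (G, r, ω, p.1.2, p.1.1.1, p.1.1.2, p.2))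
        (by fun_prop)
    rw [lintegral_lintegral_swap h3.lintegral_prod_right'.aemeasurable]
    refine lintegral_congr fun ω' => ?_
    have h4 := h3.lintegral_prod_right' (ν := energyMeasure)
    exact lintegral_prod _ (h4.comp (f := fun e : ℝ × ℝ => (e, ω')) (by fun_prop)).aemeasurable
  simp only [fun ω => lintegral_congr_ae (e1 ω)]
  refine lintegral_lintegral_swap ?_
  have h5 : Measurable fun p : ((((Dir × ℝ) × Dir) × ℝ) × ℝ) × ℝ =>
      (if p.2 < p.1.1.2 + p.1.2 then resPolar δ σ f G p.1.1.1.1.2 p.1.1.1.1.1 p.1.1.1.2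
        (p.1.1.2, p.1.2, p.2, p.1.1.2 + p.1.2 - p.2) else 0) :=
    hR.comp (f := fun p : ((((Dir × ℝ) × Dir) × ℝ) × ℝ) × ℝ =>
      (G, p.1.1.1.1.2, p.1.1.1.1.1, p.1.1.1.2, p.1.1.2, p.1.2, p.2)) (by fun_prop)
  exact h5.lintegral_prod_right'.lintegral_prod_right'.lintegral_prod_right'.lintegral_prod_right'
    |>.aemeasurable

/-- No radial Jacobian arises: the directions are exchanged by Tonelli, the energies by
`lintegral_resonant_energies`, and the weight is symmetric by microreversibility. -/
theorem resIntegral_swapTime {δ : ℝ} {σ : CrossSection}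
    (hσ : IsResonantCrossSection δ σ) {f : State × State × State × State → ℝ≥0∞}
    (hf : Measurable f) : resIntegral δ σ (f ∘ swapTime) = resIntegral δ σ f := by
  classical
  have hf' := hf.comp measurable_swapTime
  have hP := measurable_resPolar (δ := δ) hσ.measurable hf
  have hP' := measurable_resPolar (δ := δ) hσ.measurable hf'
  rw [resIntegral_eq_polar hσ.measurable hf, resIntegral_eq_polar hσ.measurable hf']
  refine lintegral_congr fun G => lintegral_congr_ae ?_
  filter_upwards [ae_energy_pos] with r hr
  rw [lintegral_lintegral_swap]
  · refine lintegral_congr fun ω => lintegral_congr fun ω' => ?_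
    rw [lintegral_resonant_energies (fun e => resPolar δ σ f G r ω ω' e)
      (hP.comp (f := fun e : ℝ × ℝ × ℝ × ℝ => (G, r, ω, ω', e)) (by fun_prop))]
    refine lintegral_congr_ae ?_
    filter_upwards [ae_energy_pos] with I hI
    refine lintegral_congr_ae ?_
    filter_upwards [ae_energy_pos] with J hJ
    refine lintegral_congr_ae ?_
    filter_upwards [ae_energy_pos] with I' hI'
    by_cases h : I' < I + J
    · rw [if_pos h, if_pos h]
      simp only [resPolar]
      rw [polarWeight_symm_res hσ hr (a := (ω', I, J)) (b := (ω, I', I + J - I')) ⟨hI, hJ⟩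
        ⟨hI', by simp only; linarith⟩ (by simp only; ring)]
      rfl
    · rw [if_neg h, if_neg h]
  · have hR : Measurable fun p : (((Dir × Dir) × ℝ) × ℝ) × ℝ =>
        (if p.2 < p.1.1.2 + p.1.2 then resPolar δ σ (f ∘ swapTime) G r p.1.1.1.1 p.1.1.1.2
          (p.1.1.2, p.1.2, p.2, p.1.1.2 + p.1.2 - p.2) else 0) :=
      Measurable.ite (measurableSet_lt (by fun_prop) (by fun_prop))
        (hP'.comp (f := fun p : (((Dir × Dir) × ℝ) × ℝ) × ℝ =>
          (G, r, p.1.1.1.1, p.1.1.1.2, (p.1.1.2, p.1.2, p.2, p.1.1.2 + p.1.2 - p.2)))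
          (by fun_prop)) measurable_const
    exact hR.lintegral_prod_right'.lintegral_prod_right'.lintegral_prod_right'.aemeasurable

end Polyatomic
-- The transition kernel and the invariant measure on collisions
namespace Polyatomic

open scoped ENNReal ProbabilityTheory
open ProbabilityTheory

/-- A kernel given by a density with respect to a fixed measure, followed by a map. -/
theorem exists_kernel_map_withDensity {X B T : Type*} [MeasurableSpace X] [MeasurableSpace B]
    [MeasurableSpace T] (β : Measure B) [SFinite β] {D : X × B → ℝ≥0∞} (hD : Measurable D)
    (hDt : ∀ p, D p ≠ ∞) {Ψ : X × B → T} (hΨ : Measurable Ψ) :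
    ∃ κ : Kernel X T, IsSFiniteKernel κ ∧
      ∀ x, κ x = (β.withDensity fun b => D (x, b)).map fun b => Ψ (x, b) := by
  let κ₀ : Kernel X B := Kernel.withDensity (Kernel.const X β) fun x b => D (x, b)
  have hκ₀ : IsSFiniteKernel κ₀ :=
    -- Finiteness of the density at every point gives s-finiteness. The transition measures
    -- themselves may be infinite, so all invariance statements rest on Tonelli for nonnegative
    -- functions.
    Kernel.IsSFiniteKernel.withDensity _ fun x b => hDt (x, b)
  -- Pairing with the identity kernel keeps `x` available, because the map `Ψ` depends on it.
  refine ⟨(Kernel.id ×ₖ κ₀).map Ψ, inferInstance, fun x => ?_⟩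
  rw [Kernel.map_apply _ hΨ, Kernel.prod_apply, Kernel.id_apply, Measure.dirac_prod,
    Measure.map_map hΨ measurable_prodMk_left]
  congr 1
  exact Kernel.withDensity_apply _ (f := fun x b => D (x, b)) hD x

theorem stdDensity_ne_top (m δ : ℝ) (σ : CrossSection) (x : State) (z : State × Dir × ℝ × ℝ) :
    stdDensity m δ σ x z ≠ ∞ := by
  unfold stdDensity
  split_ifs <;> simp

theorem resDensity_ne_top (δ : ℝ) (σ : CrossSection) (x : State) (z : State × Dir × ℝ) :
    resDensity δ σ x z ≠ ∞ := by
  unfold resDensity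
  split_ifs <;> simp

theorem standardTransition_eq (m δ : ℝ) (σ : CrossSection) (x : State) :
    standardTransition m δ σ x
      = ((stateMeasure.prod (dirMeasure.prod (energyMeasure.prod energyMeasure))).withDensity
        fun z => stdDensity m δ σ x z).map fun z => (stdCollision m (x, z)).2 := rfl

theorem resonantTransition_eq (δ : ℝ) (σ : CrossSection) (x : State) :
    resonantTransition δ σ x
      = ((stateMeasure.prod (dirMeasure.prod energyMeasure)).withDensity
        fun z => resDensity δ σ x z).map fun z => (resCollision (x, z)).2 := rfl

variable {m δ : ℝ} {σs σr : CrossSection}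

/-- The transition measures form an s-finite kernel. -/
theorem exists_transition_kernel (hσs : IsStandardCrossSection m δ σs)
    (hσr : IsResonantCrossSection δ σr) (θ : ℝ) :
    ∃ κ : Kernel State (State × State × State), IsSFiniteKernel κ ∧
      ∀ x, κ x = transition m δ σs σr θ x := by
  have hs := measurable_stdDensity (m := m) (δ := δ) hσs.measurable
  have hr := measurable_resDensity (δ := δ) hσr.measurable
  obtain ⟨κs, hκs, hs'⟩ := exists_kernel_map_withDensity
    (stateMeasure.prod (dirMeasure.prod (energyMeasure.prod energyMeasure)))
    (D := fun p : StdParam => ENNReal.ofReal θ * stdDensity m δ σs p.1 p.2) (by fun_prop)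
    (fun p => ENNReal.mul_ne_top ENNReal.ofReal_ne_top (stdDensity_ne_top _ _ _ _ _))
    (Ψ := fun p => (stdCollision m p).2)
    (measurable_snd.comp (continuous_stdCollision m).measurable)
  obtain ⟨κr, hκr, hr'⟩ := exists_kernel_map_withDensity
    (stateMeasure.prod (dirMeasure.prod energyMeasure))
    (D := fun p : ResParam => ENNReal.ofReal (1 - θ) * resDensity δ σr p.1 p.2) (by fun_prop)
    (fun p => ENNReal.mul_ne_top ENNReal.ofReal_ne_top (resDensity_ne_top _ _ _ _))
    (Ψ := fun p => (resCollision p).2)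
    (measurable_snd.comp continuous_resCollision.measurable)
  refine ⟨κs + κr, inferInstance, fun x => ?_⟩
  have h1 : Measurable fun z => stdDensity m δ σs x z := hs.comp (f := fun z => (x, z))
    (by fun_prop)
  have h2 : Measurable fun z => resDensity δ σr x z := hr.comp (f := fun z => (x, z))
    (by fun_prop)
  have e1 : κs x = ENNReal.ofReal θ • standardTransition m δ σs x := by
    rw [hs', standardTransition_eq, ← Measure.map_smul]
    congr 1
    exact withDensity_smul _ h1
  have e2 : κr x = ENNReal.ofReal (1 - θ) • resonantTransition δ σr x := by
    rw [hr', resonantTransition_eq, ← Measure.map_smul]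
    congr 1
    exact withDensity_smul _ h2
  rw [transition, ← e1, ← e2]
  rfl

theorem lintegral_standardTransition (hσs : IsStandardCrossSection m δ σs)
    {f : State × State × State × State → ℝ≥0∞} (hf : Measurable f) (x : State) :
    ∫⁻ p, f (x, p) ∂(standardTransition m δ σs x)
      = ∫⁻ z, stdDensity m δ σs x z * f (stdCollision m (x, z))
        ∂(stateMeasure.prod (dirMeasure.prod (energyMeasure.prod energyMeasure))) := by
  have hΨ : Measurable fun z => (stdCollision m (x, z)).2 :=
    (measurable_snd.comp (continuous_stdCollision m).measurable).comp (by fun_prop)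
  have hD : Measurable fun z => stdDensity m δ σs x z :=
    (measurable_stdDensity hσs.measurable).comp (f := fun z => (x, z)) (by fun_prop)
  have hfx : Measurable fun p => f (x, p) := hf.comp (by fun_prop)
  rw [standardTransition_eq, lintegral_map hfx hΨ]
  exact lintegral_withDensity_eq_lintegral_mul _ hD (hfx.comp hΨ)

theorem lintegral_resonantTransition (hσr : IsResonantCrossSection δ σr)
    {f : State × State × State × State → ℝ≥0∞} (hf : Measurable f) (x : State) :
    ∫⁻ p, f (x, p) ∂(resonantTransition δ σr x)
      = ∫⁻ z, resDensity δ σr x z * f (resCollision (x, z))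
        ∂(stateMeasure.prod (dirMeasure.prod energyMeasure)) := by
  have hΨ : Measurable fun z => (resCollision (x, z)).2 :=
    (measurable_snd.comp continuous_resCollision.measurable).comp (by fun_prop)
  have hD : Measurable fun z => resDensity δ σr x z :=
    (measurable_resDensity hσr.measurable).comp (f := fun z => (x, z)) (by fun_prop)
  have hfx : Measurable fun p => f (x, p) := hf.comp (by fun_prop)
  rw [resonantTransition_eq, lintegral_map hfx hΨ]
  exact lintegral_withDensity_eq_lintegral_mul _ hD (hfx.comp hΨ)

theorem lintegral_transition (hσs : IsStandardCrossSection m δ σs)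
    (hσr : IsResonantCrossSection δ σr) (θ : ℝ)
    {f : State × State × State × State → ℝ≥0∞} (hf : Measurable f) :
    ∫⁻ x, ∫⁻ p, f (x, p) ∂(transition m δ σs σr θ x) ∂stateMeasure
      = ENNReal.ofReal θ * stdIntegral m δ σs f + ENNReal.ofReal (1 - θ) * resIntegral δ σr f := by
  have hs : Measurable fun z : StdParam => stdDensity m δ σs z.1 z.2 * f (stdCollision m z) :=
    (measurable_stdDensity hσs.measurable).mul (hf.comp (continuous_stdCollision m).measurable)
  simp only [transition, lintegral_add_measure, lintegral_smul_measure, smul_eq_mul,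
    lintegral_standardTransition hσs hf, lintegral_resonantTransition hσr hf]
  rw [lintegral_add_left (hs.lintegral_prod_right'.const_mul _),
    lintegral_const_mul' _ _ ENNReal.ofReal_ne_top, lintegral_const_mul' _ _ ENNReal.ofReal_ne_top]
  rfl

/-- The measure on collisions `(x, y, x', y')`, as a composition product with a kernel, is
invariant under exchange of the incoming molecules and under time reversal. -/
theorem measurePreserving_compProd_transition (hm : 0 < m) (hσs : IsStandardCrossSection m δ σs)
    (hσr : IsResonantCrossSection δ σr) (θ : ℝ) {κ : Kernel State (State × State × State)}
    [IsSFiniteKernel κ] (hκ : ∀ x, κ x = transition m δ σs σr θ x) :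
    MeasurePreserving swapInitial (stateMeasure ⊗ₘ κ) (stateMeasure ⊗ₘ κ) ∧
      MeasurePreserving swapTime (stateMeasure ⊗ₘ κ) (stateMeasure ⊗ₘ κ) := by
  have hl : ∀ f : State × State × State × State → ℝ≥0∞, Measurable f →
      ∫⁻ p, f p ∂(stateMeasure ⊗ₘ κ)
      = ENNReal.ofReal θ * stdIntegral m δ σs f + ENNReal.ofReal (1 - θ) * resIntegral δ σr f := by
    intro f hf
    rw [Measure.lintegral_compProd hf]
    simp only [hκ]
    exact lintegral_transition hσs hσr θ hf
  refine ⟨⟨measurable_swapInitial, Measure.ext_of_lintegral _ fun f hf => ?_⟩,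
    ⟨measurable_swapTime, Measure.ext_of_lintegral _ fun f hf => ?_⟩⟩
  · rw [lintegral_map hf measurable_swapInitial, hl f hf,
      ← stdIntegral_swapInitial hm hσs hf, ← resIntegral_swapInitial hσr hf]
    exact hl _ (hf.comp measurable_swapInitial)
  · rw [lintegral_map hf measurable_swapTime, hl f hf,
      ← stdIntegral_swapTime hm hσs hf, ← resIntegral_swapTime hσr hf]
    exact hl _ (hf.comp measurable_swapTime)

end Polyatomic
-- Detailed balance and the symmetrized weak form
namespace Polyatomic

open scoped ENNReal ProbabilityTheory
open ProbabilityTheory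

/-- `M M_* / (I I_*)^(δ/2-1)`. -/
def pairWeight (δ : ℝ) (M : State → ℝ) (x y : State) : ℝ :=
  M x * M y / (x.2 * y.2) ^ (δ / 2 - 1)

theorem pairWeight_comm (δ : ℝ) (M : State → ℝ) (x y : State) :
    pairWeight δ M y x = pairWeight δ M x y := by
  unfold pairWeight
  rw [mul_comm (M y), mul_comm y.2]

theorem collisionIntegrand_linearized (δ : ℝ) (M h : State → ℝ) (x : State)
    (p : State × State × State) :
    collisionIntegrand δ M (fun y => M y * h y) x p
      = pairWeight δ M p.2.1 p.2.2 * (h p.2.1 + h p.2.2) - pairWeight δ M x p.1 * (h x + h p.1) := by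
  unfold collisionIntegrand pairWeight
  ring

/-- The weighted change of a function in a collision. -/
def weightedIncrement (δ : ℝ) (M h : State → ℝ) (p : State × State × State × State) : ℝ :=
  pairWeight δ M p.1 p.2.1 * increment h p

/-- The properties of an equilibrium distribution `M` and a kernel of collisions which make the
linearized collision operator symmetric. -/
structure DetailedBalance (δ : ℝ) (M : State → ℝ) (κ : Kernel State (State × State × State)) :
    Prop where
  measurable : Measurable M
  pos : ∀ x : State, 0 < x.2 → 0 < M x
  swapInitial : MeasurePreserving swapInitial (stateMeasure ⊗ₘ κ) (stateMeasure ⊗ₘ κ)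
  swapTime : MeasurePreserving swapTime (stateMeasure ⊗ₘ κ) (stateMeasure ⊗ₘ κ)
  balance : ∀ᵐ p ∂(stateMeasure ⊗ₘ κ),
    pairWeight δ M p.2.2.1 p.2.2.2 = pairWeight δ M p.1 p.2.1

namespace DetailedBalance

variable {m δ θ : ℝ} {σs σr : CrossSection} {M : State → ℝ}
  {κ : Kernel State (State × State × State)} [IsSFiniteKernel κ]

/-- The kernel may have infinite mass, so the first projection is in general not measure preserving.
It does pull null sets back to null sets, which is enough to transport properties that hold almost
everywhere. -/
theorem quasi_fst (κ : Kernel State (State × State × State)) [IsSFiniteKernel κ] :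
    Measure.QuasiMeasurePreserving (fun p : State × State × State × State => p.1)
      (stateMeasure ⊗ₘ κ) stateMeasure := by
  refine ⟨measurable_fst, Measure.AbsolutelyContinuous.mk fun s hs h0 => ?_⟩
  rw [Measure.map_apply measurable_fst hs]
  exact measure_eq_zero_iff_ae_notMem.2
    (Measure.ae_compProd_of_ae_fst κ hs.compl (measure_eq_zero_iff_ae_notMem.1 h0))

/-- The symmetries carry each of the other three states to the first position. -/
theorem quasi (hM : DetailedBalance δ M κ) :
    Measure.QuasiMeasurePreserving (fun p : State × State × State × State => p.2.1)
      (stateMeasure ⊗ₘ κ) stateMeasure ∧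
    Measure.QuasiMeasurePreserving (fun p : State × State × State × State => p.2.2.1)
      (stateMeasure ⊗ₘ κ) stateMeasure ∧
    Measure.QuasiMeasurePreserving (fun p : State × State × State × State => p.2.2.2)
      (stateMeasure ⊗ₘ κ) stateMeasure :=
  ⟨(quasi_fst κ).comp hM.swapInitial.quasiMeasurePreserving,
    (quasi_fst κ).comp hM.swapTime.quasiMeasurePreserving,
    (quasi_fst κ).comp (hM.swapInitial.quasiMeasurePreserving.comp
      hM.swapTime.quasiMeasurePreserving)⟩

theorem aemeasurable_comp (hM : DetailedBalance δ M κ) {h : State → ℝ}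
    (hh : AEMeasurable h stateMeasure) :
    AEMeasurable (fun p : State × State × State × State => h p.1) (stateMeasure ⊗ₘ κ) ∧
    AEMeasurable (fun p : State × State × State × State => h p.2.1) (stateMeasure ⊗ₘ κ) ∧
    AEMeasurable (fun p : State × State × State × State => h p.2.2.1) (stateMeasure ⊗ₘ κ) ∧
    AEMeasurable (fun p : State × State × State × State => h p.2.2.2) (stateMeasure ⊗ₘ κ) :=
  ⟨hh.comp_quasiMeasurePreserving (quasi_fst κ), hh.comp_quasiMeasurePreserving hM.quasi.1,
    hh.comp_quasiMeasurePreserving hM.quasi.2.1, hh.comp_quasiMeasurePreserving hM.quasi.2.2⟩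

-- Balance equates the weights of gain and loss, so the common weight factors out.
omit [IsSFiniteKernel κ] in
theorem ae_integrand (hM : DetailedBalance δ M κ) (h : State → ℝ) :
    ∀ᵐ p ∂(stateMeasure ⊗ₘ κ), collisionIntegrand δ M (fun y => M y * h y) p.1 p.2
      = weightedIncrement δ M h p := by
  filter_upwards [hM.balance] with p hp
  rw [collisionIntegrand_linearized, hp, weightedIncrement, increment]
  ring

theorem ae_weight_pos (hM : DetailedBalance δ M κ) :
    ∀ᵐ p ∂(stateMeasure ⊗ₘ κ), 0 < pairWeight δ M p.1 p.2.1 := by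
  filter_upwards [(quasi_fst κ).ae ae_state_energy_pos, hM.quasi.1.ae ae_state_energy_pos]
    with p h1 h2
  exact div_pos (mul_pos (hM.pos _ h1) (hM.pos _ h2)) (Real.rpow_pos_of_pos (mul_pos h1 h2) _)

theorem aemeasurable_weightedIncrement (hM : DetailedBalance δ M κ) {h : State → ℝ}
    (hh : AEMeasurable h stateMeasure) :
    AEMeasurable (weightedIncrement δ M h) (stateMeasure ⊗ₘ κ) := by
  obtain ⟨h1, h2, h3, h4⟩ := hM.aemeasurable_comp hh
  have hm := hM.measurable
  have hw : Measurable fun p : State × State × State × State => pairWeight δ M p.1 p.2.1 := by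
    unfold pairWeight
    fun_prop
  exact hw.aemeasurable.mul (((h3.add h4).sub h1).sub h2)

/-- Converts the iterated absolute integral of the hypothesis into joint integrability over
collisions, so that symmetries and Fubini can be applied. -/
theorem integrable_weakForm (hM : DetailedBalance δ M κ)
    (hκ : ∀ x, κ x = transition m δ σs σr θ x) {h g : State → ℝ}
    (hh : AEMeasurable h stateMeasure) (hg : AEMeasurable g stateMeasure)
    (hw : WeakFormDefined m δ σs σr θ M h g) :
    Integrable (fun p => weightedIncrement δ M h p * g p.1) (stateMeasure ⊗ₘ κ) := by
  have hmeas : AEMeasurable (fun p => weightedIncrement δ M h p * g p.1) (stateMeasure ⊗ₘ κ) :=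
    (hM.aemeasurable_weightedIncrement hh).mul (hM.aemeasurable_comp hg).1
  refine ⟨hmeas.aestronglyMeasurable, ?_⟩
  have h1 : ∫⁻ p, ‖weightedIncrement δ M h p * g p.1‖ₑ ∂(stateMeasure ⊗ₘ κ)
      = ∫⁻ x, ∫⁻ p, ‖weightedIncrement δ M h (x, p) * g x‖ₑ ∂(κ x) ∂stateMeasure := by
    rw [Measure.compProd, Kernel.lintegral_compProd₀ _ _ _ hmeas.enorm]
    simp
  have h2 := Measure.ae_ae_of_ae_compProd (hM.ae_integrand h)
  rw [HasFiniteIntegral, h1]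
  refine lt_of_eq_of_lt (lintegral_congr_ae ?_) hw
  filter_upwards [h2] with x hx
  rw [← hκ]
  refine lintegral_congr_ae ?_
  filter_upwards [hx] with p hp
  rw [hp]

theorem linOp_mul (hM : DetailedBalance δ M κ) (hκ : ∀ x, κ x = transition m δ σs σr θ x)
    (h g : State → ℝ) : ∀ᵐ x ∂stateMeasure, linOp m δ σs σr θ M h x * (M x * g x)
      = - ∫ p, weightedIncrement δ M h (x, p) * g x ∂(κ x) := by
  filter_upwards [Measure.ae_ae_of_ae_compProd (hM.ae_integrand h), ae_state_energy_pos]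
    with x hx hx0
  have hMx := (hM.pos x hx0).ne'
  -- The constants `-2` and `1/2` and the factors `M⁻¹` and `M` combine to the sign `-1`.
  rw [integral_mul_const, linOp, collisionOp, ← hκ, integral_congr_ae hx]
  field_simp

theorem integrable_linOp_mul (hM : DetailedBalance δ M κ)
    (hκ : ∀ x, κ x = transition m δ σs σr θ x) {h g : State → ℝ}
    (hh : AEMeasurable h stateMeasure) (hg : AEMeasurable g stateMeasure)
    (hw : WeakFormDefined m δ σs σr θ M h g) :
    Integrable (fun x => linOp m δ σs σr θ M h x * (M x * g x)) stateMeasure ∧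
      pairing (linOp m δ σs σr θ M h) (fun x => M x * g x)
        = -∫ p, weightedIncrement δ M h p * g p.1 ∂(stateMeasure ⊗ₘ κ) := by
  have hint := hM.integrable_weakForm hκ hh hg hw
  have hL := hM.linOp_mul hκ h g
  have h1 : Integrable (fun x => ∫ p, weightedIncrement δ M h (x, p) * g x ∂(κ x))
      stateMeasure := by
    rw [Measure.compProd] at hint
    simpa using Integrable.integral_compProd (E := ℝ) hint
  refine ⟨h1.neg.congr (hL.mono fun x hx => hx.symm), ?_⟩
  rw [pairing, integral_congr_ae hL, integral_neg, Measure.integral_compProd hint]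

omit [IsSFiniteKernel κ] in
/-- The symmetrized weak form. -/
theorem weakForm_eq (hM : DetailedBalance δ M κ) {h g : State → ℝ}
    (hint : Integrable (fun p => weightedIncrement δ M h p * g p.1) (stateMeasure ⊗ₘ κ)) :
    Integrable (fun p => weightedIncrement δ M h p * increment g p) (stateMeasure ⊗ₘ κ) ∧
      -∫ p, weightedIncrement δ M h p * g p.1 ∂(stateMeasure ⊗ₘ κ)
        = 1 / 4 * ∫ p, weightedIncrement δ M h p * increment g p ∂(stateMeasure ⊗ₘ κ) := by
  set μ := stateMeasure ⊗ₘ κ with hμ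
  set A : State × State × State × State → ℝ := fun p => weightedIncrement δ M h p * g p.1 with hA
  -- The weighted increment is even under exchange of the incoming molecules and, almost everywhere,
  -- odd under time reversal.
  have hsI : ∀ p, weightedIncrement δ M h (Polyatomic.swapInitial p) = weightedIncrement δ M h p := by
    intro p
    simp only [weightedIncrement, Polyatomic.swapInitial, increment, pairWeight_comm δ M p.1 p.2.1]
    ring
  have hsT : ∀ᵐ p ∂μ, weightedIncrement δ M h (Polyatomic.swapTime p)
      = - weightedIncrement δ M h p := by
    filter_upwards [hM.balance] with p hp
    simp only [weightedIncrement, Polyatomic.swapTime, increment, hp]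
    ring
  have hpres : ∀ {S : State × State × State × State → State × State × State × State},
      MeasurePreserving S μ μ → Integrable (A ∘ S) μ ∧ ∫ p, A (S p) ∂μ = ∫ p, A p ∂μ := by
    intro S hS
    refine ⟨hS.integrable_comp_of_integrable hint, ?_⟩
    have h1 : AEStronglyMeasurable A (Measure.map S μ) := by
      rw [hS.map_eq]; exact hint.aestronglyMeasurable
    rw [← integral_map hS.measurable.aemeasurable h1, hS.map_eq]
  obtain ⟨i2, e2⟩ := hpres hM.swapInitial
  obtain ⟨i3, e3⟩ := hpres hM.swapTime
  obtain ⟨i4, e4⟩ := hpres (hM.swapInitial.comp hM.swapTime)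
  -- The four images of `A` under the symmetries produce `g` at each of the four states, with signs
  -- that add up to `increment g`. All four have the same integral, whence the factor `1/4`.
  have hae : (fun p => weightedIncrement δ M h p * increment g p)
      =ᵐ[μ] fun p => (-(A (Polyatomic.swapTime p))
        + -(A ((Polyatomic.swapInitial ∘ Polyatomic.swapTime) p)))
        + (-(A p) + -(A (Polyatomic.swapInitial p))) := by
    filter_upwards [hsT] with p hp
    simp only [hA, Function.comp_apply, hsI, hp]
    simp only [increment, Polyatomic.swapInitial, Polyatomic.swapTime]
    ring
  have hi := (i3.neg.add i4.neg).add (hint.neg.add i2.neg)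
  refine ⟨hi.congr hae.symm, ?_⟩
  rw [integral_congr_ae hae]
  have hsum : ∫ p, ((-(A (Polyatomic.swapTime p))
        + -(A ((Polyatomic.swapInitial ∘ Polyatomic.swapTime) p)))
        + (-(A p) + -(A (Polyatomic.swapInitial p)))) ∂μ
      = (-(∫ p, A (Polyatomic.swapTime p) ∂μ)
        + -(∫ p, A ((Polyatomic.swapInitial ∘ Polyatomic.swapTime) p) ∂μ))
        + (-(∫ p, A p ∂μ) + -(∫ p, A (Polyatomic.swapInitial p) ∂μ)) := by
    have j1 : Integrable (fun p => -(A (Polyatomic.swapTime p))) μ := i3.neg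
    have j2 : Integrable (fun p => -(A ((Polyatomic.swapInitial ∘ Polyatomic.swapTime) p))) μ :=
      i4.neg
    have j3 : Integrable (fun p => -(A p)) μ := hint.neg
    have j4 : Integrable (fun p => -(A (Polyatomic.swapInitial p))) μ := i2.neg
    have j12 : Integrable (fun p => -(A (Polyatomic.swapTime p))
        + -(A ((Polyatomic.swapInitial ∘ Polyatomic.swapTime) p))) μ := j1.add j2
    have j34 : Integrable (fun p => -(A p) + -(A (Polyatomic.swapInitial p))) μ := j3.add j4
    rw [integral_add j12 j34, integral_add j1 j2, integral_add j3 j4,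
      integral_neg, integral_neg, integral_neg, integral_neg]
  rw [hsum, e2, e3, e4]
  ring

theorem pairing_eq (hM : DetailedBalance δ M κ)
    (hκ : ∀ x, κ x = transition m δ σs σr θ x) {h g : State → ℝ}
    (hh : AEMeasurable h stateMeasure) (hg : AEMeasurable g stateMeasure)
    (hw : WeakFormDefined m δ σs σr θ M h g) :
    pairing (linOp m δ σs σr θ M h) (fun x => M x * g x)
      = 1 / 4 * ∫ p, pairWeight δ M p.1 p.2.1 * (increment h p * increment g p)
          ∂(stateMeasure ⊗ₘ κ) := by
  rw [(hM.integrable_linOp_mul hκ hh hg hw).2,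
    (hM.weakForm_eq (hM.integrable_weakForm hκ hh hg hw)).2]
  simp only [weightedIncrement, mul_assoc]

theorem linOpSymmetric (hM : DetailedBalance δ M κ)
    (hκ : ∀ x, κ x = transition m δ σs σr θ x) : LinOpSymmetric m δ σs σr θ M := by
  intro h g hh hg hhg hgh
  have hcomm : (fun x => M x * h x * linOp m δ σs σr θ M g x)
      = fun x => linOp m δ σs σr θ M g x * (M x * h x) := by
    funext x; ring
  have hp : pairing (fun x => M x * h x) (linOp m δ σs σr θ M g)
      = pairing (linOp m δ σs σr θ M g) (fun x => M x * h x) := by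
    simp only [pairing, mul_comm]
  refine ⟨(hM.integrable_linOp_mul hκ hh.1 hg.1 hhg).1, ?_, ?_⟩
  · rw [hcomm]
    exact (hM.integrable_linOp_mul hκ hg.1 hh.1 hgh).1
  · rw [hp, hM.pairing_eq hκ hh.1 hg.1 hhg, hM.pairing_eq hκ hg.1 hh.1 hgh]
    simp only [mul_comm (increment h _)]

theorem linOpNonneg (hM : DetailedBalance δ M κ)
    (hκ : ∀ x, κ x = transition m δ σs σr θ x) : LinOpNonneg m δ σs σr θ M := by
  intro h hh hw
  refine ⟨(hM.integrable_linOp_mul hκ hh.1 hh.1 hw).1, ?_⟩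
  rw [hM.pairing_eq hκ hh.1 hh.1 hw]
  refine mul_nonneg (by norm_num) (integral_nonneg_of_ae ?_)
  filter_upwards [hM.ae_weight_pos] with p hp
  exact mul_nonneg hp.le (mul_self_nonneg _)

/-- The quadratic form vanishes, and it is the integral of the square of the increment against an
almost everywhere positive weight. -/
theorem ae_increment_eq_zero (hM : DetailedBalance δ M κ)
    (hκ : ∀ x, κ x = transition m δ σs σr θ x) {h : State → ℝ}
    (hh : h ∈ linOpKernel m δ σs σr θ M) :
    ∀ᵐ p ∂(stateMeasure ⊗ₘ κ), increment h p = 0 := by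
  obtain ⟨-, hd, hw, h0⟩ := hh
  have hp := hM.pairing_eq hκ hd.1 hd.1 hw
  have hp0 : pairing (linOp m δ σs σr θ M h) (fun x => M x * h x) = 0 := by
    rw [pairing, integral_congr_ae (g := fun _ => (0 : ℝ))]
    · simp
    · filter_upwards [h0] with x hx
      rw [hx, zero_mul]
  have hi := (hM.weakForm_eq (hM.integrable_weakForm hκ hd.1 hd.1 hw)).1
  simp only [weightedIncrement, mul_assoc] at hi
  rw [hp0] at hp
  have hz : ∫ p, pairWeight δ M p.1 p.2.1 * (increment h p * increment h p)
      ∂(stateMeasure ⊗ₘ κ) = 0 := by linarith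
  rw [integral_eq_zero_iff_of_nonneg_ae _ hi] at hz
  · filter_upwards [hz, hM.ae_weight_pos] with p h1 h2
    have h3 := (mul_eq_zero.1 h1).resolve_left h2.ne'
    exact mul_self_eq_zero.1 h3
  · filter_upwards [hM.ae_weight_pos] with p hp
    exact mul_nonneg hp.le (mul_self_nonneg _)

/-- Functions in `L²(M)` that are conserved in almost every collision belong to the kernel. -/
theorem mem_linOpKernel (hM : DetailedBalance δ M κ)
    (hκ : ∀ x, κ x = transition m δ σs σr θ x) {h : State → ℝ}
    (hL2 : MemLp h 2 (stateMeasure.withDensity fun x => ENNReal.ofReal (M x)))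
    (hh : AEMeasurable h stateMeasure)
    (hinc : ∀ᵐ p ∂(stateMeasure ⊗ₘ κ), increment h p = 0) :
    h ∈ linOpKernel m δ σs σr θ M := by
  have hz : ∀ᵐ x ∂stateMeasure, ∀ᵐ p ∂(transition m δ σs σr θ x),
      collisionIntegrand δ M (fun y => M y * h y) x p = 0 := by
    have h1 : ∀ᵐ p ∂(stateMeasure ⊗ₘ κ),
        collisionIntegrand δ M (fun y => M y * h y) p.1 p.2 = 0 := by
      filter_upwards [hM.ae_integrand h, hinc] with p h1 h2
      rw [h1, weightedIncrement, h2, mul_zero]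
    simpa only [hκ] using Measure.ae_ae_of_ae_compProd h1
  refine ⟨hL2, ⟨hh, ?_⟩, ?_, ?_⟩
  · filter_upwards [hz] with x hx
    exact (integrable_zero _ _ _).congr (hx.mono fun p hp => hp.symm)
  · have h1 : ∫⁻ x, ∫⁻ p, ‖collisionIntegrand δ M (fun y => M y * h y) x p * h x‖ₑ
        ∂(transition m δ σs σr θ x) ∂stateMeasure = ∫⁻ _, 0 ∂stateMeasure := by
      refine lintegral_congr_ae ?_
      filter_upwards [hz] with x hx
      rw [lintegral_congr_ae (g := fun _ => 0), lintegral_zero]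
      filter_upwards [hx] with p hp
      rw [hp, zero_mul, enorm_zero]
    rw [WeakFormDefined, h1, lintegral_zero]
    exact ENNReal.zero_lt_top
  · filter_upwards [hz] with x hx
    rw [linOp, collisionOp, integral_congr_ae hx]
    simp

end DetailedBalance

end Polyatomic
-- From the collision measure to collision parameters, and local integrability
namespace Polyatomic

open scoped ENNReal ProbabilityTheory
open ProbabilityTheory

variable {m δ θ : ℝ} {σs σr : CrossSection} {κ : Kernel State (State × State × State)}
  [IsSFiniteKernel κ]

theorem lintegral_compProd_transition (hσs : IsStandardCrossSection m δ σs)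
    (hσr : IsResonantCrossSection δ σr) (hκ : ∀ x, κ x = transition m δ σs σr θ x)
    {f : State × State × State × State → ℝ≥0∞} (hf : Measurable f) :
    ∫⁻ p, f p ∂(stateMeasure ⊗ₘ κ)
      = ENNReal.ofReal θ * stdIntegral m δ σs f + ENNReal.ofReal (1 - θ) * resIntegral δ σr f := by
  rw [Measure.lintegral_compProd hf]
  simp only [hκ]
  exact lintegral_transition hσs hσr θ hf

/-- Almost all pairs of molecules have different velocities. -/
theorem ae_velocity_ne {B : Type*} [MeasurableSpace B] (β : Measure B) [SFinite β] :
    ∀ᵐ z : State × State × B ∂(stateMeasure.prod (stateMeasure.prod β)), z.1.1 ≠ z.2.1.1 := by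
  have hm : MeasurableSet {z : State × State × B | z.1.1 ≠ z.2.1.1} :=
    (measurableSet_eq_fun (by fun_prop) (by fun_prop)).compl
  refine (Measure.ae_prod_iff_ae_ae hm).2 (Filter.Eventually.of_forall fun x => ?_)
  refine Measure.quasiMeasurePreserving_fst.ae (p := fun y : State => x.1 ≠ y.1) ?_
  refine Measure.quasiMeasurePreserving_fst.ae (p := fun v : Vel => x.1 ≠ v) ?_
  filter_upwards [compl_mem_ae_iff.2 (measure_singleton (μ := (volume : Measure Vel)) x.1)]
    with v hv h
  exact hv h.symm

theorem ae_energies_pos {B : Type*} [MeasurableSpace B] (β : Measure B) [SFinite β] :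
    ∀ᵐ z : State × State × B ∂(stateMeasure.prod (stateMeasure.prod β)),
      0 < z.1.2 * z.2.1.2 := by
  filter_upwards [Measure.quasiMeasurePreserving_fst.ae ae_state_energy_pos,
    Measure.quasiMeasurePreserving_snd.ae (p := fun w : State × B => 0 < w.1.2)
      (Measure.quasiMeasurePreserving_fst.ae ae_state_energy_pos)] with z h1 h2
  exact mul_pos h1 h2

/-- An exceptional set that is null for the collision measure has zero integral against the density,
and the density is positive at almost every possible collision. This is where positivity of the
cross section, distinct velocities and positive energies enter. -/
theorem ae_std_of_ae_compProd (hσs : IsStandardCrossSection m δ σs)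
    (hσr : IsResonantCrossSection δ σr) (hκ : ∀ x, κ x = transition m δ σs σr θ x) (hθ : 0 < θ)
    {P : State × State × State × State → Prop} (hP : ∀ᵐ p ∂(stateMeasure ⊗ₘ κ), P p) :
    ∀ᵐ z : StdParam ∂(stateMeasure.prod (stateMeasure.prod
        (dirMeasure.prod (energyMeasure.prod energyMeasure)))),
      Possible m z.1 z.2.1 z.2.2.2.1 z.2.2.2.2 → P (stdCollision m z) := by
  obtain ⟨N, hNP, hN, hN0⟩ := exists_measurable_superset_of_null (ae_iff.1 hP)
  have hf : Measurable (N.indicator (1 : State × State × State × State → ℝ≥0∞)) :=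
    measurable_one.indicator hN
  have h0 := lintegral_compProd_transition hσs hσr hκ hf
  rw [lintegral_indicator_one hN, hN0, eq_comm, add_eq_zero, mul_eq_zero] at h0
  have hD : Measurable fun z : StdParam =>
      stdDensity m δ σs z.1 z.2 * N.indicator 1 (stdCollision m z) :=
    (measurable_stdDensity hσs.measurable).mul (hf.comp (continuous_stdCollision m).measurable)
  have h1 : ∫⁻ z : StdParam, stdDensity m δ σs z.1 z.2 * N.indicator 1 (stdCollision m z)
      ∂(stateMeasure.prod (stateMeasure.prod
        (dirMeasure.prod (energyMeasure.prod energyMeasure)))) = 0 := by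
    rw [lintegral_prod _ hD.aemeasurable]
    exact h0.1.resolve_left (ENNReal.ofReal_pos.2 hθ).ne'
  filter_upwards [(lintegral_eq_zero_iff hD).1 h1, hσs.pos, ae_velocity_ne _, ae_energies_pos _]
    with z hz hpos hne hen hposs
  by_contra hc
  have hmem : stdCollision m z ∈ N := hNP hc
  simp only [Pi.zero_apply, mul_eq_zero, indicator_of_mem hmem, Pi.one_apply, one_ne_zero,
    or_false, stdDensity, if_pos hposs, ENNReal.ofReal_eq_zero] at hz
  have : 0 < ‖z.1.1 - z.2.1.1‖ := norm_pos_iff.2 (sub_ne_zero.2 hne)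
  exact absurd hz (not_le.2 (mul_pos (mul_pos (Real.rpow_pos_of_pos hen _) this) (hpos hposs)))

theorem ae_res_of_ae_compProd (hσs : IsStandardCrossSection m δ σs)
    (hσr : IsResonantCrossSection δ σr) (hκ : ∀ x, κ x = transition m δ σs σr θ x) (hθ : θ < 1)
    {P : State × State × State × State → Prop} (hP : ∀ᵐ p ∂(stateMeasure ⊗ₘ κ), P p) :
    ∀ᵐ z : ResParam ∂(stateMeasure.prod (stateMeasure.prod (dirMeasure.prod energyMeasure))),
      z.2.2.2 < z.1.2 + z.2.1.2 → P (resCollision z) := by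
  obtain ⟨N, hNP, hN, hN0⟩ := exists_measurable_superset_of_null (ae_iff.1 hP)
  have hf : Measurable (N.indicator (1 : State × State × State × State → ℝ≥0∞)) :=
    measurable_one.indicator hN
  have h0 := lintegral_compProd_transition hσs hσr hκ hf
  rw [lintegral_indicator_one hN, hN0, eq_comm, add_eq_zero, mul_eq_zero, mul_eq_zero] at h0
  have hD : Measurable fun z : ResParam =>
      resDensity δ σr z.1 z.2 * N.indicator 1 (resCollision z) :=
    (measurable_resDensity hσr.measurable).mul (hf.comp continuous_resCollision.measurable)
  have h1 : ∫⁻ z : ResParam, resDensity δ σr z.1 z.2 * N.indicator 1 (resCollision z)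
      ∂(stateMeasure.prod (stateMeasure.prod (dirMeasure.prod energyMeasure))) = 0 := by
    rw [lintegral_prod _ hD.aemeasurable]
    exact h0.2.resolve_left (ENNReal.ofReal_pos.2 (sub_pos.2 hθ)).ne'
  filter_upwards [(lintegral_eq_zero_iff hD).1 h1, hσr.pos, ae_velocity_ne _, ae_energies_pos _]
    with z hz hpos hne hen hposs
  by_contra hc
  have hmem : resCollision z ∈ N := hNP hc
  simp only [Pi.zero_apply, mul_eq_zero, indicator_of_mem hmem, Pi.one_apply, one_ne_zero,
    or_false, resDensity, if_pos hposs, ENNReal.ofReal_eq_zero] at hz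
  have : 0 < ‖z.1.1 - z.2.1.1‖ := norm_pos_iff.2 (sub_ne_zero.2 hne)
  exact absurd hz (not_le.2 (mul_pos (mul_pos (Real.rpow_pos_of_pos hen _) this) (hpos hposs)))

/-- Standard collisions are tested only for `0 < θ`, because the resonant invariants need not be
conserved by them. -/
theorem ae_increment_eq_zero_of_collisions (hσs : IsStandardCrossSection m δ σs)
    (hσr : IsResonantCrossSection δ σr) (hκ : ∀ x, κ x = transition m δ σs σr θ x)
    {φ : State → ℝ} (hφ : Continuous φ)
    (hs : 0 < θ → ∀ z : StdParam, Possible m z.1 z.2.1 z.2.2.2.1 z.2.2.2.2 →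
      increment φ (stdCollision m z) = 0)
    (hr : ∀ z : ResParam, increment φ (resCollision z) = 0) :
    ∀ᵐ p ∂(stateMeasure ⊗ₘ κ), increment φ p = 0 := by
  have hinc : Measurable (increment φ) := by
    unfold increment
    have := hφ.measurable
    fun_prop
  have hN : MeasurableSet {p | increment φ p ≠ 0} :=
    (hinc (measurableSet_singleton 0)).compl
  have hf : Measurable ({p | increment φ p ≠ 0}.indicator
      (1 : State × State × State × State → ℝ≥0∞)) := measurable_one.indicator hN
  have h0 := lintegral_compProd_transition hσs hσr hκ hf
  rw [lintegral_indicator_one hN] at h0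
  refine ae_iff.2 (h0.trans ?_)
  have hr0 : resIntegral δ σr ({p | increment φ p ≠ 0}.indicator 1) = 0 := by
    unfold resIntegral
    simp [indicator, hr]
  rw [hr0, mul_zero, add_zero]
  rcases le_or_gt θ 0 with h | h
  · rw [ENNReal.ofReal_of_nonpos h, zero_mul]
  · have hs0 : stdIntegral m δ σs ({p | increment φ p ≠ 0}.indicator 1) = 0 := by
      have : ∀ x z, stdDensity m δ σs x z
          * {p | increment φ p ≠ 0}.indicator 1 (stdCollision m (x, z)) = 0 := by
        intro x z
        by_cases hp : Possible m x z.1 z.2.2.1 z.2.2.2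
        · rw [indicator_of_notMem (by simpa using hs h (x, z) hp), mul_zero]
        · rw [stdDensity, if_neg hp, zero_mul]
      unfold stdIntegral
      simp [this]
    rw [hs0, mul_zero]

/-- Square integrable functions are locally integrable away from zero internal energy. -/
theorem locallyIntegrable_above {M h : State → ℝ} (hMm : Measurable M)
    (hMc : ContinuousOn M {x | 0 < x.2}) (hM0 : ∀ x : State, 0 < x.2 → 0 < M x)
    (hh : AEMeasurable h stateMeasure)
    (hL : MemLp h 2 (stateMeasure.withDensity fun x => ENNReal.ofReal (M x))) {ε : ℝ}
    (hε : 0 < ε) : LocallyIntegrable (above ε h) := by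
  have hsq := hL.integrable_sq
  rw [integrable_withDensity_iff_integrable_smul' (by fun_prop) (by simp)] at hsq
  refine locallyIntegrable_iff.2 fun K hK => ?_
  have hmeas : MeasurableSet {x : State | ε < x.2} := measurableSet_lt (by fun_prop) (by fun_prop)
  have hcl : IsClosed {x : State | ε ≤ x.2} := isClosed_le (by fun_prop) (by fun_prop)
  have hK' : IsCompact (K ∩ {x : State | ε ≤ x.2}) := hK.inter_right hcl
  -- The closed condition `ε ≤ I` keeps the set compact and inside the region where `M` is
  -- continuous and positive, so `M` is bounded below there.
  obtain ⟨c, hc, hcM⟩ : ∃ c > 0, ∀ x ∈ K ∩ {x : State | ε ≤ x.2}, c ≤ M x := by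
    rcases (K ∩ {x : State | ε ≤ x.2}).eq_empty_or_nonempty with he | hne
    · exact ⟨1, one_pos, by simp [he]⟩
    · obtain ⟨x, hx, hmin⟩ := hK'.exists_isMinOn hne
        (hMc.mono fun x hx => hε.trans_le hx.2)
      exact ⟨M x, hM0 x (hε.trans_le hx.2), fun y hy => hmin hy⟩
  unfold above
  rw [IntegrableOn, integrable_indicator_iff hmeas, IntegrableOn, Measure.restrict_restrict hmeas]
  have hle : (volume : Measure State).restrict ({x : State | ε < x.2} ∩ K) ≤ stateMeasure := by
    rw [stateMeasure_eq_restrict]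
    exact Measure.restrict_mono (fun x hx => hε.trans hx.1) le_rfl
  have hfin : IsFiniteMeasure ((volume : Measure State).restrict ({x : State | ε < x.2} ∩ K)) :=
    ⟨by
      rw [Measure.restrict_apply_univ]
      exact (measure_mono inter_subset_right).trans_lt hK.measure_lt_top⟩
  -- The dominating function comes from `|h| ≤ 1 + h² ≤ 1 + c⁻¹ M h²`.
  refine Integrable.mono' (g := fun x => 1 + c⁻¹ * ((ENNReal.ofReal (M x)).toReal • h x ^ 2))
    ((integrable_const 1).add ((hsq.mono_measure hle).const_mul _))
    (hh.mono_measure hle).aestronglyMeasurable ?_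
  refine (ae_restrict_iff' (hmeas.inter hK.measurableSet)).2 (Filter.Eventually.of_forall ?_)
  rintro x ⟨hx1, hx2⟩
  have hcx := hcM x ⟨hx2, (show ε < x.2 from hx1).le⟩
  rw [ENNReal.toReal_ofReal (hc.le.trans hcx), smul_eq_mul, Real.norm_eq_abs]
  have h1 : h x ^ 2 ≤ c⁻¹ * (M x * h x ^ 2) := by
    rw [← mul_assoc]
    exact le_mul_of_one_le_left (sq_nonneg _) ((one_le_inv_mul₀ hc).2 hcx)
  nlinarith [sq_abs (h x), sq_nonneg (|h x| - 1), abs_nonneg (h x)]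

end Polyatomic
-- Conservation laws, Gibbs distributions and the kernel of the operator
namespace Polyatomic

open scoped ENNReal ProbabilityTheory
open ProbabilityTheory

/-- The parallelogram law about `G - u`, once with half the outgoing and once with half the incoming
relative velocity. -/
theorem norm_sq_outcome (u x y : Vel) (q : ℝ) (ω : Dir) :
    ‖(1 / 2 : ℝ) • (x + y) + (q / 2) • (ω : Vel) - u‖ ^ 2
      + ‖(1 / 2 : ℝ) • (x + y) - (q / 2) • (ω : Vel) - u‖ ^ 2
      = ‖x - u‖ ^ 2 + ‖y - u‖ ^ 2 + (q ^ 2 - ‖x - y‖ ^ 2) / 2 := by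
  have h1 := parallelogram_law_with_norm ℝ ((1 / 2 : ℝ) • (x + y) - u) ((q / 2) • (ω : Vel))
  have h2 := parallelogram_law_with_norm ℝ ((1 / 2 : ℝ) • (x + y) - u) ((1 / 2 : ℝ) • (x - y))
  rw [show (1 / 2 : ℝ) • (x + y) - u + (q / 2) • (ω : Vel)
      = (1 / 2 : ℝ) • (x + y) + (q / 2) • (ω : Vel) - u by abel,
    show (1 / 2 : ℝ) • (x + y) - u - (q / 2) • (ω : Vel)
      = (1 / 2 : ℝ) • (x + y) - (q / 2) • (ω : Vel) - u by abel,
    norm_smul (q / 2), norm_eq_of_mem_sphere ω, Real.norm_eq_abs, mul_one, sq_abs] at h1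
  rw [show (1 / 2 : ℝ) • (x + y) - u + (1 / 2 : ℝ) • (x - y) = x - u by module,
    show (1 / 2 : ℝ) • (x + y) - u - (1 / 2 : ℝ) • (x - y) = y - u by module,
    norm_smul, Real.norm_of_nonneg (by norm_num)] at h2
  linear_combination h1 - h2

theorem increment_normSq_resCollision (u : Vel) (z : ResParam) :
    increment (fun x => ‖x.1 - u‖ ^ 2) (resCollision z) = 0 := by
  have := norm_sq_outcome u z.1.1 z.2.1.1 ‖z.1.1 - z.2.1.1‖ z.2.2.1
  simp only [increment, resCollision, outcome]
  linarith

theorem increment_energy_resCollision (z : ResParam) :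
    increment (fun x => x.2) (resCollision z) = 0 := by
  simp only [increment, resCollision, outcome]
  ring

theorem increment_totalEnergy_stdCollision {m : ℝ} (hm : 0 < m) (u : Vel) {z : StdParam}
    (hz : Possible m z.1 z.2.1 z.2.2.2.1 z.2.2.2.2) :
    increment (fun x => m * ‖x.1 - u‖ ^ 2 + 2 * x.2) (stdCollision m z) = 0 := by
  have h1 := norm_sq_outcome u z.1.1 z.2.1.1
    (Real.sqrt (‖z.1.1 - z.2.1.1‖ ^ 2 - 4 / m * gap z.1 z.2.1 z.2.2.2.1 z.2.2.2.2)) z.2.2.1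
  rw [Real.sq_sqrt (sub_nonneg.2 (le_of_lt hz))] at h1
  simp only [increment, stdCollision, outcome]
  have h2 : m * (4 / m * gap z.1 z.2.1 z.2.2.2.1 z.2.2.2.2)
      = 4 * gap z.1 z.2.1 z.2.2.2.1 z.2.2.2.2 := by field_simp
  simp only [gap] at h1 h2 ⊢
  linear_combination m * h1 - h2 / 2

theorem increment_velocity_stdCollision (m : ℝ) (i : Fin 3) (z : StdParam) :
    increment (fun x => x.1 i) (stdCollision m z) = 0 := by
  simp [increment, stdCollision, outcome]
  ring

theorem increment_velocity_resCollision (i : Fin 3) (z : ResParam) :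
    increment (fun x => x.1 i) (resCollision z) = 0 := by
  simp [increment, resCollision, outcome]
  ring

theorem increment_one (p : State × State × State × State) :
    increment (fun _ => 1) p = 0 := by
  norm_num [increment]

section Kernel

variable {m δ θ : ℝ} {σs σr : CrossSection} {κ : Kernel State (State × State × State)}
  [IsSFiniteKernel κ]

omit [IsSFiniteKernel κ] in
theorem ae_increment_eq_zero_of_mem_span {S : Set (State → ℝ)}
    (hS : ∀ φ ∈ S, ∀ᵐ p ∂(stateMeasure ⊗ₘ κ), increment φ p = 0) {φ : State → ℝ}
    (hφ : φ ∈ Submodule.span ℝ S) : ∀ᵐ p ∂(stateMeasure ⊗ₘ κ), increment φ p = 0 := by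
  induction hφ using Submodule.span_induction with
  | mem φ h => exact hS φ h
  | zero => simp [increment]
  | add φ ψ _ _ h1 h2 =>
    filter_upwards [h1, h2] with p h1 h2
    simp only [increment, Pi.add_apply] at h1 h2 ⊢
    linarith
  | smul a φ _ h =>
    filter_upwards [h] with p h
    simp only [increment, Pi.smul_apply, smul_eq_mul] at h ⊢
    linear_combination a * h

theorem ae_increment_stdInvariants (hm : 0 < m) (hσs : IsStandardCrossSection m δ σs)
    (hσr : IsResonantCrossSection δ σr) (hκ : ∀ x, κ x = transition m δ σs σr θ x) :
    ∀ φ ∈ stdInvariants m, ∀ᵐ p ∂(stateMeasure ⊗ₘ κ), increment φ p = 0 := by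
  rintro φ (rfl | rfl | rfl | rfl | rfl)
  · exact Filter.Eventually.of_forall increment_one
  iterate 3
    exact ae_increment_eq_zero_of_collisions hσs hσr hκ (by fun_prop)
      (fun _ z _ => increment_velocity_stdCollision m _ z)
      (fun z => increment_velocity_resCollision _ z)
  · refine ae_increment_eq_zero_of_collisions hσs hσr hκ (by fun_prop) (fun _ z hz => ?_)
      (fun z => ?_)
    · simpa using increment_totalEnergy_stdCollision hm 0 hz
    · have h1 := increment_normSq_resCollision 0 z
      have h2 := increment_energy_resCollision z
      simp only [increment, sub_zero] at h1 h2 ⊢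
      linear_combination m * h1 + 2 * h2

theorem ae_increment_resInvariants (hσs : IsStandardCrossSection m δ σs)
    (hσr : IsResonantCrossSection δ σr) (hκ : ∀ x, κ x = transition m δ σs σr 0 x) :
    ∀ φ ∈ resInvariants, ∀ᵐ p ∂(stateMeasure ⊗ₘ κ), increment φ p = 0 := by
  rintro φ (rfl | rfl | rfl | rfl | rfl | rfl)
  · exact Filter.Eventually.of_forall increment_one
  iterate 3
    exact ae_increment_eq_zero_of_collisions hσs hσr hκ (by fun_prop)
      (fun h => absurd h (lt_irrefl 0)) (fun z => increment_velocity_resCollision _ z)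
  · exact ae_increment_eq_zero_of_collisions hσs hσr hκ (by fun_prop)
      (fun h => absurd h (lt_irrefl 0)) (fun z => by simpa using increment_normSq_resCollision 0 z)
  · exact ae_increment_eq_zero_of_collisions hσs hσr hκ (by fun_prop)
      (fun h => absurd h (lt_irrefl 0)) increment_energy_resCollision

end Kernel

/-- A distribution which is Gaussian in the velocity and a Gamma distribution in the internal
energy. -/
def gibbs (δ C a b : ℝ) (u : Vel) (x : State) : ℝ :=
  C * x.2 ^ (δ / 2 - 1) * Real.exp (-(a * ‖x.1 - u‖ ^ 2 + b * x.2))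

theorem maxwellianR_eq_gibbs {m δ kB n Ttr Tint : ℝ} (hm : 0 < m) (hδ : 2 ≤ δ) (hkB : 0 < kB)
    (hn : 0 < n) (u : Vel) (hT : 0 < Ttr) (hT' : 0 < Tint) :
    ∃ C > 0, maxwellianR m δ kB n u Ttr Tint
      = gibbs δ C (m / (2 * kB * Ttr)) (1 / (kB * Tint)) u := by
  have hΓ : 0 < Real.Gamma (δ / 2) := Real.Gamma_pos_of_pos (by linarith)
  refine ⟨n / ((2 * Real.pi * kB * Ttr / m) ^ (3 / 2 : ℝ) * (kB * Tint) ^ (δ / 2)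
    * Real.Gamma (δ / 2)), by positivity, ?_⟩
  funext x
  unfold maxwellianR gibbs
  rw [show -(m * ‖x.1 - u‖ ^ 2 / (2 * kB * Ttr)) - x.2 / (kB * Tint)
    = -(m / (2 * kB * Ttr) * ‖x.1 - u‖ ^ 2 + 1 / (kB * Tint) * x.2) by ring]
  ring

theorem maxwellianS_eq_maxwellianR {m δ kB n T : ℝ} (hkB : 0 < kB) (hT : 0 < T) (u : Vel) :
    maxwellianS m δ kB n u T = maxwellianR m δ kB n u T T := by
  funext x
  unfold maxwellianR maxwellianS
  congr 2
  field_simp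
  ring

theorem gibbs_pos {δ C : ℝ} (hC : 0 < C) (a b : ℝ) (u : Vel) (x : State) (hx : 0 < x.2) :
    0 < gibbs δ C a b u x := by
  unfold gibbs
  positivity

theorem measurable_gibbs (δ C a b : ℝ) (u : Vel) : Measurable (gibbs δ C a b u) := by
  unfold gibbs
  fun_prop

theorem continuousOn_gibbs (δ C a b : ℝ) (u : Vel) :
    ContinuousOn (gibbs δ C a b u) {x | 0 < x.2} := by
  unfold gibbs
  refine ContinuousOn.mul (continuousOn_const.mul ?_) (by fun_prop)
  exact continuousOn_snd.rpow_const fun x hx => Or.inl (ne_of_gt hx)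

/-- The division by `(I I_*)^(δ/2-1)` removes exactly the power factors of the two distributions. -/
theorem pairWeight_gibbs (δ C a b : ℝ) (u : Vel) {x y : State} (hx : 0 < x.2) (hy : 0 < y.2) :
    pairWeight δ (gibbs δ C a b u) x y
      = C ^ 2 * Real.exp (-((a * ‖x.1 - u‖ ^ 2 + b * x.2) + (a * ‖y.1 - u‖ ^ 2 + b * y.2))) := by
  have h1 := (Real.rpow_pos_of_pos hx (δ / 2 - 1)).ne'
  have h2 := (Real.rpow_pos_of_pos hy (δ / 2 - 1)).ne'
  unfold pairWeight gibbs
  rw [Real.mul_rpow hx.le hy.le, neg_add (a * ‖x.1 - u‖ ^ 2 + b * x.2), Real.exp_add]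
  field_simp

/-- Balance amounts to conservation of `a |ξ - u|² + b I`. Resonant collisions conserve the two
terms separately. Standard ones conserve only the total energy, so `2a = mb` is needed when they
occur. -/
theorem detailedBalance_gibbs {m δ θ C a b : ℝ} (hm : 0 < m) {σs σr : CrossSection}
    (hσs : IsStandardCrossSection m δ σs) (hσr : IsResonantCrossSection δ σr)
    {κ : Kernel State (State × State × State)} [IsSFiniteKernel κ]
    (hκ : ∀ x, κ x = transition m δ σs σr θ x) (hC : 0 < C) (u : Vel)
    (hab : 0 < θ → 2 * a = m * b) : DetailedBalance δ (gibbs δ C a b u) κ := by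
  obtain ⟨hI, hT⟩ := measurePreserving_compProd_transition hm hσs hσr θ hκ
  have hq := DetailedBalance.quasi_fst κ
  have hinc : ∀ᵐ p ∂(stateMeasure ⊗ₘ κ),
      increment (fun x : State => a * ‖x.1 - u‖ ^ 2 + b * x.2) p = 0 := by
    refine ae_increment_eq_zero_of_collisions hσs hσr hκ (by fun_prop) (fun hθ z hz => ?_)
      (fun z => ?_)
    · have h := increment_totalEnergy_stdCollision hm u hz
      have ha : a = m * b / 2 := by linarith [hab hθ]
      simp only [increment, ha] at h ⊢
      linear_combination b / 2 * h
    · have h1 := increment_normSq_resCollision u z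
      have h2 := increment_energy_resCollision z
      simp only [increment] at h1 h2 ⊢
      linear_combination a * h1 + b * h2
  refine ⟨measurable_gibbs .., gibbs_pos hC a b u, hI, hT, ?_⟩
  filter_upwards [hinc, hq.ae ae_state_energy_pos,
    (hq.comp hI.quasiMeasurePreserving).ae ae_state_energy_pos,
    (hq.comp hT.quasiMeasurePreserving).ae ae_state_energy_pos,
    (hq.comp (hI.quasiMeasurePreserving.comp hT.quasiMeasurePreserving)).ae ae_state_energy_pos]
    with p hp h1 h2 h3 h4
  rw [pairWeight_gibbs (x := p.1) (y := p.2.1) _ _ _ _ _ h1 h2,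
    pairWeight_gibbs (x := p.2.2.1) (y := p.2.2.2) _ _ _ _ _ h3 h4]
  simp only [increment] at hp
  congr 3
  linarith

/-- The rate `a / 4` is chosen so that the square of the bound consumes half of the decay rate of
the Gibbs distribution and leaves the other half for integrability. -/
theorem one_add_two_mul_le_exp {a t : ℝ} (ha : 0 < a) (ht : 0 ≤ t) :
    1 + 2 * t ≤ (1 + 8 / a) * Real.exp (a * t / 4) := by
  have h1 := Real.add_one_le_exp (a * t / 4)
  have h2 : 0 ≤ a * t / 4 := by positivity
  have h3 : 8 / a * (a * t / 4) = 2 * t := by field_simp; ring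
  have h4 : 8 / a * (a * t / 4) ≤ 8 / a * Real.exp (a * t / 4) :=
    mul_le_mul_of_nonneg_left (by linarith) (by positivity)
  linarith

theorem integrable_gibbs {δ a b : ℝ} (hδ : 2 ≤ δ) (C : ℝ) (ha : 0 < a) (hb : 0 < b) (u : Vel) :
    Integrable (gibbs δ C a b u) stateMeasure := by
  have h1 : Integrable fun v : Vel => Real.exp (-(a * ‖v - u‖ ^ 2)) := by
    have h := (GaussianFourier.integrable_cexp_neg_mul_sq_norm_add (b := (a : ℂ)) (by simpa) 0
      (0 : Vel)).norm
    have h' : Integrable fun v : Vel => Real.exp (-(a * ‖v‖ ^ 2)) := by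
      refine h.congr (Filter.Eventually.of_forall fun v => ?_)
      simp [Complex.norm_exp, ← Complex.ofReal_pow]
    exact h'.comp_sub_right u
  have h2 : Integrable (fun I : ℝ => I ^ (δ / 2 - 1) * Real.exp (-b * I)) energyMeasure := by
    -- Integrability at zero energy requires the exponent `δ/2 - 1` to exceed `-1`, which `δ ≥ 2`
    -- ensures.
    have h := integrableOn_rpow_mul_exp_neg_mul_rpow (p := 1) (s := δ / 2 - 1) (b := b)
      (by linarith) one_pos hb
    simp only [Real.rpow_one] at h
    exact h
  refine ((h1.mul_prod h2).const_mul C).congr (Filter.Eventually.of_forall fun x => ?_)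
  simp only [gibbs]
  rw [neg_add, Real.exp_add, neg_mul]
  ring

/-- Polynomially bounded functions are square integrable with respect to a Gibbs distribution. -/
theorem memLp_gibbs {δ C a b : ℝ} (hδ : 2 ≤ δ) (hC : 0 < C) (ha : 0 < a) (hb : 0 < b) (u : Vel) :
    MemLp (fun x : State => (1 + ‖x.1‖ ^ 2) * (1 + |x.2|)) 2
      (stateMeasure.withDensity fun x => ENNReal.ofReal (gibbs δ C a b u x)) := by
  have hmeas : Measurable fun x : State => (1 + ‖x.1‖ ^ 2) * (1 + |x.2|) := by fun_prop
  have hg := measurable_gibbs δ C a b u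
  rw [memLp_two_iff_integrable_sq hmeas.aestronglyMeasurable,
    integrable_withDensity_iff_integrable_smul' (by fun_prop) (by simp)]
  set K : ℝ := (1 + 2 * ‖u‖ ^ 2) * (1 + 8 / a) * (1 + 8 / b) with hK
  refine Integrable.mono' ((integrable_gibbs hδ C (half_pos ha) (half_pos hb) u).const_mul (K ^ 2))
    (by fun_prop) ?_
  filter_upwards [ae_state_energy_pos] with x hx
  have hv : 1 + ‖x.1‖ ^ 2 ≤ (1 + 2 * ‖u‖ ^ 2) * (1 + 2 * ‖x.1 - u‖ ^ 2) := by
    have h1 : ‖x.1‖ ≤ ‖x.1 - u‖ + ‖u‖ := by simpa using norm_add_le (x.1 - u) u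
    have h2 : ‖x.1‖ ^ 2 ≤ (‖x.1 - u‖ + ‖u‖) ^ 2 := by gcongr
    nlinarith [sq_nonneg (‖x.1 - u‖ - ‖u‖), mul_nonneg (sq_nonneg ‖u‖) (sq_nonneg ‖x.1 - u‖)]
  have hv' := one_add_two_mul_le_exp (t := ‖x.1 - u‖ ^ 2) ha (by positivity)
  have he' := one_add_two_mul_le_exp hb hx.le
  have hW : (1 + ‖x.1‖ ^ 2) * (1 + |x.2|)
      ≤ K * Real.exp (a * ‖x.1 - u‖ ^ 2 / 4 + b * x.2 / 4) := by
    rw [abs_of_pos hx, Real.exp_add]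
    calc (1 + ‖x.1‖ ^ 2) * (1 + x.2)
        ≤ ((1 + 2 * ‖u‖ ^ 2) * ((1 + 8 / a) * Real.exp (a * ‖x.1 - u‖ ^ 2 / 4)))
          * ((1 + 8 / b) * Real.exp (b * x.2 / 4)) := by
          refine mul_le_mul (hv.trans ?_) (by linarith) (by positivity) (by positivity)
          gcongr
      _ = _ := by rw [hK]; ring
  have hg0 := gibbs_pos (δ := δ) hC a b u x hx
  rw [ENNReal.toReal_ofReal hg0.le, smul_eq_mul, Real.norm_of_nonneg (by positivity)]
  calc gibbs δ C a b u x * ((1 + ‖x.1‖ ^ 2) * (1 + |x.2|)) ^ 2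
      ≤ gibbs δ C a b u x * (K * Real.exp (a * ‖x.1 - u‖ ^ 2 / 4 + b * x.2 / 4)) ^ 2 := by
        gcongr
    _ = K ^ 2 * gibbs δ C (a / 2) (b / 2) u x := by
        unfold gibbs
        rw [mul_pow, ← Real.exp_nat_mul]
        rw [show -(a / 2 * ‖x.1 - u‖ ^ 2 + b / 2 * x.2) = -(a * ‖x.1 - u‖ ^ 2 + b * x.2)
          + ((2 : ℕ) : ℝ) * (a * ‖x.1 - u‖ ^ 2 / 4 + b * x.2 / 4) by push_cast; ring,
          Real.exp_add]
        ring

/-- The weight `(1 + |ξ|²)(1 + |I|)` dominates all generators of the kernels. -/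
theorem norm_le_weight_of_mem_invariants {m : ℝ} {φ : State → ℝ}
    (hφ : φ ∈ stdInvariants m ∪ resInvariants) (x : State) :
    ‖φ x‖ ≤ (1 + |m| + 2) * ‖(1 + ‖x.1‖ ^ 2) * (1 + |x.2|)‖ := by
  rw [Real.norm_of_nonneg (r := (1 + ‖x.1‖ ^ 2) * (1 + |x.2|)) (by positivity)]
  have hI := abs_nonneg x.2
  have hm := abs_nonneg m
  have hv := sq_nonneg ‖x.1‖
  have hvI := mul_nonneg hv hI
  have hW : 1 + ‖x.1‖ ^ 2 + |x.2| ≤ (1 + ‖x.1‖ ^ 2) * (1 + |x.2|) := by linarith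
  refine le_trans ?_ (mul_le_mul_of_nonneg_left hW (by positivity))
  have hmv := mul_nonneg hm hv
  have hmI := mul_nonneg hm hI
  have hi : ∀ i, ‖x.1 i‖ ≤ 1 + ‖x.1‖ ^ 2 := fun i => by
    have := PiLp.norm_apply_le x.1 i
    nlinarith [sq_nonneg (‖x.1‖ - 1)]
  rcases hφ with (rfl | rfl | rfl | rfl | rfl) | (rfl | rfl | rfl | rfl | rfl | rfl)
  · rw [norm_one]; nlinarith
  · have := hi 0; nlinarith
  · have := hi 1; nlinarith
  · have := hi 2; nlinarith
  · have h1 := norm_add_le (m * ‖x.1‖ ^ 2) (2 * x.2)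
    simp only [norm_mul, Real.norm_eq_abs, abs_pow, abs_norm, Nat.abs_ofNat] at h1 ⊢
    nlinarith
  · rw [norm_one]; nlinarith
  · have := hi 0; nlinarith
  · have := hi 1; nlinarith
  · have := hi 2; nlinarith
  · rw [Real.norm_of_nonneg hv]; nlinarith
  · rw [Real.norm_eq_abs]; nlinarith

theorem measurable_of_mem_invariants {m : ℝ} {φ : State → ℝ}
    (hφ : φ ∈ stdInvariants m ∪ resInvariants) : Measurable φ := by
  rcases hφ with (rfl | rfl | rfl | rfl | rfl) | (rfl | rfl | rfl | rfl | rfl | rfl) <;> fun_prop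

/-- Changing a function on a null set is harmless, since each of the four states of a collision
avoids a given null set almost surely. -/
theorem generatedBy_subset_linOpKernel {m δ θ : ℝ} {σs σr : CrossSection} {M : State → ℝ}
    {κ : Kernel State (State × State × State)} [IsSFiniteKernel κ] (hM : DetailedBalance δ M κ)
    (hκ : ∀ x, κ x = transition m δ σs σr θ x)
    (hW : MemLp (fun x : State => (1 + ‖x.1‖ ^ 2) * (1 + |x.2|)) 2
      (stateMeasure.withDensity fun x => ENNReal.ofReal (M x)))
    {S : Set (State → ℝ)} (hS : S ⊆ stdInvariants m ∪ resInvariants)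
    (hinc : ∀ φ ∈ S, ∀ᵐ p ∂(stateMeasure ⊗ₘ κ), increment φ p = 0) :
    generatedBy S ⊆ linOpKernel m δ σs σr θ M := by
  rintro h ⟨φ, hφ, hae⟩
  have hprop : Measurable φ ∧
      MemLp φ 2 (stateMeasure.withDensity fun x => ENNReal.ofReal (M x)) := by
    clear hae
    induction hφ using Submodule.span_induction with
    | mem φ h =>
      have := measurable_of_mem_invariants (hS h)
      exact ⟨this, hW.of_le_mul this.aestronglyMeasurable
        (Filter.Eventually.of_forall fun x => norm_le_weight_of_mem_invariants (hS h) x)⟩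
    | zero => exact ⟨measurable_zero, MemLp.zero⟩
    | add φ ψ _ _ h1 h2 => exact ⟨h1.1.add h2.1, h1.2.add h2.2⟩
    | smul c φ _ h1 => exact ⟨h1.1.const_smul c, h1.2.const_smul c⟩
  refine hM.mem_linOpKernel hκ
    (hprop.2.ae_eq ((withDensity_absolutelyContinuous _ _).ae_le hae.symm))
    (hprop.1.aemeasurable.congr hae.symm) ?_
  obtain ⟨q2, q3, q4⟩ := hM.quasi
  filter_upwards [ae_increment_eq_zero_of_mem_span hinc hφ,
    (DetailedBalance.quasi_fst κ).ae hae, q2.ae hae, q3.ae hae, q4.ae hae]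
    with p h0 h1 h2 h3 h4
  rw [increment, h1, h2, h3, h4]
  exact h0

section Gibbs

variable {m δ C a b : ℝ} {σs σr : CrossSection}

theorem linOp_gibbs_standard {θ : ℝ} (hm : 0 < m) (hδ : 2 ≤ δ)
    (hσs : IsStandardCrossSection m δ σs) (hσr : IsResonantCrossSection δ σr) (hC : 0 < C)
    (ha : 0 < a) (hb : 0 < b) (u : Vel) (hθ : 0 < θ) (hab : 2 * a = m * b) :
    LinOpSymmetric m δ σs σr θ (gibbs δ C a b u) ∧ LinOpNonneg m δ σs σr θ (gibbs δ C a b u) ∧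
      linOpKernel m δ σs σr θ (gibbs δ C a b u) = generatedBy (stdInvariants m) := by
  obtain ⟨κ, _, hκ⟩ := exists_transition_kernel hσs hσr θ
  have hM := detailedBalance_gibbs hm hσs hσr hκ hC u fun _ => hab
  refine ⟨hM.linOpSymmetric hκ, hM.linOpNonneg hκ, Subset.antisymm (fun h hh => ?_) ?_⟩
  · exact mem_generatedBy_of_std hm
      (fun ε hε => locallyIntegrable_above (measurable_gibbs ..) (continuousOn_gibbs δ C a b u)
        (gibbs_pos hC a b u) hh.2.1.1 hh.1 hε)
      (ae_std_of_ae_compProd hσs hσr hκ hθ (hM.ae_increment_eq_zero hκ hh))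
  · exact generatedBy_subset_linOpKernel hM hκ (memLp_gibbs hδ hC ha hb u) subset_union_left
      (ae_increment_stdInvariants hm hσs hσr hκ)

theorem linOp_gibbs_resonant (hm : 0 < m) (hδ : 2 ≤ δ)
    (hσs : IsStandardCrossSection m δ σs) (hσr : IsResonantCrossSection δ σr) (hC : 0 < C)
    (ha : 0 < a) (hb : 0 < b) (u : Vel) :
    LinOpSymmetric m δ σs σr 0 (gibbs δ C a b u) ∧ LinOpNonneg m δ σs σr 0 (gibbs δ C a b u) ∧
      linOpKernel m δ σs σr 0 (gibbs δ C a b u) = generatedBy resInvariants := by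
  obtain ⟨κ, _, hκ⟩ := exists_transition_kernel hσs hσr 0
  have hM := detailedBalance_gibbs (a := a) (b := b) hm hσs hσr hκ hC u
    fun h => absurd h (lt_irrefl 0)
  refine ⟨hM.linOpSymmetric hκ, hM.linOpNonneg hκ, Subset.antisymm (fun h hh => ?_) ?_⟩
  · exact mem_generatedBy_of_res
      (fun ε hε => locallyIntegrable_above (measurable_gibbs ..) (continuousOn_gibbs δ C a b u)
        (gibbs_pos hC a b u) hh.2.1.1 hh.1 hε)
      (ae_res_of_ae_compProd hσs hσr hκ one_pos (hM.ae_increment_eq_zero hκ hh))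
  · exact generatedBy_subset_linOpKernel (m := m) hM hκ (memLp_gibbs hδ hC ha hb u)
      subset_union_right (ae_increment_resInvariants hσs hσr hκ)

end Gibbs

end Polyatomic

end

theorem mainTheorem5 (m δ kB n : ℝ) (hm : 0 < m) (hδ : 2 ≤ δ) (hkB : 0 < kB) (hn : 0 < n)
    (u : Polyatomic.Vel) (σs σr : Polyatomic.CrossSection)
    (hσs : Polyatomic.IsStandardCrossSection m δ σs)
    (hσr : Polyatomic.IsResonantCrossSection δ σr) :
    (∀ θ T : ℝ, 0 < θ → θ ≤ 1 → 0 < T →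
      Polyatomic.LinOpSymmetric m δ σs σr θ (Polyatomic.maxwellianS m δ kB n u T) ∧
      Polyatomic.LinOpNonneg m δ σs σr θ (Polyatomic.maxwellianS m δ kB n u T) ∧
      Polyatomic.linOpKernel m δ σs σr θ (Polyatomic.maxwellianS m δ kB n u T)
        = Polyatomic.generatedBy
            {fun _ => 1, fun x => x.1 0, fun x => x.1 1, fun x => x.1 2,
              fun x => m * ‖x.1‖ ^ 2 + 2 * x.2}) ∧
    (∀ Ttr Tint : ℝ, 0 < Ttr → 0 < Tint →
      Polyatomic.LinOpSymmetric m δ σs σr 0 (Polyatomic.maxwellianR m δ kB n u Ttr Tint) ∧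
      Polyatomic.LinOpNonneg m δ σs σr 0 (Polyatomic.maxwellianR m δ kB n u Ttr Tint) ∧
      Polyatomic.linOpKernel m δ σs σr 0 (Polyatomic.maxwellianR m δ kB n u Ttr Tint)
        = Polyatomic.generatedBy
            {fun _ => 1, fun x => x.1 0, fun x => x.1 1, fun x => x.1 2,
              fun x => ‖x.1‖ ^ 2, fun x => x.2}) := by
  refine ⟨fun θ T hθ _ hT => ?_, fun Ttr Tint hTtr hTint => ?_⟩
  · obtain ⟨C, hC, h⟩ := Polyatomic.maxwellianR_eq_gibbs hm hδ hkB hn u hT hT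
    rw [Polyatomic.maxwellianS_eq_maxwellianR hkB hT, h]
    -- The remaining condition `2a = mb` holds because translational and internal temperatures
    -- agree: `a = m / (2 kB T)` and `b = 1 / (kB T)`.
    exact Polyatomic.linOp_gibbs_standard hm hδ hσs hσr hC (by positivity) (by positivity) u hθ
      (by field_simp)
  · obtain ⟨C, hC, h⟩ := Polyatomic.maxwellianR_eq_gibbs hm hδ hkB hn u hTtr hTint
    rw [h]
    exact Polyatomic.linOp_gibbs_resonant hm hδ hσs hσr hC (by positivity) (by positivity) u
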